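/- Let $F$ be the bowtie, i.e. the graph on five vertices formed by two triangles that share exactly one vertex. Let $\mathrm{ex}(n,F)$ be the maximum number of edges of an $n$-vertex graph with no subgraph isomorphic to $F$, and let $h_F(n,q)$ be the minimum number of subgraphs isomorphic to $F$ in a graph with $n$ vertices and $\mathrm{ex}(n,F)+q$ edges. For every $c>0$ there is $\delta>0$ such that for all natural numbers $n\ge 1/\delta$ and $0\le q\le \delta n^2$ the following holds. If $2(q+1)=dn+m$ with integers $d\ge 0$ and $0\le m<n$, and $$e_1=\left\lfloor \frac{dn}{4}+\frac{\min\{m,n/2\}}{2}\right\rfloor,\qquad e_2=q+1-e_1,$$ then $(1-c)M\le h_F(n,q)\le(1+c)M$, where $$M=\frac n2\left[\binom{e_1}{2}+\binom{e_2}{2}+m\binom{d+1}{2}\frac n2+(n-m)\binom d2\frac n2+4e_1e_2\right].$$ In particular, $h_F(n,q)=(1+o(1))\,\frac98\,q^2n$ whenever $n\to\infty$, $q/n\to\infty$ and $q/n^2\to 0$; that is, for all sequences $(n_k)$, $(q_k)$ of natural numbers with $n_k\to\infty$, $q_k/n_k\to\infty$ and $q_k/n_k^2\to0$, the ratio of $h_F(n_k,q_k)$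 to $\frac98q_k^2n_k$ tends to $1$. -/

import Mathlib

/-- The bowtie: two triangles `0 1 2` and `0 3 4` sharing exactly the (central) vertex `0`. -/
def bowtie : SimpleGraph (Fin 5) :=
  SimpleGraph.fromEdgeSet {s(0, 1), s(0, 2), s(1, 2), s(0, 3), s(0, 4), s(3, 4)}

/-- The supersaturation function `h_F(n, q)`: the minimum number of subgraphs isomorphic to `F`
over all graphs with `n` vertices and `ex(n, F) + q` edges.
(If there is no such graph, the value is the junk value `0`.) -/
noncomputable def supersat {W : Type*} (F : SimpleGraph W) (n q : ℕ) : ℕ :=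
  sInf {k : ℕ | ∃ H : SimpleGraph (Fin n),
    H.edgeSet.ncard = SimpleGraph.extremalNumber n F + q ∧ H.copyCount F = k}

/-!
Each graph with `ex(n, F) + q` edges, where `F` is the bowtie, has `n ^ 2 / 4 + t` edges with
`t = q + 1` once `n` is large (`extremalNumber_bowtie`). The count is governed by the edges inside
the classes of a nearly balanced bipartition, the *inner edges*.

*Lower bound* (`bowties_lower`). A graph with few bowties has few triangles, since triangles at a
vertex typically form bowties (`bowties_ge`). A stability argument, with the neighbourhood of a
vertex of maximum degree as one class, gives a bipartition with few inner edges
(`exists_partition`), and a maximum cut improves it to one where no vertex prefers its own class.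
Vertices of large degree in their own class are centres of many bowties, so there are few of them,
and vertices with many missing edges to the other class cost more edges than their inner edges
regain. What remains (`exists_structure`) is a set `I` of inner edges, about `t` or more, whose ends
are adjacent to almost all of the opposite class, and whose number exceeds `t` when edges between
these ends are missing.

If `t` is much larger than `n`, each edge of `I` lies in about `n / 2` triangles and each of these
has three vertices, so the Cauchy-Schwarz inequality over the centres gives `9 / 8 * t ^ 2 * n`
bowties, which is never less than the main term (`bowties_ge_of_many`, `mainTerm_le`). Otherwise the
bowties are counted over pairs of edges of `I`, according to whether the edges are disjoint in the
same class, lie in opposite classes, or share a vertex (`bowties_ge_of_inner`). A missing edge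
destroys bowties of pairs in opposite classes; all but one of the pairs at a missing edge are
charged to pairs that share a vertex (`sum_miss_mul_le`), and that one is repaid by the additional
edge of `I` (`sq_degrees_ge`). What remains is to minimise a function of the split of `2 t` into the
degree sums of the two classes, where the degrees enter through a convex function on the integers,
bounded by its tangents. Between breakpoints the function is concave, and the optimum is the split
of the theorem (`split_optimal`).

*Upper bound* (`bowties_upper`). The optimum is attained by a balanced complete bipartite graph with
a nearly regular graph with `e₁` edges in one class and one with `e₂` edges in the other. A graph
that minimises the sum of the squares of the degrees is nearly regular (`exists_nearly_regular`).

All counts are sums of real indicators over ordered tuples of vertices, so that each bowtie is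
counted eight times (`bowties_eq`), each edge twice and each triangle six times.
-/

/-! ### Bowties as ordered tuples -/

section Tuples

open scoped Classical

/-- The real indicator of a proposition. -/
noncomputable def ind (p : Prop) : ℝ := if p then 1 else 0

lemma ind_nonneg (p : Prop) : 0 ≤ ind p := by unfold ind; split_ifs <;> norm_num

lemma ind_le_one (p : Prop) : ind p ≤ 1 := by unfold ind; split_ifs <;> norm_num

lemma ind_of {p : Prop} (h : p) : ind p = 1 := by simp [ind, h]

lemma ind_of_not {p : Prop} (h : ¬p) : ind p = 0 := by simp [ind, h]

lemma ind_and (p q : Prop) : ind (p ∧ q) = ind p * ind q := by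
  by_cases hp : p <;> by_cases hq : q <;> simp [ind, hp, hq]

lemma ind_mono {p q : Prop} (h : p → q) : ind p ≤ ind q := by
  by_cases hp : p
  · rw [ind_of hp, ind_of (h hp)]
  · rw [ind_of_not hp]; exact ind_nonneg q

lemma ind_congr {p q : Prop} (h : p ↔ q) : ind p = ind q := by rw [propext h]

lemma sum_ind {α : Type*} [Fintype α] (p : α → Prop) [DecidablePred p] :
    ∑ a, ind (p a) = ((Finset.univ.filter p).card : ℝ) := by
  rw [← Finset.sum_boole]
  refine Finset.sum_congr rfl fun a _ => ?_
  by_cases h : p a <;> simp [ind, h]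

/-- The indicator of `x`, `y` spanning a triangle with `v`. -/
noncomputable def tri {V : Type*} (G : SimpleGraph V) (v x y : V) : ℝ :=
  ind (G.Adj v x ∧ G.Adj v y ∧ G.Adj x y)

/-- The indicator of the pairs `{x, y}` and `{u, w}` being disjoint. -/
noncomputable def apart {V : Type*} (x y u w : V) : ℝ :=
  ind (x ≠ u ∧ x ≠ w ∧ y ≠ u ∧ y ≠ w)

/-- The number of ordered bowties `(v, x, y, u, w)`: the centre `v`, then the other vertices of the
two triangles. Each bowtie is counted eight times. -/
noncomputable def bowties {V : Type*} [Fintype V] (G : SimpleGraph V) : ℝ :=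
  ∑ v, ∑ x, ∑ y, ∑ u, ∑ w, tri G v x y * tri G v u w * apart x y u w

lemma bowtie_adj_iff (a b : Fin 5) : bowtie.Adj a b ↔
    (a = 0 ∧ b ≠ 0) ∨ (b = 0 ∧ a ≠ 0) ∨ (a = 1 ∧ b = 2) ∨ (a = 2 ∧ b = 1) ∨
      (a = 3 ∧ b = 4) ∨ (a = 4 ∧ b = 3) := by
  rw [bowtie, SimpleGraph.fromEdgeSet_adj]
  fin_cases a <;> fin_cases b <;> simp

/-- The bowtie has eight automorphisms: the images of `1` and `3`, one vertex from each of the two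
outer edges, determine the others. -/
lemma card_bowtie_aut : Nat.card (bowtie ≃g bowtie) = 8 := by
  let D : Fin 5 → Fin 5 → Bool := fun a b =>
    (a == 0 && b != 0) || (b == 0 && a != 0) || (a == 1 && b == 2) || (a == 2 && b == 1) ||
      (a == 3 && b == 4) || (a == 4 && b == 3)
  have hD : ∀ a b, bowtie.Adj a b ↔ D a b := fun a b => by
    rw [bowtie_adj_iff]
    simp [D, or_assoc]
  -- the other end of an outer edge
  let s : Fin 5 → Fin 5 := ![0, 2, 1, 4, 3]
  let P : Fin 5 × Fin 5 → Bool := fun q => q.1 != 0 && q.2 != 0 && q.1 != q.2 && !D q.1 q.2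
  have hcentre : ∀ z, (∀ y, y ≠ z → D z y) → z = 0 := by decide
  have hother : ∀ a b, a ≠ 0 → b ≠ 0 → D a b → b = s a := by decide
  have hP : Fintype.card {q // P q} = 8 := by decide
  have hinj : ∀ a b, P (a, b) → ∀ x y : Fin 5,
      (![0, a, s a, b, s b] : Fin 5 → Fin 5) x = (![0, a, s a, b, s b] : Fin 5 → Fin 5) y →
        x = y := by decide +kernel
  have hadj : ∀ a b, P (a, b) → ∀ x y : Fin 5,
      D ((![0, a, s a, b, s b] : Fin 5 → Fin 5) x) ((![0, a, s a, b, s b] : Fin 5 → Fin 5) y) =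
        D x y := by decide +kernel
  have h0 : ∀ σ : bowtie ≃g bowtie, σ 0 = 0 := fun σ => hcentre _ fun y hy => by
    rw [← hD, ← σ.apply_symm_apply y, σ.map_adj_iff, hD]
    have : σ.symm y ≠ 0 := fun h => hy (by rw [← h, σ.apply_symm_apply])
    simpa [D] using this
  have hne : ∀ (σ : bowtie ≃g bowtie) a, a ≠ 0 → σ a ≠ 0 := fun σ a ha h =>
    ha (σ.injective (h.trans (h0 σ).symm))
  have hs : ∀ (σ : bowtie ≃g bowtie) a b, a ≠ 0 → b ≠ 0 → D a b → σ b = s (σ a) :=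
    fun σ a b ha hb h => hother _ _ (hne σ a ha) (hne σ b hb)
      ((hD _ _).1 (σ.map_adj_iff.2 ((hD _ _).2 h)))
  rw [← hP, ← Nat.card_eq_fintype_card]
  refine Nat.card_congr (Equiv.ofBijective (fun σ => ⟨(σ 1, σ 3), ?_⟩) ⟨?_, ?_⟩)
  · have h13 : ¬D (σ 1) (σ 3) := by
      rw [← hD, σ.map_adj_iff, hD]
      decide
    simp [P, hne σ 1, hne σ 3, h13]
  · intro σ τ h
    have h := congrArg Subtype.val h
    simp only [Prod.mk.injEq] at h
    ext a
    congr 1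
    fin_cases a
    · exact (h0 σ).trans (h0 τ).symm
    · exact h.1
    · exact (hs σ 1 2 (by decide) (by decide) (by decide)).trans
        ((congrArg s h.1).trans (hs τ 1 2 (by decide) (by decide) (by decide)).symm)
    · exact h.2
    · exact (hs σ 3 4 (by decide) (by decide) (by decide)).trans
        ((congrArg s h.2).trans (hs τ 3 4 (by decide) (by decide) (by decide)).symm)
  · rintro ⟨⟨a, b⟩, hab⟩
    have hbij := Finite.injective_iff_bijective.1 (fun x y => hinj a b hab x y)
    exact ⟨⟨Equiv.ofBijective _ hbij, fun {x y} => by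
      rw [hD, hD]
      exact iff_of_eq (congrArg (· = true) (hadj a b hab x y))⟩, rfl⟩

/-- Copies with the same image differ by an automorphism of the bowtie, so that each subgraph
isomorphic to the bowtie is the image of eight copies. -/
lemma card_copy_bowtie {V : Type*} [Fintype V] (G : SimpleGraph V) :
    Nat.card (SimpleGraph.Copy bowtie G) = 8 * G.copyCount bowtie := by
  have : Fintype {f : bowtie →g G // Function.Injective f} := Fintype.ofFinite _
  have : Finite (bowtie ≃g bowtie) := Nat.finite_of_card_ne_zero (by rw [card_bowtie_aut]; simp)
  have : Fintype (bowtie ≃g bowtie) := Fintype.ofFinite _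
  have hverts : ∀ (f : SimpleGraph.Copy bowtie G) (v : V),
      v ∈ f.toSubgraph.verts ↔ v ∈ Set.range f := fun f v => by simp
  have hadj : ∀ (f : SimpleGraph.Copy bowtie G) (x y : V),
      f.toSubgraph.Adj x y ↔ ∃ a b, bowtie.Adj a b ∧ f a = x ∧ f b = y := fun f x y => by
    simp [Relation.Map]
  rw [SimpleGraph.copyCount_eq_card_image_copyToSubgraph, Nat.card_eq_fintype_card,
    ← Finset.card_univ, Finset.card_eq_sum_card_image SimpleGraph.Copy.toSubgraph,
    Finset.sum_const_nat (m := 8), mul_comm]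
  intro S hS
  obtain ⟨f, -, rfl⟩ := Finset.mem_image.1 hS
  rw [← card_bowtie_aut, Nat.card_eq_fintype_card, ← Finset.card_univ]
  symm
  apply Finset.card_bij (fun (σ : bowtie ≃g bowtie) _ => f.comp σ.toCopy)
  · intro σ _
    simp only [Finset.mem_filter, Finset.mem_univ, true_and]
    ext x y
    · rw [hverts, hverts]
      constructor
      · rintro ⟨a, rfl⟩
        exact ⟨σ a, rfl⟩
      · rintro ⟨a, rfl⟩
        exact ⟨σ.symm a, by simp⟩
    · rw [hadj, hadj]
      constructor
      · rintro ⟨a, b, h, rfl, rfl⟩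
        exact ⟨σ a, σ b, σ.map_rel_iff.2 h, rfl, rfl⟩
      · rintro ⟨a, b, h, rfl, rfl⟩
        exact ⟨σ.symm a, σ.symm b, σ.symm.map_rel_iff.2 h, by simp, by simp⟩
  · intro σ _ τ _ h
    ext a
    have := congrArg (fun g : SimpleGraph.Copy bowtie G => g a) h
    have := f.injective this
    simpa using congrArg Fin.val this
  · intro g hg
    simp only [Finset.mem_filter, Finset.mem_univ, true_and] at hg
    have hr : Set.range g = Set.range f := by
      ext v
      rw [← hverts, ← hverts, hg]
    let σ : Fin 5 ≃ Fin 5 := (Equiv.ofInjective g g.injective).trans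
      ((Equiv.setCongr hr).trans (Equiv.ofInjective f f.injective).symm)
    have hσ : ∀ a, f (σ a) = g a := fun a => by
      have := Equiv.apply_ofInjective_symm f.injective (Equiv.setCongr hr ⟨g a, a, rfl⟩)
      simpa [σ] using this
    have hA : ∀ (k : SimpleGraph.Copy bowtie G) (a b : Fin 5),
        k.toSubgraph.Adj (k a) (k b) ↔ bowtie.Adj a b := fun k a b => by
      rw [hadj]
      constructor
      · rintro ⟨a', b', h, ha, hb⟩
        rwa [← k.injective ha, ← k.injective hb]
      · exact fun h => ⟨a, b, h, rfl, rfl⟩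
    refine ⟨⟨σ, fun {a b} => ?_⟩, Finset.mem_univ _, ?_⟩
    · rw [← hA f, hσ, hσ, ← hg, hA g]
    · ext a
      exact hσ a

/-- The conditions for `(p₀, p₁, p₂, p₃, p₄)` to be an ordered bowtie. -/
def IsBowtie {V : Type*} (G : SimpleGraph V) (p : V × V × V × V × V) : Prop :=
  (G.Adj p.1 p.2.1 ∧ G.Adj p.1 p.2.2.1 ∧ G.Adj p.2.1 p.2.2.1) ∧
    (G.Adj p.1 p.2.2.2.1 ∧ G.Adj p.1 p.2.2.2.2 ∧ G.Adj p.2.2.2.1 p.2.2.2.2) ∧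
    (p.2.1 ≠ p.2.2.2.1 ∧ p.2.1 ≠ p.2.2.2.2 ∧ p.2.2.1 ≠ p.2.2.2.1 ∧ p.2.2.1 ≠ p.2.2.2.2)

lemma card_copy_eq_card_isBowtie {V : Type*} (G : SimpleGraph V) :
    Nat.card (SimpleGraph.Copy bowtie G) = Nat.card {p // IsBowtie G p} := by
  apply Nat.card_congr
  refine Equiv.ofBijective (fun f => ⟨(f 0, f 1, f 2, f 3, f 4), ?_⟩) ⟨?_, ?_⟩
  · have h : ∀ a b, bowtie.Adj a b → G.Adj (f a) (f b) := fun a b h => f.toHom.map_adj h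
    have hi : ∀ a b, a ≠ b → f a ≠ f b := fun a b h => f.injective.ne h
    refine ⟨⟨h _ _ ?_, h _ _ ?_, h _ _ ?_⟩, ⟨h _ _ ?_, h _ _ ?_, h _ _ ?_⟩,
      hi _ _ ?_, hi _ _ ?_, hi _ _ ?_, hi _ _ ?_⟩ <;> simp [bowtie_adj_iff]
  · intro f g h
    have h := congrArg Subtype.val h
    simp only [Prod.mk.injEq] at h
    ext a
    fin_cases a
    exacts [h.1, h.2.1, h.2.2.1, h.2.2.2.1, h.2.2.2.2]
  · rintro ⟨⟨v, x, y, u, w⟩, ⟨h1, h2, h3⟩, ⟨h4, h5, h6⟩, h7, h8, h9, h10⟩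
    simp only at *
    refine ⟨⟨⟨![v, x, y, u, w], ?_⟩, ?_⟩, rfl⟩
    · intro a b hab
      rw [bowtie_adj_iff] at hab
      fin_cases a <;> fin_cases b <;> simp at hab <;>
        simp [h1, h2, h3, h4, h5, h6, h1.symm, h2.symm, h3.symm, h4.symm, h5.symm, h6.symm]
    · intro a b hab
      have := h1.ne; have := h2.ne; have := h3.ne; have := h4.ne; have := h5.ne; have := h6.ne
      fin_cases a <;> fin_cases b <;> simp_all

/-- The ordered bowties are the copies of the bowtie, eight for each subgraph isomorphic to it. -/
lemma bowties_eq {V : Type*} [Fintype V] (G : SimpleGraph V) :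
    bowties G = 8 * (G.copyCount bowtie : ℝ) := by
  have h1 : bowties G = ∑ p : V × V × V × V × V, ind (IsBowtie G p) := by
    simp only [Fintype.sum_prod_type, bowties, tri, apart, IsBowtie, ind_and]
    simp only [mul_assoc]
  rw [h1, sum_ind, ← Fintype.card_subtype, ← Nat.card_eq_fintype_card,
    ← card_copy_eq_card_isBowtie, card_copy_bowtie]
  push_cast
  rfl

end Tuples

/-! ### Triangles and bowties -/

section Triangles

open scoped Classical

variable {V : Type*}

lemma tri_nonneg (G : SimpleGraph V) (v x y : V) : 0 ≤ tri G v x y := ind_nonneg _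

lemma tri_le_one (G : SimpleGraph V) (v x y : V) : tri G v x y ≤ 1 := ind_le_one _

lemma apart_nonneg (x y u w : V) : 0 ≤ apart x y u w := ind_nonneg _

lemma apart_le_one (x y u w : V) : apart x y u w ≤ 1 := ind_le_one _

lemma apart_ge (x y u w : V) :
    1 - ind (x = u) - ind (x = w) - ind (y = u) - ind (y = w) ≤ apart x y u w := by
  unfold apart
  by_cases h1 : x = u <;> by_cases h2 : x = w <;> by_cases h3 : y = u <;> by_cases h4 : y = w <;>
    simp [ind, h1, h2, h3, h4] <;> (try split_ifs) <;> norm_num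

variable [Fintype V]

/-- The degree of a vertex, as a real number. -/
noncomputable def rdeg (G : SimpleGraph V) (x : V) : ℝ := ∑ y, ind (G.Adj x y)

/-- The number of ordered pairs spanning a triangle with `v`, that is, twice the number of
triangles at `v`. -/
noncomputable def triAt (G : SimpleGraph V) (v : V) : ℝ := ∑ x, ∑ y, tri G v x y

/-- The number of ordered bowties with centre `v`. -/
noncomputable def bowtiesAt (G : SimpleGraph V) (v : V) : ℝ :=
  ∑ x, ∑ y, ∑ u, ∑ w, tri G v x y * tri G v u w * apart x y u w

lemma triAt_nonneg (G : SimpleGraph V) (v : V) : 0 ≤ triAt G v :=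
  Finset.sum_nonneg fun _ _ => Finset.sum_nonneg fun _ _ => tri_nonneg _ _ _ _

lemma bowtiesAt_nonneg (G : SimpleGraph V) (v : V) : 0 ≤ bowtiesAt G v :=
  Finset.sum_nonneg fun _ _ => Finset.sum_nonneg fun _ _ => Finset.sum_nonneg fun _ _ =>
    Finset.sum_nonneg fun _ _ =>
      mul_nonneg (mul_nonneg (tri_nonneg _ _ _ _) (tri_nonneg _ _ _ _)) (apart_nonneg _ _ _ _)

lemma bowties_eq_sum (G : SimpleGraph V) : bowties G = ∑ v, bowtiesAt G v := rfl

lemma sum_ind_eq (a : V) : ∑ b, ind (a = b) = 1 := by simp [ind]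

lemma sum_ind_eq' (a : V) : ∑ b, ind (b = a) = 1 := by simp [ind]

lemma sum_mul_ind_eq' (f : V → ℝ) (a : V) : ∑ b, f b * ind (b = a) = f a := by simp [ind]

/-- Two triangles at `v` form a bowtie unless they share a further vertex, and a triangle shares one
with at most `2 n` others. -/
lemma bowtiesAt_ge (G : SimpleGraph V) (v : V) :
    triAt G v ^ 2 - 4 * Fintype.card V * triAt G v ≤ bowtiesAt G v := by
  have hpt : ∀ x y u w, tri G v x y * tri G v u w
      - tri G v x y * (ind (x = u) + ind (x = w) + ind (y = u) + ind (y = w))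
      ≤ tri G v x y * tri G v u w * apart x y u w := by
    intro x y u w
    have h1 := tri_nonneg G v x y
    have h2 := tri_nonneg G v u w
    have h3 := tri_le_one G v u w
    have h4 := apart_ge x y u w
    have h5 : 0 ≤ ind (x = u) + ind (x = w) + ind (y = u) + ind (y = w) := by
      have := ind_nonneg (x = u); have := ind_nonneg (x = w); have := ind_nonneg (y = u)
      have := ind_nonneg (y = w); positivity
    have h6 : tri G v u w - (ind (x = u) + ind (x = w) + ind (y = u) + ind (y = w))
        ≤ tri G v u w * apart x y u w := by
      nlinarith
    nlinarith
  have hsum : ∑ x, ∑ y, ∑ u, ∑ w, (tri G v x y * tri G v u w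
      - tri G v x y * (ind (x = u) + ind (x = w) + ind (y = u) + ind (y = w)))
      = triAt G v ^ 2 - 4 * Fintype.card V * triAt G v := by
    have hin : ∀ x y : V, ∑ u : V, ∑ w : V, (ind (x = u) + ind (x = w) + ind (y = u) + ind (y = w))
        = 4 * Fintype.card V := by
      intro x y
      simp only [Finset.sum_add_distrib, sum_ind_eq, Finset.sum_const, Finset.card_univ,
        nsmul_eq_mul, mul_one, ← Finset.mul_sum]
      ring
    calc _ = ∑ x, ∑ y, (tri G v x y * triAt G v - tri G v x y * (4 * Fintype.card V)) := by
          refine Finset.sum_congr rfl fun x _ => Finset.sum_congr rfl fun y _ => ?_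
          simp only [Finset.sum_sub_distrib, ← Finset.mul_sum]
          rw [hin]
          rfl
      _ = _ := by
          simp only [Finset.sum_sub_distrib, ← Finset.sum_mul]
          unfold triAt
          ring
  rw [← hsum]
  exact Finset.sum_le_sum fun x _ => Finset.sum_le_sum fun y _ => Finset.sum_le_sum fun u _ =>
    Finset.sum_le_sum fun w _ => hpt x y u w

/-- Six times the number of triangles. -/
noncomputable def triTotal (G : SimpleGraph V) : ℝ := ∑ v, triAt G v

/-- The triangles alone give many bowties, by the Cauchy-Schwarz inequality over the centres. -/
lemma bowties_ge (G : SimpleGraph V) :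
    triTotal G ^ 2 - 4 * (Fintype.card V : ℝ) ^ 2 * triTotal G ≤ Fintype.card V * bowties G := by
  have h1 : triTotal G ^ 2 ≤ Fintype.card V * ∑ v, triAt G v ^ 2 := by
    have := sq_sum_le_card_mul_sum_sq (s := (Finset.univ : Finset V)) (f := triAt G)
    simpa [triTotal] using this
  have h2 : ∑ v, triAt G v ^ 2 - 4 * Fintype.card V * triTotal G ≤ bowties G := by
    rw [bowties_eq_sum, triTotal, Finset.mul_sum, ← Finset.sum_sub_distrib]
    exact Finset.sum_le_sum fun v _ => bowtiesAt_ge G v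
  have h3 : (0 : ℝ) ≤ Fintype.card V := by positivity
  nlinarith [mul_le_mul_of_nonneg_left h2 h3]

lemma sum_rdeg (G : SimpleGraph V) : ∑ x, rdeg G x = 2 * (G.edgeSet.ncard : ℝ) := by
  have h : ∀ x, rdeg G x = (G.degree x : ℝ) := by
    intro x
    rw [rdeg, sum_ind, ← SimpleGraph.card_neighborFinset_eq_degree]
    congr 2
    ext y
    simp
  simp only [h]
  rw [← SimpleGraph.coe_edgeFinset, Set.ncard_coe_finset]
  exact_mod_cast G.sum_degrees_eq_twice_card_edges

lemma rdeg_nonneg (G : SimpleGraph V) (x : V) : 0 ≤ rdeg G x :=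
  Finset.sum_nonneg fun _ _ => ind_nonneg _

lemma rdeg_le_card (G : SimpleGraph V) (x : V) : rdeg G x ≤ Fintype.card V := by
  calc rdeg G x ≤ ∑ _y : V, (1 : ℝ) := Finset.sum_le_sum fun _ _ => ind_le_one _
    _ = Fintype.card V := by simp

end Triangles

/-! ### Stability: a partition with few inner edges -/

section Stability

open scoped Classical

variable {V : Type*} [Fintype V]

/-- The number of neighbours of `x` in its own class of the partition `p`. -/
noncomputable def inDeg (G : SimpleGraph V) (p : V → Bool) (x : V) : ℝ :=
  ∑ y, ind (G.Adj x y ∧ p x = p y)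

/-- The number of neighbours of `x` in the other class of the partition `p`. -/
noncomputable def crossDeg (G : SimpleGraph V) (p : V → Bool) (x : V) : ℝ :=
  ∑ y, ind (G.Adj x y ∧ p x ≠ p y)

/-- The number of non-neighbours of `x` in the other class of the partition `p`. -/
noncomputable def missDeg (G : SimpleGraph V) (p : V → Bool) (x : V) : ℝ :=
  ∑ y, ind (p x ≠ p y ∧ ¬G.Adj x y)

/-- The size of a class of the partition `p`. -/
noncomputable def classCard (p : V → Bool) (i : Bool) : ℝ := ∑ x, ind (p x = i)

lemma inDeg_nonneg (G : SimpleGraph V) (p : V → Bool) (x : V) : 0 ≤ inDeg G p x :=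
  Finset.sum_nonneg fun _ _ => ind_nonneg _

lemma missDeg_nonneg (G : SimpleGraph V) (p : V → Bool) (x : V) : 0 ≤ missDeg G p x :=
  Finset.sum_nonneg fun _ _ => ind_nonneg _

lemma inDeg_le_rdeg (G : SimpleGraph V) (p : V → Bool) (x : V) : inDeg G p x ≤ rdeg G x :=
  Finset.sum_le_sum fun _ _ => ind_mono fun h => h.1

lemma rdeg_eq (G : SimpleGraph V) (p : V → Bool) (x : V) :
    rdeg G x = inDeg G p x + crossDeg G p x := by
  rw [rdeg, inDeg, crossDeg, ← Finset.sum_add_distrib]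
  refine Finset.sum_congr rfl fun y _ => ?_
  by_cases h1 : G.Adj x y <;> by_cases h2 : p x = p y <;> simp [ind, h1, h2]

lemma classCard_add (p : V → Bool) : classCard p true + classCard p false = Fintype.card V := by
  rw [classCard, classCard, ← Finset.sum_add_distrib]
  have : ∀ x, ind (p x = true) + ind (p x = false) = 1 := fun x => by
    cases h : p x <;> simp [ind]
  simp [this]

lemma classCard_eq (p : V → Bool) (i : Bool) :
    classCard p i = ((Finset.univ.filter fun x => p x = i).card : ℝ) := sum_ind _

lemma classCard_nonneg (p : V → Bool) (i : Bool) : 0 ≤ classCard p i :=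
  Finset.sum_nonneg fun _ _ => ind_nonneg _

lemma crossDeg_add_missDeg (G : SimpleGraph V) (p : V → Bool) (x : V) :
    crossDeg G p x + missDeg G p x = classCard p (!p x) := by
  rw [crossDeg, missDeg, classCard, ← Finset.sum_add_distrib]
  refine Finset.sum_congr rfl fun y _ => ?_
  by_cases h1 : G.Adj x y <;> cases h2 : p x <;> cases h3 : p y <;> simp [ind, h1]

lemma sum_classCard_not (p : V → Bool) :
    ∑ x, classCard p (!p x) = 2 * (classCard p true * classCard p false) := by
  have : ∀ x, classCard p (!p x) = ind (p x = true) * classCard p false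
      + ind (p x = false) * classCard p true := fun x => by
    cases h : p x <;> simp [ind]
  simp only [this, Finset.sum_add_distrib, ← Finset.sum_mul]
  rw [← classCard, ← classCard]
  ring

/-- The edges inside the classes outnumber the missing edges across by the excess of the number of
edges over `n ^ 2 / 4`. -/
lemma sum_inDeg_eq (G : SimpleGraph V) (p : V → Bool) :
    ∑ x, inDeg G p x = 2 * (G.edgeSet.ncard : ℝ) + ∑ x, missDeg G p x
      - 2 * (classCard p true * classCard p false) := by
  rw [← sum_classCard_not, ← sum_rdeg]
  simp only [rdeg_eq G p, ← crossDeg_add_missDeg G, Finset.sum_add_distrib]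
  ring

lemma classCard_mul_le (p : V → Bool) :
    classCard p true * classCard p false ≤ ((Fintype.card V ^ 2 / 4 : ℕ) : ℝ) := by
  have h := classCard_add p
  rw [classCard_eq, classCard_eq] at h ⊢
  set a := (Finset.univ.filter fun x => p x = true).card
  set b := (Finset.univ.filter fun x => p x = false).card
  have h' : a + b = Fintype.card V := by exact_mod_cast h
  rw [← h', ← Nat.cast_mul]
  norm_cast
  rw [Nat.le_div_iff_mul_le (by norm_num)]
  zify
  nlinarith [sq_nonneg ((a : ℤ) - b)]

/-- Splitting the vertices into the neighbourhood of a vertex of maximum degree among those in few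
triangles, and the rest, leaves few edges inside the classes. -/
lemma exists_partition (G : SimpleGraph V) (θ : ℝ) (hθ : 0 < θ)
    (he : (Fintype.card V : ℝ) ^ 2 / 2 ≤ 2 * (G.edgeSet.ncard : ℝ)) :
    ∃ p : V → Bool, ∑ x, inDeg G p x ≤ 2 * θ + 2 * Fintype.card V * (triTotal G / θ) := by
  set n : ℝ := (Fintype.card V : ℝ) with hn
  have hn0 : 0 ≤ n := by positivity
  -- the vertices in many triangles are few
  have hbad : ∑ x, ind (θ < triAt G x) ≤ triTotal G / θ := by
    rw [le_div_iff₀ hθ, Finset.sum_mul, triTotal]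
    refine Finset.sum_le_sum fun x _ => ?_
    by_cases h : θ < triAt G x
    · rw [ind_of h]; linarith
    · rw [ind_of_not h]; linarith [triAt_nonneg G x]
  by_cases hgood : ∃ v, triAt G v ≤ θ
  · obtain ⟨v, hv, hmax⟩ : ∃ v, triAt G v ≤ θ ∧ ∀ x, triAt G x ≤ θ → rdeg G x ≤ rdeg G v := by
      obtain ⟨v, hv, hmax⟩ := Finset.exists_max_image (Finset.univ.filter fun v => triAt G v ≤ θ)
        (rdeg G) (by obtain ⟨v, hv⟩ := hgood; exact ⟨v, by simpa using hv⟩)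
      exact ⟨v, by simpa using hv, fun x hx => hmax x (by simpa using hx)⟩
    refine ⟨fun x => decide (G.Adj v x), ?_⟩
    set p : V → Bool := fun x => decide (G.Adj v x) with hp
    have hpt : ∀ x, p x = true ↔ G.Adj v x := fun x => by simp [hp]
    have hpf : ∀ x, p x = false ↔ ¬G.Adj v x := fun x => by simp [hp]
    -- an edge inside the neighbourhood of `v` is a triangle at `v`
    have hA : ∑ x, ind (p x = true) * inDeg G p x = triAt G v := by
      rw [triAt]
      refine Finset.sum_congr rfl fun x _ => ?_
      rw [inDeg, Finset.mul_sum]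
      refine Finset.sum_congr rfl fun y _ => ?_
      rw [← ind_and]
      apply ind_congr
      constructor
      · rintro ⟨h1, h2, h3⟩
        exact ⟨(hpt x).1 h1, (hpt y).1 (h3 ▸ h1), h2⟩
      · rintro ⟨h1, h2, h3⟩
        exact ⟨(hpt x).2 h1, h3, ((hpt x).2 h1).trans ((hpt y).2 h2).symm⟩
    have ha : classCard p true = rdeg G v := by
      rw [classCard, rdeg]
      exact Finset.sum_congr rfl fun x _ => ind_congr (hpt x)
    have hcross : ∑ x, ind (p x = true) * crossDeg G p x
        = ∑ x, ind (p x = false) * crossDeg G p x := by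
      simp only [crossDeg, Finset.mul_sum, ← ind_and]
      rw [Finset.sum_comm]
      refine Finset.sum_congr rfl fun x _ => Finset.sum_congr rfl fun y _ => ind_congr ?_
      rw [G.adj_comm]
      cases p x <;> cases p y <;> simp
    have hsplit : ∀ f : V → ℝ, ∑ x, f x
        = ∑ x, ind (p x = true) * f x + ∑ x, ind (p x = false) * f x := fun f => by
      rw [← Finset.sum_add_distrib]
      refine Finset.sum_congr rfl fun x _ => ?_
      cases p x <;> simp [ind]
    have hB : ∑ x, ind (p x = false) * rdeg G x
        ≤ classCard p false * rdeg G v + n * (triTotal G / θ) := by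
      calc ∑ x, ind (p x = false) * rdeg G x
          ≤ ∑ x, (ind (p x = false) * rdeg G v + n * ind (θ < triAt G x)) := by
            refine Finset.sum_le_sum fun x _ => ?_
            have h1 := rdeg_le_card G x
            have h2 := rdeg_nonneg G v
            have h3 := ind_nonneg (p x = false)
            have h4 := ind_le_one (p x = false)
            have h5 := rdeg_nonneg G x
            by_cases h : θ < triAt G x
            · rw [ind_of h]
              nlinarith [mul_nonneg h3 h2]
            · rw [ind_of_not h]
              have := hmax x (not_lt.1 h)
              nlinarith
        _ = classCard p false * rdeg G v + n * ∑ x, ind (θ < triAt G x) := by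
            rw [Finset.sum_add_distrib, ← Finset.sum_mul, ← Finset.mul_sum, classCard]
        _ ≤ _ := by gcongr
    have h1 := hsplit (rdeg G)
    have h2 := hsplit (inDeg G p)
    have h3 := sum_rdeg G
    have h4 := classCard_add p
    have h5 : ∀ i, ∑ x, ind (p x = i) * rdeg G x = ∑ x, ind (p x = i) * inDeg G p x
        + ∑ x, ind (p x = i) * crossDeg G p x := fun i => by
      rw [← Finset.sum_add_distrib]
      refine Finset.sum_congr rfl fun x _ => ?_
      rw [rdeg_eq G p]; ring
    have h6 := h5 true
    have h7 := h5 false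
    -- the first class is the neighbourhood of `v`, so this is the product of the class sizes
    have h8 : classCard p false * rdeg G v ≤ n ^ 2 / 4 := by
      rw [ha] at h4
      nlinarith [sq_nonneg (classCard p false - rdeg G v)]
    linarith
  · -- if all vertices are in many triangles, the bound is trivial
    push Not at hgood
    refine ⟨fun _ => true, ?_⟩
    have h1 : n ≤ triTotal G / θ := by
      refine le_trans (le_of_eq ?_) hbad
      simp [ind, hgood, hn]
    have h2 : ∑ x, inDeg G (fun _ => true) x ≤ n * n := by
      calc ∑ x, inDeg G (fun _ => true) x ≤ ∑ _x : V, n :=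
            Finset.sum_le_sum fun x _ => (inDeg_le_rdeg G _ x).trans (rdeg_le_card G x)
        _ = n * n := by simp [hn]
    nlinarith

/-- Moving a vertex to the other class exchanges its inner and its crossing edges. -/
lemma sum_inDeg_update (G : SimpleGraph V) (p : V → Bool) (x : V) :
    ∑ y, inDeg G (Function.update p x (!p x)) y
      = ∑ y, inDeg G p y + 2 * (crossDeg G p x - inDeg G p x) := by
  have key : ∀ y z, ind (G.Adj y z ∧ Function.update p x (!p x) y = Function.update p x (!p x) z)
      = ind (G.Adj y z ∧ p y = p z)
        + (ind (G.Adj x z ∧ p x ≠ p z) - ind (G.Adj x z ∧ p x = p z)) * ind (y = x)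
        + (ind (G.Adj x y ∧ p x ≠ p y) - ind (G.Adj x y ∧ p x = p y)) * ind (z = x) := by
    intro y z
    by_cases hy : y = x
    · subst hy
      by_cases hz : z = y
      · subst hz
        simp [ind]
      · by_cases h1 : G.Adj y z <;> cases h2 : p y <;> cases h3 : p z <;>
          simp [ind, hz, h1, h3]
    · by_cases hz : z = x
      · subst hz
        by_cases h1 : G.Adj y z <;> cases h2 : p y <;> cases h3 : p z <;>
          simp [ind, hy, h1, h2, G.adj_comm z y]
      · simp [ind, hz, hy]
  calc ∑ y, inDeg G (Function.update p x (!p x)) y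
      = ∑ y, (inDeg G p y + (crossDeg G p x - inDeg G p x) * ind (y = x)
          + (ind (G.Adj x y ∧ p x ≠ p y) - ind (G.Adj x y ∧ p x = p y))) := by
        refine Finset.sum_congr rfl fun y _ => ?_
        rw [inDeg, Finset.sum_congr rfl fun z _ => key y z, Finset.sum_add_distrib,
          Finset.sum_add_distrib, ← Finset.sum_mul, ← Finset.mul_sum, sum_ind_eq',
          Finset.sum_sub_distrib]
        simp only [inDeg, crossDeg, mul_one]
    _ = _ := by
        rw [Finset.sum_add_distrib, Finset.sum_add_distrib, ← Finset.mul_sum, sum_ind_eq',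
          Finset.sum_sub_distrib]
        rw [← inDeg, ← crossDeg]
        ring

/-- A partition with few inner edges in which every vertex has at least as many neighbours in the
other class as in its own: the one that minimises the number of inner edges. -/
lemma exists_max_cut (G : SimpleGraph V) (θ : ℝ) (hθ : 0 < θ)
    (he : (Fintype.card V : ℝ) ^ 2 / 2 ≤ 2 * (G.edgeSet.ncard : ℝ)) :
    ∃ p : V → Bool, ∑ x, inDeg G p x ≤ 2 * θ + 2 * Fintype.card V * (triTotal G / θ) ∧
      ∀ x, inDeg G p x ≤ crossDeg G p x := by
  obtain ⟨p₀, hp₀⟩ := exists_partition G θ hθ he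
  obtain ⟨p, -, hp⟩ := Finset.exists_min_image (Finset.univ : Finset (V → Bool))
    (fun p => ∑ x, inDeg G p x) ⟨p₀, Finset.mem_univ _⟩
  refine ⟨p, (hp p₀ (Finset.mem_univ _)).trans hp₀, fun x => ?_⟩
  have := hp (Function.update p x (!p x)) (Finset.mem_univ _)
  rw [sum_inDeg_update] at this
  linarith

end Stability

/-! ### Counting bowties over pairs of inner edges -/

section PairCount

open scoped Classical

variable {V : Type*} [Fintype V]

/-- The bilinear form that counts pairs of disjoint pairs. -/
noncomputable def pairSum (f g : V → V → ℝ) : ℝ :=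
  ∑ x, ∑ y, ∑ u, ∑ w, f x y * g u w * apart x y u w

lemma bowtiesAt_eq_pairSum (G : SimpleGraph V) (v : V) :
    bowtiesAt G v = pairSum (tri G v) (tri G v) := rfl

lemma pairSum_add_left (f₁ f₂ g : V → V → ℝ) :
    pairSum (fun x y => f₁ x y + f₂ x y) g = pairSum f₁ g + pairSum f₂ g := by
  simp only [pairSum, add_mul, Finset.sum_add_distrib]

omit [Fintype V] in
lemma apart_symm (x y u w : V) : apart x y u w = apart u w x y := by
  apply ind_congr
  simp only [ne_comm (a := u), ne_comm (a := w)]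
  tauto

omit [Fintype V] in
lemma apart_swap (x y u w : V) : apart x y u w = apart y x u w := by
  apply ind_congr
  tauto

lemma pairSum_comm (f g : V → V → ℝ) : pairSum f g = pairSum g f := by
  calc pairSum f g = ∑ q : V × V, ∑ s : V × V, f q.1 q.2 * g s.1 s.2 * apart q.1 q.2 s.1 s.2 := by
        simp only [Fintype.sum_prod_type, pairSum]
    _ = ∑ q : V × V, ∑ s : V × V, g q.1 q.2 * f s.1 s.2 * apart q.1 q.2 s.1 s.2 := by
        rw [Finset.sum_comm]
        refine Finset.sum_congr rfl fun q _ => Finset.sum_congr rfl fun s _ => ?_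
        rw [apart_symm]; ring
    _ = pairSum g f := by simp only [Fintype.sum_prod_type, pairSum]

lemma pairSum_swap_left (f g : V → V → ℝ) : pairSum (fun x y => f y x) g = pairSum f g := by
  unfold pairSum
  rw [Finset.sum_comm]
  refine Finset.sum_congr rfl fun x _ => Finset.sum_congr rfl fun y _ =>
    Finset.sum_congr rfl fun u _ => Finset.sum_congr rfl fun w _ => ?_
  rw [apart_swap]

lemma pairSum_add_right (f g₁ g₂ : V → V → ℝ) :
    pairSum f (fun x y => g₁ x y + g₂ x y) = pairSum f g₁ + pairSum f g₂ := by
  rw [pairSum_comm, pairSum_add_left, pairSum_comm g₁, pairSum_comm g₂]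

lemma pairSum_mono {f₁ f₂ g₁ g₂ : V → V → ℝ} (hf₀ : ∀ x y, 0 ≤ f₁ x y) (hg₀ : ∀ x y, 0 ≤ g₁ x y)
    (hf : ∀ x y, f₁ x y ≤ f₂ x y) (hg : ∀ x y, g₁ x y ≤ g₂ x y) :
    pairSum f₁ g₁ ≤ pairSum f₂ g₂ := by
  refine Finset.sum_le_sum fun x _ => Finset.sum_le_sum fun y _ =>
    Finset.sum_le_sum fun u _ => Finset.sum_le_sum fun w _ => ?_
  exact mul_le_mul_of_nonneg_right
    (mul_le_mul (hf x y) (hg u w) (hg₀ u w) ((hf₀ x y).trans (hf x y))) (apart_nonneg _ _ _ _)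

/-- The expansion of the form at a sum of a symmetric function and the two orientations of another
one. -/
lemma pairSum_expand (f g : V → V → ℝ) :
    pairSum (fun x y => f x y + (g x y + g y x)) (fun x y => f x y + (g x y + g y x))
      = pairSum f f + 4 * pairSum f g + 4 * pairSum g g := by
  have h1 : ∀ k, pairSum (fun x y => f x y + (g x y + g y x)) k
      = pairSum f k + (pairSum g k + pairSum g k) := fun k => by
    rw [pairSum_add_left, pairSum_add_left, pairSum_swap_left g k]
  have h2 : ∀ k, pairSum k (fun x y => f x y + (g x y + g y x))
      = pairSum k f + (pairSum k g + pairSum k g) := fun k => by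
    rw [pairSum_comm, h1, pairSum_comm f, pairSum_comm g]
  rw [h1, h2, h2, pairSum_comm g f]
  ring

/-- The indicator of a triangle `v x y` whose edge `x y` belongs to `I` and lies in the class
opposite to `v`. -/
noncomputable def farTri (G I : SimpleGraph V) (p : V → Bool) (v x y : V) : ℝ :=
  ind (I.Adj x y ∧ p x ≠ p v ∧ G.Adj v x ∧ G.Adj v y)

/-- The indicator of a triangle `v x y` whose edge `v x` belongs to `I`, with `y` in the class
opposite to `v`. -/
noncomputable def nearTri (G I : SimpleGraph V) (p : V → Bool) (v x y : V) : ℝ :=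
  ind (I.Adj v x ∧ p y ≠ p v ∧ G.Adj v y ∧ G.Adj x y)

/-- The indicator of a missing edge between the classes. -/
noncomputable def miss (G : SimpleGraph V) (p : V → Bool) (x y : V) : ℝ :=
  ind (p x ≠ p y ∧ ¬G.Adj x y)

omit [Fintype V] in
lemma miss_nonneg (G : SimpleGraph V) (p : V → Bool) (x y : V) : 0 ≤ miss G p x y := ind_nonneg _

omit [Fintype V] in
lemma miss_comm (G : SimpleGraph V) (p : V → Bool) (x y : V) : miss G p x y = miss G p y x := by
  apply ind_congr
  rw [G.adj_comm, ne_comm]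

lemma missDeg_eq (G : SimpleGraph V) (p : V → Bool) (x : V) :
    missDeg G p x = ∑ y, miss G p x y := rfl

lemma rdeg_eq_zero_or_one_le (G : SimpleGraph V) (x : V) :
    rdeg G x = 0 ∧ (∀ y, ¬G.Adj x y) ∨ 1 ≤ rdeg G x ∧ ∃ y, G.Adj x y := by
  by_cases h : ∃ y, G.Adj x y
  · right
    obtain ⟨y, hy⟩ := h
    refine ⟨?_, y, hy⟩
    calc (1 : ℝ) = ind (G.Adj x y) := (ind_of hy).symm
      _ ≤ rdeg G x := Finset.single_le_sum (f := fun y => ind (G.Adj x y))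
          (fun _ _ => ind_nonneg _) (Finset.mem_univ y)
  · left
    push Not at h
    exact ⟨Finset.sum_eq_zero fun y _ => ind_of_not (h y), h⟩

lemma rdeg_mul_pred_nonneg (G : SimpleGraph V) (x : V) : 0 ≤ rdeg G x * (rdeg G x - 1) := by
  rcases rdeg_eq_zero_or_one_le G x with h | h
  · rw [h.1]; simp
  · exact mul_nonneg (by linarith [h.1]) (by linarith [h.1])

/-- The sum of `2 * (d.choose 2)` over the degrees `d`. -/
noncomputable def cherries (G : SimpleGraph V) : ℝ := ∑ x, rdeg G x * (rdeg G x - 1)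

lemma cherries_nonneg (G : SimpleGraph V) : 0 ≤ cherries G :=
  Finset.sum_nonneg fun _ _ => rdeg_mul_pred_nonneg _ _

/-- The degree sum over a class, that is, twice the number of edges of `I` in a class when `I` has
no edges between the classes. -/
noncomputable def classDeg (I : SimpleGraph V) (p : V → Bool) (i : Bool) : ℝ :=
  ∑ x, ind (p x = i) * rdeg I x

lemma classDeg_nonneg (I : SimpleGraph V) (p : V → Bool) (i : Bool) : 0 ≤ classDeg I p i :=
  Finset.sum_nonneg fun _ _ => mul_nonneg (ind_nonneg _) (rdeg_nonneg _ _)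

lemma sum_split (p : V → Bool) (f : V → ℝ) :
    ∑ x, f x = ∑ x, ind (p x = true) * f x + ∑ x, ind (p x = false) * f x := by
  rw [← Finset.sum_add_distrib]
  refine Finset.sum_congr rfl fun x _ => ?_
  cases p x <;> simp [ind]

lemma classDeg_add (I : SimpleGraph V) (p : V → Bool) :
    classDeg I p true + classDeg I p false = ∑ x, rdeg I x := (sum_split p _).symm

lemma sum_sum_adj_left (I : SimpleGraph V) (f : V → ℝ) :
    ∑ x, ∑ y, ind (I.Adj x y) * f x = ∑ x, rdeg I x * f x :=
  Finset.sum_congr rfl fun x _ => by rw [← Finset.sum_mul]; rfl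

lemma sum_sum_adj_right (I : SimpleGraph V) (f : V → ℝ) :
    ∑ x, ∑ y, ind (I.Adj x y) * f y = ∑ x, rdeg I x * f x := by
  rw [Finset.sum_comm, ← sum_sum_adj_left]
  simp only [I.adj_comm]

lemma sum_adj_mul_adj_ne (I : SimpleGraph V) (v : V) :
    ∑ x, ∑ u, ind (I.Adj v x) * ind (I.Adj v u) * (1 - ind (u = x))
      = rdeg I v * (rdeg I v - 1) := by
  simp only [← Finset.mul_sum, mul_sub, mul_one, Finset.sum_sub_distrib, mul_assoc,
    sum_mul_ind_eq']
  have e : ∑ x, ind (I.Adj v x) * ind (I.Adj v x) = rdeg I v := by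
    refine Finset.sum_congr rfl fun x _ => ?_
    rw [← ind_and, and_self_iff]
  rw [e, ← Finset.sum_mul, ← rdeg]

lemma sum_classDeg_not_mul (I : SimpleGraph V) (p : V → Bool) :
    ∑ v, classDeg I p (!p v) * rdeg I v = 2 * (classDeg I p true * classDeg I p false) := by
  rw [sum_split p]
  have : ∀ i, ∑ v, ind (p v = i) * (classDeg I p (!p v) * rdeg I v)
      = classDeg I p (!i) * classDeg I p i := by
    intro i
    conv_rhs => rw [classDeg, classDeg, Finset.mul_sum]
    refine Finset.sum_congr rfl fun v _ => ?_
    by_cases h : p v = i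
    · rw [h, classDeg]; ring
    · rw [ind_of_not h]; ring
  rw [this, this]
  simp only [Bool.not_true, Bool.not_false]
  ring

lemma sum_comm_four (F : V → V → V → V → V → ℝ) :
    ∑ v, ∑ x, ∑ y, ∑ u, ∑ w, F v x y u w = ∑ x, ∑ y, ∑ u, ∑ w, ∑ v, F v x y u w := by
  rw [Finset.sum_comm]
  refine Finset.sum_congr rfl fun x _ => ?_
  rw [Finset.sum_comm]
  refine Finset.sum_congr rfl fun y _ => ?_
  rw [Finset.sum_comm]
  refine Finset.sum_congr rfl fun u _ => ?_
  rw [Finset.sum_comm]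

section Lower

variable {G I : SimpleGraph V} {p : V → Bool} {r h g : ℝ}

omit [Fintype V] in
lemma farTri_add_nearTri_le (hI : I ≤ G) (hp : ∀ x y, I.Adj x y → p x = p y) (v x y : V) :
    farTri G I p v x y + (nearTri G I p v x y + nearTri G I p v y x) ≤ tri G v x y := by
  unfold farTri nearTri tri
  by_cases h1 : I.Adj x y ∧ p x ≠ p v ∧ G.Adj v x ∧ G.Adj v y
  · have h2 : ¬I.Adj v x := fun hh => h1.2.1 (hp _ _ hh).symm
    have h3 : ¬I.Adj v y := fun hh => h1.2.1 ((hp _ _ h1.1).trans (hp _ _ hh).symm)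
    rw [ind_of h1, ind_of_not (fun hh => h2 hh.1), ind_of_not (fun hh => h3 hh.1),
      ind_of ⟨h1.2.2.1, h1.2.2.2, hI h1.1⟩]
    norm_num
  · rw [ind_of_not h1]
    by_cases h2 : I.Adj v x ∧ p y ≠ p v ∧ G.Adj v y ∧ G.Adj x y
    · have h3 : ¬I.Adj v y := fun hh => h2.2.1 (hp _ _ hh).symm
      rw [ind_of h2, ind_of_not (fun hh => h3 hh.1), ind_of ⟨hI h2.1, h2.2.2.1, h2.2.2.2⟩]
      norm_num
    · rw [ind_of_not h2]
      simp only [zero_add]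
      refine ind_mono fun h3 => ⟨h3.2.2.1, hI h3.1, h3.2.2.2.symm⟩

lemma bowtiesAt_ge_pairSum (hI : I ≤ G) (hp : ∀ x y, I.Adj x y → p x = p y) (v : V) :
    pairSum (farTri G I p v) (farTri G I p v) + 4 * pairSum (farTri G I p v) (nearTri G I p v)
      + 4 * pairSum (nearTri G I p v) (nearTri G I p v) ≤ bowtiesAt G v := by
  rw [← pairSum_expand, bowtiesAt_eq_pairSum]
  have h0 : ∀ x y, 0 ≤ farTri G I p v x y + (nearTri G I p v x y + nearTri G I p v y x) :=
    fun x y => add_nonneg (ind_nonneg _) (add_nonneg (ind_nonneg _) (ind_nonneg _))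
  exact pairSum_mono h0 h0 (farTri_add_nearTri_le hI hp v) (farTri_add_nearTri_le hI hp v)

/-- The common neighbours, in the opposite class, of two vertices of the same class. -/
lemma sum_common_ge (hr : ∀ x y, I.Adj x y → missDeg G p x ≤ r) (hh : ∀ i, h ≤ classCard p i)
    (hp : ∀ x y, I.Adj x y → p x = p y) {v u : V} (huv : I.Adj v u) :
    h - 2 * r ≤ ∑ w, ind (p w ≠ p v ∧ G.Adj v w ∧ G.Adj u w) := by
  have hpt : ∀ w, ind (p w = !p v) - miss G p v w - miss G p u w
      ≤ ind (p w ≠ p v ∧ G.Adj v w ∧ G.Adj u w) := by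
    intro w
    have := hp _ _ huv
    unfold miss
    rw [← this]
    by_cases h1 : G.Adj v w <;> by_cases h2 : G.Adj u w <;> cases h3 : p v <;> cases h4 : p w <;>
      simp [ind, h1, h2]
  have := Finset.sum_le_sum fun w (_ : w ∈ Finset.univ) => hpt w
  rw [Finset.sum_sub_distrib, Finset.sum_sub_distrib, ← missDeg_eq, ← missDeg_eq,
    ← classCard] at this
  linarith [hr _ _ huv, hr _ _ huv.symm, hh (!p v)]

/-- The common neighbours, in the opposite class, of the ends of two edges of `I`. -/
lemma sum_common_four_ge (hr : ∀ x y, I.Adj x y → missDeg G p x ≤ r)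
    (hh : ∀ i, h ≤ classCard p i) (hp : ∀ x y, I.Adj x y → p x = p y) {x y u w : V}
    (hxy : I.Adj x y) (huw : I.Adj u w) (hxu : p x = p u) :
    h - 4 * r ≤ ∑ v, farTri G I p v x y * farTri G I p v u w := by
  have hpt : ∀ v, ind (p v = !p x) - miss G p x v - miss G p y v - miss G p u v - miss G p w v
      ≤ farTri G I p v x y * farTri G I p v u w := by
    intro v
    have e1 := hp _ _ hxy
    have e2 := hp _ _ huw
    unfold miss farTri
    rw [← ind_and, ← e2, ← e1, ← hxu, G.adj_comm v x, G.adj_comm v y, G.adj_comm v u,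
      G.adj_comm v w]
    by_cases h1 : p v = !p x
    · have h2 : p x ≠ p v := by rw [h1]; cases p x <;> simp
      rw [ind_of h1]
      by_cases k1 : G.Adj x v
      · by_cases k2 : G.Adj y v
        · by_cases k3 : G.Adj u v
          · by_cases k4 : G.Adj w v
            · simp [ind, hxy, huw, h2, k1, k2, k3, k4]
            · simp [ind, h2, k1, k2, k3, k4]
          · rw [ind_of (p := p x ≠ p v ∧ ¬G.Adj u v) ⟨h2, k3⟩]
            linarith [ind_nonneg (p x ≠ p v ∧ ¬G.Adj x v), ind_nonneg (p x ≠ p v ∧ ¬G.Adj y v),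
              ind_nonneg (p x ≠ p v ∧ ¬G.Adj w v), ind_nonneg ((I.Adj x y ∧ p x ≠ p v ∧ G.Adj x v ∧
                G.Adj y v) ∧ I.Adj u w ∧ p x ≠ p v ∧ G.Adj u v ∧ G.Adj w v)]
        · rw [ind_of (p := p x ≠ p v ∧ ¬G.Adj y v) ⟨h2, k2⟩]
          linarith [ind_nonneg (p x ≠ p v ∧ ¬G.Adj x v), ind_nonneg (p x ≠ p v ∧ ¬G.Adj u v),
            ind_nonneg (p x ≠ p v ∧ ¬G.Adj w v), ind_nonneg ((I.Adj x y ∧ p x ≠ p v ∧ G.Adj x v ∧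
                G.Adj y v) ∧ I.Adj u w ∧ p x ≠ p v ∧ G.Adj u v ∧ G.Adj w v)]
      · rw [ind_of (p := p x ≠ p v ∧ ¬G.Adj x v) ⟨h2, k1⟩]
        linarith [ind_nonneg (p x ≠ p v ∧ ¬G.Adj y v), ind_nonneg (p x ≠ p v ∧ ¬G.Adj u v),
          ind_nonneg (p x ≠ p v ∧ ¬G.Adj w v), ind_nonneg ((I.Adj x y ∧ p x ≠ p v ∧ G.Adj x v ∧
                G.Adj y v) ∧ I.Adj u w ∧ p x ≠ p v ∧ G.Adj u v ∧ G.Adj w v)]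
    · rw [ind_of_not h1]
      linarith [ind_nonneg (p x ≠ p v ∧ ¬G.Adj x v), ind_nonneg (p x ≠ p v ∧ ¬G.Adj y v),
        ind_nonneg (p x ≠ p v ∧ ¬G.Adj u v),
        ind_nonneg (p x ≠ p v ∧ ¬G.Adj w v), ind_nonneg ((I.Adj x y ∧ p x ≠ p v ∧ G.Adj x v ∧
                G.Adj y v) ∧ I.Adj u w ∧ p x ≠ p v ∧ G.Adj u v ∧ G.Adj w v)]
  have := Finset.sum_le_sum fun w (_ : w ∈ Finset.univ) => hpt w
  rw [Finset.sum_sub_distrib, Finset.sum_sub_distrib, Finset.sum_sub_distrib,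
    Finset.sum_sub_distrib, ← missDeg_eq, ← missDeg_eq, ← missDeg_eq, ← missDeg_eq,
    ← classCard] at this
  linarith [hr _ _ hxy, hr _ _ hxy.symm, hr _ _ huw, hr _ _ huw.symm, hh (!p x)]

omit [Fintype V] in
lemma apart_eq_of_ne {x y u w : V} (hxy : x ≠ y) (huw : u ≠ w) :
    apart x y u w = 1 - ind (u = x) - ind (w = x) - ind (u = y) - ind (w = y)
      + ind (u = x) * ind (w = y) + ind (u = y) * ind (w = x) := by
  unfold apart
  by_cases h1 : x = u
  · subst h1
    by_cases h2 : y = w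
    · subst h2
      simp [ind, hxy, hxy.symm]
    · simp [ind, hxy, huw.symm, Ne.symm h2]
  · by_cases h2 : x = w
    · subst h2
      by_cases h3 : y = u
      · subst h3
        simp [ind, hxy, hxy.symm]
      · simp [ind, hxy, huw, Ne.symm h3]
    · by_cases h3 : y = u
      · subst h3
        simp [ind, h1, hxy.symm, Ne.symm h2, huw.symm]
      · by_cases h4 : y = w
        · subst h4
          simp [ind, Ne.symm h1, Ne.symm h2, huw]
        · simp [ind, h1, h2, h3, h4, Ne.symm h1, Ne.symm h2, Ne.symm h3, Ne.symm h4]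

/-- The ordered pairs of disjoint ordered edges of `I` within the same class, by inclusion and
exclusion over the coincidences of the ends. -/
lemma sum_apart_eq (hp : ∀ x y, I.Adj x y → p x = p y) :
    classDeg I p true ^ 2 + classDeg I p false ^ 2
      - 2 * (classDeg I p true + classDeg I p false) - 4 * cherries I
    = ∑ x, ∑ y, ∑ u, ∑ w, ind (I.Adj x y) * ind (I.Adj u w) * ind (p x = p u)
        * apart x y u w := by
  have hpt : ∀ x y u w, ind (I.Adj x y) * ind (I.Adj u w) * ind (p x = p u)
      - ind (I.Adj x y) * (ind (I.Adj u w) * ind (u = x))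
      - ind (I.Adj x y) * (ind (I.Adj u w) * ind (w = x))
      - ind (I.Adj x y) * (ind (I.Adj u w) * ind (u = y))
      - ind (I.Adj x y) * (ind (I.Adj u w) * ind (w = y))
      + ind (I.Adj x y) * (ind (u = x) * ind (w = y))
      + ind (I.Adj x y) * (ind (u = y) * ind (w = x))
      = ind (I.Adj x y) * ind (I.Adj u w) * ind (p x = p u) * apart x y u w := by
    intro x y u w
    by_cases h1 : I.Adj x y
    · by_cases h2 : I.Adj u w
      · have h3 := apart_eq_of_ne h1.ne h2.ne
        by_cases h4 : p x = p u
        · rw [ind_of h1, ind_of h2, ind_of h4]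
          linarith
        · rw [ind_of h1, ind_of h2, ind_of_not h4]
          have e1 : u ≠ x := fun e => h4 (by rw [e])
          have e2 : w ≠ x := fun e => h4 (by rw [hp _ _ h2, e])
          have e3 : u ≠ y := fun e => h4 (by rw [hp _ _ h1, e])
          have e4 : w ≠ y := fun e => h4 (by rw [hp _ _ h1, hp _ _ h2, e])
          simp [ind, e1, e2, e3, e4]
      · rw [ind_of h1, ind_of_not h2]
        have h3 : ¬(u = x ∧ w = y) := fun e => h2 (by rw [e.1, e.2]; exact h1)
        have h4 : ¬(u = y ∧ w = x) := fun e => h2 (by rw [e.1, e.2]; exact h1.symm)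
        rw [← ind_and, ← ind_and, ind_of_not h3, ind_of_not h4]
        simp
    · rw [ind_of_not h1]; simp
  rw [← Finset.sum_congr rfl fun x _ => Finset.sum_congr rfl fun y _ =>
    Finset.sum_congr rfl fun u _ => Finset.sum_congr rfl fun w _ => hpt x y u w]
  simp only [Finset.sum_add_distrib, Finset.sum_sub_distrib]
  have s0 : ∑ x, ∑ y, ∑ u, ∑ w, ind (I.Adj x y) * ind (I.Adj u w) * ind (p x = p u)
      = classDeg I p true ^ 2 + classDeg I p false ^ 2 := by
    have e : ∀ i, ∑ u, ∑ w, ind (I.Adj u w) * ind (i = p u)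
        = ind (i = true) * classDeg I p true + ind (i = false) * classDeg I p false := by
      intro i
      rw [sum_sum_adj_left I fun u => ind (i = p u)]
      cases i
      · rw [ind_of_not (by simp), ind_of rfl, zero_mul, zero_add, one_mul, classDeg]
        exact Finset.sum_congr rfl fun u _ => by rw [mul_comm, eq_comm (a := p u)]
      · rw [ind_of_not (p := true = false) (by simp), ind_of (p := true = true) rfl, zero_mul,
          add_zero, one_mul, classDeg]
        exact Finset.sum_congr rfl fun u _ => by rw [mul_comm, eq_comm (a := p u)]
    calc _ = ∑ x, ∑ y, ind (I.Adj x y) * (ind (p x = true) * classDeg I p true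
          + ind (p x = false) * classDeg I p false) := by
          refine Finset.sum_congr rfl fun x _ => Finset.sum_congr rfl fun y _ => ?_
          rw [← e, Finset.mul_sum]
          refine Finset.sum_congr rfl fun u _ => ?_
          rw [Finset.mul_sum]
          exact Finset.sum_congr rfl fun w _ => mul_assoc _ _ _
      _ = ∑ x, (ind (p x = true) * rdeg I x * classDeg I p true
          + ind (p x = false) * rdeg I x * classDeg I p false) := by
          rw [sum_sum_adj_left I fun x => ind (p x = true) * classDeg I p true
            + ind (p x = false) * classDeg I p false]
          exact Finset.sum_congr rfl fun x _ => by ring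
      _ = _ := by
          rw [Finset.sum_add_distrib, ← Finset.sum_mul, ← Finset.sum_mul, ← classDeg, ← classDeg]
          ring
  have sl : ∀ x, ∑ u, ∑ w, ind (I.Adj u w) * ind (u = x) = rdeg I x := fun x => by
    rw [sum_sum_adj_left I fun u => ind (u = x), sum_mul_ind_eq']
  have sr : ∀ x, ∑ u, ∑ w, ind (I.Adj u w) * ind (w = x) = rdeg I x := fun x => by
    rw [sum_sum_adj_right I fun u => ind (u = x), sum_mul_ind_eq']
  simp only [← Finset.mul_sum]
  rw [s0]
  simp only [sl, sr, sum_ind_eq', mul_one]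
  rw [sum_sum_adj_left I (rdeg I), sum_sum_adj_right I (rdeg I), classDeg_add]
  have : ∑ x, ∑ y, ind (I.Adj x y) = ∑ x, rdeg I x := rfl
  simp only [this]
  simp only [cherries, mul_sub, Finset.sum_sub_distrib, mul_one]
  ring

/-- Two disjoint edges of `I` in the same class form a bowtie with each common neighbour of their
four ends in the opposite class. -/
lemma sum_pairSum_far_far_ge (hr : ∀ x y, I.Adj x y → missDeg G p x ≤ r)
    (hh : ∀ i, h ≤ classCard p i) (hp : ∀ x y, I.Adj x y → p x = p y)
    (hg : g = h - 4 * r - 2) (hg0 : 0 ≤ g) :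
    g * (classDeg I p true ^ 2 + classDeg I p false ^ 2
      - 2 * (classDeg I p true + classDeg I p false) - 4 * cherries I)
    ≤ ∑ v, pairSum (farTri G I p v) (farTri G I p v) := by
  refine (mul_le_mul_of_nonneg_left ((sum_apart_eq hp).le) hg0).trans ?_
  simp only [pairSum]
  rw [sum_comm_four]
  simp only [Finset.mul_sum]
  refine Finset.sum_le_sum fun x _ => Finset.sum_le_sum fun y _ => Finset.sum_le_sum fun u _ =>
    Finset.sum_le_sum fun w _ => ?_
  rw [← Finset.sum_mul, ← mul_assoc]
  refine mul_le_mul_of_nonneg_right ?_ (apart_nonneg _ _ _ _)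
  by_cases hc : (I.Adj x y ∧ I.Adj u w) ∧ p x = p u
  · rw [← ind_and, ← ind_and, ind_of hc]
    have := sum_common_four_ge hr hh hp hc.1.1 hc.1.2 hc.2
    linarith
  · rw [← ind_and, ← ind_and, ind_of_not hc, mul_zero]
    exact Finset.sum_nonneg fun v _ => mul_nonneg (ind_nonneg _) (ind_nonneg _)

/-- Two edges of `I` that share the vertex `v` form bowties with centre `v` and the common
neighbours of their ends in the opposite class. -/
lemma sum_pairSum_near_near_ge (hr : ∀ x y, I.Adj x y → missDeg G p x ≤ r)
    (hh : ∀ i, h ≤ classCard p i) (hp : ∀ x y, I.Adj x y → p x = p y) (hr0 : 0 ≤ r)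
    (hg : g = h - 4 * r - 2) (hg0 : 0 ≤ g) :
    g ^ 2 * cherries I ≤ ∑ v, pairSum (nearTri G I p v) (nearTri G I p v) := by
  have key : ∀ v x u, g ^ 2 * (ind (I.Adj v x) * ind (I.Adj v u) * (1 - ind (u = x)))
      ≤ ∑ y, ∑ w, nearTri G I p v x y * nearTri G I p v u w * apart x y u w := by
    intro v x u
    by_cases hc : I.Adj v x ∧ I.Adj v u ∧ u ≠ x
    · obtain ⟨h1, h2, h3⟩ := hc
      rw [ind_of h1, ind_of h2, ind_of_not h3]
      have hN : ∀ y w, ind (p y ≠ p v ∧ G.Adj v y ∧ G.Adj x y)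
          * (ind (p w ≠ p v ∧ G.Adj v w ∧ G.Adj u w) - ind (w = y))
          ≤ nearTri G I p v x y * nearTri G I p v u w * apart x y u w := by
        intro y w
        unfold nearTri
        simp only [h1, h2, true_and]
        by_cases k1 : p y ≠ p v ∧ G.Adj v y ∧ G.Adj x y
        · by_cases k2 : p w ≠ p v ∧ G.Adj v w ∧ G.Adj u w
          · rw [ind_of k1, ind_of k2]
            by_cases k3 : w = y
            · rw [ind_of k3]
              simp [apart_nonneg]
            · rw [ind_of_not k3]
              unfold apart
              rw [ind_of]
              · norm_num
              · refine ⟨h3.symm, ?_, ?_, fun e => k3 e.symm⟩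
                · rintro rfl
                  exact k2.1 (hp _ _ h1).symm
                · rintro rfl
                  exact k1.1 (hp _ _ h2).symm
          · rw [ind_of k1, ind_of_not k2]
            simp [ind_nonneg]
        · rw [ind_of_not k1]
          simp
      have c1 := sum_common_ge hr hh hp h1
      have c2 := sum_common_ge hr hh hp h2
      refine le_trans ?_ (Finset.sum_le_sum fun y _ => Finset.sum_le_sum fun w _ => hN y w)
      simp only [← Finset.mul_sum, Finset.sum_sub_distrib, sum_ind_eq']
      rw [← Finset.sum_mul]
      set c := ∑ w, ind (p w ≠ p v ∧ G.Adj v w ∧ G.Adj x w)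
      set c' := ∑ w, ind (p w ≠ p v ∧ G.Adj v w ∧ G.Adj u w)
      have : g * g ≤ c * (c' - 1) := mul_le_mul (by linarith) (by linarith) hg0 (by linarith)
      linarith
    · refine le_trans (le_of_eq ?_) (Finset.sum_nonneg fun y _ => Finset.sum_nonneg fun w _ =>
        mul_nonneg (mul_nonneg (ind_nonneg _) (ind_nonneg _)) (apart_nonneg _ _ _ _))
      by_cases h1 : I.Adj v x
      · by_cases h2 : I.Adj v u
        · have h3 : u = x := by by_contra h3; exact hc ⟨h1, h2, h3⟩
          simp [ind, h3]
        · simp [ind, h2]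
      · simp [ind, h1]
  rw [cherries, Finset.mul_sum]
  refine Finset.sum_le_sum fun v _ => ?_
  calc g ^ 2 * (rdeg I v * (rdeg I v - 1))
      = ∑ x, ∑ u, g ^ 2 * (ind (I.Adj v x) * ind (I.Adj v u) * (1 - ind (u = x))) := by
        rw [← sum_adj_mul_adj_ne]
        simp only [Finset.mul_sum]
    _ ≤ ∑ x, ∑ u, ∑ y, ∑ w, nearTri G I p v x y * nearTri G I p v u w * apart x y u w :=
        Finset.sum_le_sum fun x _ => Finset.sum_le_sum fun u _ => key v x u
    _ = pairSum (nearTri G I p v) (nearTri G I p v) := by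
        refine Finset.sum_congr rfl fun x _ => ?_
        rw [Finset.sum_comm]

/-- An edge `v u` of `I` and an edge of `I` in the opposite class, both of whose ends are adjacent
to `v`, form a bowtie with centre `v` for each further common neighbour of `v` and `u`. -/
lemma sum_pairSum_far_near_ge (hr : ∀ x y, I.Adj x y → missDeg G p x ≤ r)
    (hh : ∀ i, h ≤ classCard p i) (hp : ∀ x y, I.Adj x y → p x = p y) (hr0 : 0 ≤ r)
    (hg : g = h - 4 * r - 2) :
    g * ∑ v, ∑ x, ∑ y, farTri G I p v x y * rdeg I v
      ≤ ∑ v, pairSum (farTri G I p v) (nearTri G I p v) := by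
  rw [Finset.mul_sum]
  refine Finset.sum_le_sum fun v _ => ?_
  simp only [pairSum, Finset.mul_sum]
  refine Finset.sum_le_sum fun x _ => Finset.sum_le_sum fun y _ => ?_
  rw [rdeg, Finset.mul_sum, Finset.mul_sum]
  refine Finset.sum_le_sum fun u _ => ?_
  by_cases h1 : I.Adj x y ∧ p x ≠ p v ∧ G.Adj v x ∧ G.Adj v y
  · by_cases h2 : I.Adj v u
    · have hN : ∀ w, ind (p w ≠ p v ∧ G.Adj v w ∧ G.Adj u w) - ind (w = x) - ind (w = y)
          ≤ farTri G I p v x y * nearTri G I p v u w * apart x y u w := by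
        intro w
        unfold nearTri farTri
        rw [ind_of h1]
        simp only [h2, true_and, one_mul]
        by_cases k2 : p w ≠ p v ∧ G.Adj v w ∧ G.Adj u w
        · rw [ind_of k2]
          by_cases k3 : w = x
          · rw [ind_of k3]
            linarith [apart_nonneg x y u w, ind_nonneg (w = y)]
          · by_cases k4 : w = y
            · rw [ind_of k4]
              linarith [apart_nonneg x y u w, ind_nonneg (w = x)]
            · rw [ind_of_not k3, ind_of_not k4]
              unfold apart
              rw [ind_of]
              · norm_num
              · refine ⟨?_, fun e => k3 e.symm, ?_, fun e => k4 e.symm⟩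
                · rintro rfl
                  exact h1.2.1 (hp _ _ h2).symm
                · rintro rfl
                  exact h1.2.1 ((hp _ _ h1.1).trans (hp _ _ h2).symm)
        · rw [ind_of_not k2]
          linarith [ind_nonneg (w = x), ind_nonneg (w = y)]
      refine le_trans ?_ (Finset.sum_le_sum fun w _ => hN w)
      rw [Finset.sum_sub_distrib, Finset.sum_sub_distrib, sum_ind_eq', sum_ind_eq', farTri,
        ind_of h1, ind_of h2]
      linarith [sum_common_ge hr hh hp h2]
    · rw [ind_of_not h2]
      simp only [mul_zero]
      exact Finset.sum_nonneg fun w _ =>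
        mul_nonneg (mul_nonneg (ind_nonneg _) (ind_nonneg _)) (apart_nonneg _ _ _ _)
  · rw [farTri, ind_of_not h1]
    simp

/-- The number of ordered pairs of non-isolated vertices of `I` that form a missing edge. -/
noncomputable def missPairs (G I : SimpleGraph V) (p : V → Bool) : ℝ :=
  ∑ x, ∑ y, ind ((p x ≠ p y ∧ ¬G.Adj x y) ∧ (∃ z, I.Adj x z) ∧ ∃ z, I.Adj y z)

/-- A missing edge `x v` spoils at most `d(x) d(v)` pairs of edges of `I` in opposite classes. All
but one of them are charged to the pairs of edges of `I` that share `x` or `v`. -/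
lemma sum_miss_mul_le (hr : ∀ x y, I.Adj x y → missDeg G p x ≤ r) :
    ∑ x, ∑ v, rdeg I x * rdeg I v * miss G p x v ≤ missPairs G I p + 2 * r * cherries I := by
  have hpt : ∀ x v, rdeg I x * rdeg I v * miss G p x v
      ≤ ind ((p x ≠ p v ∧ ¬G.Adj x v) ∧ (∃ z, I.Adj x z) ∧ ∃ z, I.Adj v z)
        + rdeg I x * (rdeg I x - 1) * miss G p x v + rdeg I v * (rdeg I v - 1) * miss G p v x := by
    intro x v
    rw [miss_comm G p v x]
    have h0 := miss_nonneg G p x v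
    have hx := rdeg_mul_pred_nonneg I x
    have hv := rdeg_mul_pred_nonneg I v
    have hxm := mul_nonneg hx h0
    have hvm := mul_nonneg hv h0
    rcases rdeg_eq_zero_or_one_le I x with h1 | h1
    · rw [h1.1] at *
      linarith [ind_nonneg ((p x ≠ p v ∧ ¬G.Adj x v) ∧ (∃ z, I.Adj x z) ∧ ∃ z, I.Adj v z)]
    · rcases rdeg_eq_zero_or_one_le I v with h2 | h2
      · rw [h2.1] at *
        linarith [ind_nonneg ((p x ≠ p v ∧ ¬G.Adj x v) ∧ (∃ z, I.Adj x z) ∧ ∃ z, I.Adj v z)]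
      · rw [ind_and (p x ≠ p v ∧ ¬G.Adj x v), ind_of (And.intro h1.2 h2.2), mul_one]
        have : rdeg I x * rdeg I v ≤ 1 + rdeg I x * (rdeg I x - 1) + rdeg I v * (rdeg I v - 1) := by
          nlinarith [sq_nonneg (rdeg I x - rdeg I v), sq_nonneg (rdeg I x + rdeg I v - 2)]
        have := mul_le_mul_of_nonneg_right this h0
        unfold miss at *
        linarith
  have hb : ∑ x, ∑ v, rdeg I x * (rdeg I x - 1) * miss G p x v ≤ r * cherries I := by
    rw [cherries, Finset.mul_sum]
    refine Finset.sum_le_sum fun x _ => ?_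
    rw [← Finset.mul_sum, ← missDeg_eq, mul_comm r]
    rcases rdeg_eq_zero_or_one_le I x with h1 | ⟨_, y, hy⟩
    · rw [h1.1]; simp
    · exact mul_le_mul_of_nonneg_left (hr x y hy) (rdeg_mul_pred_nonneg I x)
  have hs := Finset.sum_le_sum fun x (_ : x ∈ Finset.univ) =>
    Finset.sum_le_sum fun v (_ : v ∈ Finset.univ) => hpt x v
  simp only [Finset.sum_add_distrib] at hs
  rw [Finset.sum_comm (f := fun x v => rdeg I v * (rdeg I v - 1) * miss G p v x)] at hs
  have e : missPairs G I p = ∑ x, ∑ v, ind ((p x ≠ p v ∧ ¬G.Adj x v) ∧ (∃ z, I.Adj x z) ∧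
      ∃ z, I.Adj v z) := rfl
  rw [e]
  linarith

/-- The pairs of an edge of `I` at `v` and an edge of `I` in the opposite class that spans a triangle
with `v`. Each pair of edges in opposite classes arises from four choices of `v`, with two
orientations of the edge opposite to `v` each, unless there are missing edges between them. -/
lemma sum_far_mul_rdeg_ge (hr : ∀ x y, I.Adj x y → missDeg G p x ≤ r)
    (hp : ∀ x y, I.Adj x y → p x = p y) :
    2 * (classDeg I p true * classDeg I p false) - 2 * missPairs G I p - 4 * r * cherries I
      ≤ ∑ v, ∑ x, ∑ y, farTri G I p v x y * rdeg I v := by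
  have hpt : ∀ v x y, (ind (I.Adj x y) * ind (p x = !p v) - ind (I.Adj x y) * miss G p x v
      - ind (I.Adj x y) * miss G p y v) * rdeg I v ≤ farTri G I p v x y * rdeg I v := by
    intro v x y
    refine mul_le_mul_of_nonneg_right ?_ (rdeg_nonneg _ _)
    unfold farTri miss
    by_cases h1 : I.Adj x y
    · have := hp _ _ h1
      rw [← this, G.adj_comm v x, G.adj_comm v y]
      by_cases h2 : G.Adj x v <;> by_cases h3 : G.Adj y v <;> cases h4 : p x <;> cases h5 : p v <;>
        simp [ind, h1, h2, h3]
    · simp [ind, h1]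
  have hc : ∀ v, ∑ x, ∑ y, ind (I.Adj x y) * ind (p x = !p v) = classDeg I p (!p v) := by
    intro v
    rw [sum_sum_adj_left I fun x => ind (p x = !p v), classDeg]
    exact Finset.sum_congr rfl fun x _ => mul_comm _ _
  have hs := Finset.sum_le_sum fun v (_ : v ∈ Finset.univ) =>
    Finset.sum_le_sum fun x (_ : x ∈ Finset.univ) =>
      Finset.sum_le_sum fun y (_ : y ∈ Finset.univ) => hpt v x y
  refine le_trans ?_ hs
  have hv : ∀ v, ∑ x, ∑ y, (ind (I.Adj x y) * ind (p x = !p v) - ind (I.Adj x y) * miss G p x v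
      - ind (I.Adj x y) * miss G p y v) * rdeg I v = classDeg I p (!p v) * rdeg I v
      - 2 * ((∑ x, rdeg I x * miss G p x v) * rdeg I v) := by
    intro v
    simp only [← Finset.sum_mul _ _ (rdeg I v)]
    simp only [Finset.sum_sub_distrib]
    rw [hc, sum_sum_adj_left I fun x => miss G p x v, sum_sum_adj_right I fun x => miss G p x v]
    ring
  simp only [hv, Finset.sum_sub_distrib, ← Finset.mul_sum]
  have e2 : ∑ v, (∑ x, rdeg I x * miss G p x v) * rdeg I v
      = ∑ x, ∑ v, rdeg I x * rdeg I v * miss G p x v := by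
    rw [Finset.sum_comm]
    refine Finset.sum_congr rfl fun v _ => ?_
    rw [Finset.sum_mul]
    exact Finset.sum_congr rfl fun x _ => by ring
  rw [sum_classDeg_not_mul, e2]
  linarith [sum_miss_mul_le (p := p) hr]

/-- The lower bound for the number of bowties in terms of the inner edges `I`, all of whose ends
are adjacent to almost all of the opposite class. Disjoint edges in one class have about `n / 2`
possible centres, edges in opposite classes have their four ends as centres, each with about `n / 2`
choices for the remaining vertex, and edges that share a vertex are the sides of about `n ^ 2 / 4`
bowties. -/
lemma bowties_ge_of_inner (hI : I ≤ G) (hp : ∀ x y, I.Adj x y → p x = p y)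
    (hr : ∀ x y, I.Adj x y → missDeg G p x ≤ r)
    (hh : ∀ i, h ≤ classCard p i) (hr0 : 0 ≤ r) (hg : g = h - 4 * r - 2) (hg0 : 0 ≤ g) :
    g * (classDeg I p true ^ 2 + classDeg I p false ^ 2
      - 2 * (classDeg I p true + classDeg I p false)
      + 8 * (classDeg I p true * classDeg I p false) - 8 * missPairs G I p
      + 4 * (g - 1 - 4 * r) * cherries I) ≤ bowties G := by
  have h1 := Finset.sum_le_sum fun v (_ : v ∈ Finset.univ) => bowtiesAt_ge_pairSum hI hp v
  rw [← bowties_eq_sum] at h1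
  simp only [Finset.sum_add_distrib, ← Finset.mul_sum] at h1
  have h2 := sum_pairSum_far_far_ge hr hh hp hg hg0
  have h3 := sum_pairSum_near_near_ge hr hh hp hr0 hg hg0
  have h4 := sum_pairSum_far_near_ge hr hh hp hr0 hg
  have h5 := mul_le_mul_of_nonneg_left (sum_far_mul_rdeg_ge hr hp) hg0
  linarith

end Lower

end PairCount

/-! ### The structure of graphs with few triangles -/

section Structure

open scoped Classical

variable {V : Type*} [Fintype V]

/-- Each edge of `I` lies in about `n / 2` triangles with their third vertex in the opposite class.
-/
lemma triTotal_ge {G I : SimpleGraph V} {p : V → Bool} {r h : ℝ} (hI : I ≤ G)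
    (hp : ∀ x y, I.Adj x y → p x = p y) (hr : ∀ x y, I.Adj x y → missDeg G p x ≤ r)
    (hh : ∀ i, h ≤ classCard p i) :
    3 * (h - 2 * r) * ∑ x, rdeg I x ≤ triTotal G := by
  have h1 := Finset.sum_le_sum fun v (_ : v ∈ Finset.univ) =>
    Finset.sum_le_sum fun x (_ : x ∈ Finset.univ) =>
      Finset.sum_le_sum fun y (_ : y ∈ Finset.univ) => farTri_add_nearTri_le hI hp v x y
  simp only [Finset.sum_add_distrib] at h1
  have hfar : (h - 2 * r) * ∑ x, rdeg I x ≤ ∑ v, ∑ x, ∑ y, farTri G I p v x y := by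
    rw [Finset.sum_comm]
    simp only [rdeg, Finset.mul_sum]
    refine Finset.sum_le_sum fun x _ => ?_
    rw [Finset.sum_comm]
    refine Finset.sum_le_sum fun y _ => ?_
    by_cases hxy : I.Adj x y
    · rw [ind_of hxy, mul_one]
      refine (sum_common_ge hr hh hp hxy).trans (Finset.sum_le_sum fun v _ => ind_mono ?_)
      rintro ⟨h1, h2, h3⟩
      exact ⟨hxy, h1.symm, h2.symm, h3.symm⟩
    · rw [ind_of_not hxy, mul_zero]
      exact Finset.sum_nonneg fun _ _ => ind_nonneg _
  have hnear : (h - 2 * r) * ∑ x, rdeg I x ≤ ∑ v, ∑ x, ∑ y, nearTri G I p v x y := by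
    simp only [rdeg, Finset.mul_sum]
    refine Finset.sum_le_sum fun x _ => Finset.sum_le_sum fun y _ => ?_
    by_cases hxy : I.Adj x y
    · rw [ind_of hxy, mul_one]
      refine (sum_common_ge hr hh hp hxy).trans (Finset.sum_le_sum fun v _ => ind_mono ?_)
      exact fun h1 => ⟨hxy, h1⟩
    · rw [ind_of_not hxy, mul_zero]
      exact Finset.sum_nonneg fun _ _ => ind_nonneg _
  have hswap : ∑ v, ∑ x, ∑ y, nearTri G I p v y x = ∑ v, ∑ x, ∑ y, nearTri G I p v x y :=
    Finset.sum_congr rfl fun v _ => Finset.sum_comm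
  rw [hswap] at h1
  have e : triTotal G = ∑ v, ∑ x, ∑ y, tri G v x y := rfl
  rw [e]
  linarith

/-- A vertex with many neighbours in both classes lies in many triangles. -/
lemma triAt_ge_of_inDeg (G : SimpleGraph V) (p : V → Bool) (x : V) :
    2 * (inDeg G p x * crossDeg G p x - ∑ y, missDeg G p y) ≤ triAt G x := by
  have hpt : ∀ y z, ind (G.Adj x y ∧ p x = p y) * ind (G.Adj x z ∧ p x ≠ p z) - miss G p y z
      + (ind (G.Adj x z ∧ p x = p z) * ind (G.Adj x y ∧ p x ≠ p y) - miss G p z y)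
      ≤ tri G x y z := by
    intro y z
    unfold miss tri
    rw [G.adj_comm z y]
    by_cases h1 : G.Adj x y <;> by_cases h2 : G.Adj x z <;> by_cases h3 : G.Adj y z <;>
      cases h4 : p x <;> cases h5 : p y <;> cases h6 : p z <;> simp [ind, h1, h2, h3]
  have hs := Finset.sum_le_sum fun y (_ : y ∈ Finset.univ) =>
    Finset.sum_le_sum fun z (_ : z ∈ Finset.univ) => hpt y z
  simp only [Finset.sum_add_distrib, Finset.sum_sub_distrib, ← Finset.mul_sum,
    ← Finset.sum_mul] at hs
  rw [Finset.sum_comm (f := fun y z => miss G p z y)] at hs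
  simp only [← missDeg_eq] at hs
  simp only [← inDeg.eq_1, ← crossDeg.eq_1, ← triAt.eq_1] at hs
  linarith

/-- The edges inside the classes whose ends have small degree in their class and few missing edges
to the other class. -/
def goodInner (G : SimpleGraph V) (p : V → Bool) (s r : ℝ) : SimpleGraph V where
  Adj x y := (G.Adj x y ∧ p x = p y) ∧ (inDeg G p x ≤ s ∧ missDeg G p x ≤ r) ∧
    (inDeg G p y ≤ s ∧ missDeg G p y ≤ r)
  symm := ⟨fun _ _ h => ⟨⟨h.1.1.symm, h.1.2.symm⟩, h.2.2, h.2.1⟩⟩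
  loopless := ⟨fun _ h => h.1.1.ne rfl⟩

/-- The number of vertices of large degree inside their class. -/
noncomputable def heavy (G : SimpleGraph V) (p : V → Bool) (s : ℝ) : ℝ :=
  ∑ x, ind (s < inDeg G p x)

/-- The inner edges lost at vertices with many missing edges are outnumbered by the missing edges
at these vertices. -/
lemma sum_inDeg_sub_le (G : SimpleGraph V) (p : V → Bool) {s r : ℝ}
    (hsr : 2 * s ≤ r) :
    ∑ x, inDeg G p x - ∑ x, rdeg (goodInner G p s r) x
      ≤ 2 * Fintype.card V * heavy G p s
        + (∑ x, missDeg G p x - missPairs G (goodInner G p s r) p) := by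
  set I := goodInner G p s r
  set n : ℝ := (Fintype.card V : ℝ) with hn
  set B : V → ℝ := fun x => ind (¬(inDeg G p x ≤ s ∧ missDeg G p x ≤ r)) with hB
  have h1 : ∀ x y, ind (G.Adj x y ∧ p x = p y) - ind (I.Adj x y)
      ≤ ind (G.Adj x y ∧ p x = p y) * B x + ind (G.Adj x y ∧ p x = p y) * B y := by
    intro x y
    by_cases k : G.Adj x y ∧ p x = p y
    · by_cases k1 : inDeg G p x ≤ s ∧ missDeg G p x ≤ r
      · by_cases k2 : inDeg G p y ≤ s ∧ missDeg G p y ≤ r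
        · have : I.Adj x y := ⟨k, k1, k2⟩
          rw [ind_of k, ind_of this]
          have := ind_nonneg (¬(inDeg G p x ≤ s ∧ missDeg G p x ≤ r))
          have := ind_nonneg (¬(inDeg G p y ≤ s ∧ missDeg G p y ≤ r))
          simp only [hB]
          linarith
        · have e : B y = 1 := ind_of k2
          rw [ind_of k, e]
          have := ind_nonneg (¬(inDeg G p x ≤ s ∧ missDeg G p x ≤ r))
          have := ind_nonneg (I.Adj x y)
          simp only [hB]
          linarith
      · have e : B x = 1 := ind_of k1
        rw [ind_of k, e]
        have := ind_nonneg (¬(inDeg G p y ≤ s ∧ missDeg G p y ≤ r))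
        have := ind_nonneg (I.Adj x y)
        simp only [hB]
        linarith
    · rw [ind_of_not k]
      simp [ind_nonneg]
  have h2 : ∑ x, inDeg G p x - ∑ x, rdeg I x ≤ 2 * ∑ x, inDeg G p x * B x := by
    have := Finset.sum_le_sum fun x (_ : x ∈ Finset.univ) =>
      Finset.sum_le_sum fun y (_ : y ∈ Finset.univ) => h1 x y
    simp only [Finset.sum_add_distrib, Finset.sum_sub_distrib] at this
    rw [Finset.sum_comm (f := fun x y => ind (G.Adj x y ∧ p x = p y) * B y)] at this
    have e1 : ∀ x y, ind (G.Adj y x ∧ p y = p x) = ind (G.Adj x y ∧ p x = p y) := fun x y => by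
      rw [G.adj_comm, eq_comm (a := p y)]
    simp only [e1, ← Finset.sum_mul] at this
    simp only [← inDeg.eq_1, ← rdeg.eq_1] at this
    linarith
  have h3 : ∀ x, 2 * (inDeg G p x * B x) ≤ 2 * n * ind (s < inDeg G p x)
      + ind (r < missDeg G p x) * missDeg G p x := by
    intro x
    have k0 := inDeg_nonneg G p x
    have k1 := missDeg_nonneg G p x
    have k2 := (inDeg_le_rdeg G p x).trans (rdeg_le_card G x)
    by_cases c1 : s < inDeg G p x
    · have : B x = 1 := ind_of (by rintro ⟨h, -⟩; linarith)
      rw [this, ind_of c1]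
      have := mul_nonneg (ind_nonneg (r < missDeg G p x)) k1
      linarith
    · rw [ind_of_not c1]
      by_cases c2 : r < missDeg G p x
      · have : B x = 1 := ind_of (by rintro ⟨-, h⟩; linarith)
        rw [this, ind_of c2]
        linarith
      · have : B x = 0 := ind_of_not (by push Not at *; exact ⟨c1, c2⟩)
        rw [this, ind_of_not c2]
        simp
  have h4 : ∑ x, ind (r < missDeg G p x) * missDeg G p x ≤
      ∑ x, missDeg G p x - missPairs G I p := by
    rw [le_sub_iff_add_le, missPairs, ← Finset.sum_add_distrib]
    refine Finset.sum_le_sum fun x _ => ?_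
    by_cases c2 : r < missDeg G p x
    · rw [ind_of c2, Finset.sum_eq_zero]
      · linarith
      · refine fun y _ => ind_of_not ?_
        rintro ⟨-, ⟨z, hz⟩, -⟩
        linarith [hz.2.1.2]
    · rw [ind_of_not c2, zero_mul, zero_add]
      exact Finset.sum_le_sum fun y _ => ind_mono fun h => h.1
  have h5 := Finset.sum_le_sum fun x (_ : x ∈ Finset.univ) => h3 x
  rw [← Finset.mul_sum, Finset.sum_add_distrib, ← Finset.mul_sum] at h5
  rw [heavy]
  linarith

/-- Each heavy vertex is the centre of many bowties. -/
lemma heavy_mul_le (G : SimpleGraph V) (p : V → Bool) {s : ℝ} (hs : 0 ≤ s)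
    (hcut : ∀ x, inDeg G p x ≤ crossDeg G p x) (hmiss : ∑ x, missDeg G p x ≤ s ^ 2 / 2)
    (hsn : 8 * (Fintype.card V : ℝ) ≤ s ^ 2) :
    heavy G p s * (s ^ 4 / 2) ≤ bowties G := by
  rw [heavy, Finset.sum_mul, bowties_eq_sum]
  refine Finset.sum_le_sum fun x _ => ?_
  by_cases h : s < inDeg G p x
  · rw [ind_of h, one_mul]
    have h1 := triAt_ge_of_inDeg G p x
    have h2 := bowtiesAt_ge G x
    have h3 : s * s ≤ inDeg G p x * crossDeg G p x :=
      mul_le_mul h.le (h.le.trans (hcut x)) hs (hs.trans h.le)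
    have h4 : s ^ 2 ≤ triAt G x := by nlinarith
    nlinarith [sq_nonneg s]
  · rw [ind_of_not h, zero_mul]
    exact bowtiesAt_nonneg G x

lemma heavy_eq_zero_or_one_le (G : SimpleGraph V) (p : V → Bool) (s : ℝ) :
    heavy G p s = 0 ∨ 1 ≤ heavy G p s := by
  rw [heavy, sum_ind]
  rcases Nat.eq_zero_or_pos (Finset.univ.filter fun x => s < inDeg G p x).card with h | h
  · left; exact_mod_cast h
  · right; exact_mod_cast h

/-- A graph with at least `n ^ 2 / 4 + t` edges and few triangles has a partition into two classes
of nearly equal size such that at least about `t` edges inside the classes have both ends adjacent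
to almost all of the other class. The number of these edges exceeds `t` by the number of missing
edges between their ends, up to an error that comes from vertices of high degree inside their own
class. These are few, since each is the centre of many bowties. -/
lemma exists_structure (G : SimpleGraph V) {κ : ℝ} (hκ : 0 < κ) {t : ℕ} (ht : 1 ≤ t)
    (he : Fintype.card V ^ 2 / 4 + t ≤ G.edgeSet.ncard)
    (hn : 32 / κ ^ 2 ≤ Fintype.card V)
    (hT : triTotal G ≤ (κ ^ 2 / 32) ^ 2 * (Fintype.card V : ℝ) ^ 3) :
    ∃ (p : V → Bool) (I : SimpleGraph V) (S : ℝ), I ≤ G ∧ (∀ x y, I.Adj x y → p x = p y) ∧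
      (∀ x y, I.Adj x y → missDeg G p x ≤ κ * Fintype.card V) ∧
      (∀ i, (1 / 2 - κ) * Fintype.card V ≤ classCard p i) ∧
      2 * t + missPairs G I p - 2 * Fintype.card V * S ≤ ∑ x, rdeg I x ∧
      S * ((κ * Fintype.card V / 2) ^ 4 / 2) ≤ bowties G ∧ (S = 0 ∨ 1 ≤ S) := by
  set n : ℝ := (Fintype.card V : ℝ) with hnn
  have hn0 : 0 < n := lt_of_lt_of_le (by positivity) hn
  have hfl : n ^ 2 / 4 ≤ ((Fintype.card V ^ 2 / 4 : ℕ) : ℝ) + 1 := by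
    have := Nat.lt_floor_add_one (n ^ 2 / 4)
    have e : ⌊n ^ 2 / 4⌋₊ = Fintype.card V ^ 2 / 4 := by
      rw [hnn]
      exact_mod_cast Nat.floor_div_eq_div (K := ℝ) (Fintype.card V ^ 2) 4
    rw [e] at this
    exact this.le
  have heR : ((Fintype.card V ^ 2 / 4 : ℕ) : ℝ) + t ≤ (G.edgeSet.ncard : ℝ) := by
    exact_mod_cast he
  have ht' : (1 : ℝ) ≤ t := by exact_mod_cast ht
  set β : ℝ := κ ^ 2 / 32 with hβ
  have hβ0 : 0 < β := by positivity
  obtain ⟨p, hp1, hp2⟩ := exists_max_cut G (β * n ^ 2) (by positivity) (by rw [← hnn]; linarith)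
  have hin : ∑ x, inDeg G p x ≤ 4 * β * n ^ 2 := by
    have : triTotal G / (β * n ^ 2) ≤ β * n := by
      rw [div_le_iff₀ (by positivity)]
      nlinarith
    have := mul_le_mul_of_nonneg_left this (show 0 ≤ 2 * n by positivity)
    nlinarith
  have hedge := sum_inDeg_eq G p
  have hab := classCard_mul_le p
  have hadd := classCard_add p
  rw [← hnn] at hadd
  have hmiss : ∑ x, missDeg G p x ≤ ∑ x, inDeg G p x := by linarith
  have hmiss0 : 0 ≤ ∑ x, missDeg G p x := Finset.sum_nonneg fun x _ => missDeg_nonneg G p x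
  set s : ℝ := κ * n / 2 with hs
  have hs0 : 0 ≤ s := by positivity
  have hs2 : s ^ 2 = 8 * β * n ^ 2 := by rw [hs, hβ]; ring
  have hsn : 8 * n ≤ s ^ 2 := by
    rw [hs]
    rw [div_le_iff₀ (by positivity)] at hn
    nlinarith
  have hab2 : (classCard p true - classCard p false) ^ 2 ≤ (κ * n) ^ 2 := by
    have : (classCard p true - classCard p false) ^ 2
        = n ^ 2 - 4 * (classCard p true * classCard p false) := by rw [← hadd]; ring
    rw [this]
    have h2 : 8 * β * n ^ 2 = (κ * n) ^ 2 / 4 := by rw [hβ]; ring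
    nlinarith [sq_nonneg (κ * n)]
  have habs := abs_le.1 (abs_le_of_sq_le_sq hab2 (by positivity))
  refine ⟨p, goodInner G p s (κ * n), heavy G p s, ?_, ?_, ?_, ?_, ?_, ?_, ?_⟩
  · intro x y h
    exact h.1.1
  · intro x y h
    exact h.1.2
  · intro x y h
    exact h.2.1.2
  · intro i
    cases i <;> linarith
  · have := sum_inDeg_sub_le G p (show 2 * s ≤ κ * n by rw [hs]; linarith)
    linarith
  · exact heavy_mul_le G p hs0 hp2 (by linarith) hsn
  · exact heavy_eq_zero_or_one_le G p s

end Structure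

/-! ### The optimal distribution of the inner edges -/

section Optimum

/-- The main term of the asymptotic formula. -/
noncomputable def mainTerm (n d m e₁ e₂ : ℕ) : ℝ :=
  (n : ℝ) / 2 * ((e₁.choose 2 : ℝ) + (e₂.choose 2 : ℝ)
    + (m : ℝ) * ((d + 1).choose 2 : ℝ) * ((n : ℝ) / 2)
    + ((n : ℝ) - m) * (d.choose 2 : ℝ) * ((n : ℝ) / 2)
    + 4 * (e₁ : ℝ) * (e₂ : ℝ))

lemma mainTerm_eq {n d m e₁ e₂ t : ℕ} (hm : 2 * t = d * n + m) (he : e₁ + e₂ = t) :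
    8 * mainTerm n d m e₁ e₂ = (n : ℝ) / 2 * (4 * (t : ℝ) ^ 2 - 4 * t + 24 * (e₁ * e₂)
      + 8 * t * n * d - 2 * (n : ℝ) ^ 2 * d ^ 2 - 2 * (n : ℝ) ^ 2 * d) := by
  have h1 : (m : ℝ) = 2 * t - d * n := by
    have : (2 : ℝ) * t = d * n + m := by exact_mod_cast hm
    linarith
  have h2 : (t : ℝ) = e₁ + e₂ := by exact_mod_cast he.symm
  rw [mainTerm, Nat.cast_choose_two, Nat.cast_choose_two, Nat.cast_choose_two,
    Nat.cast_choose_two, h1, h2]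
  push_cast
  ring

lemma mainTerm_le {n d m e₁ e₂ t : ℕ} (hm : 2 * t = d * n + m) (he : e₁ + e₂ = t) :
    8 * mainTerm n d m e₁ e₂ ≤ 9 * (t : ℝ) ^ 2 * n := by
  rw [mainTerm_eq hm he]
  have h2 : (t : ℝ) = e₁ + e₂ := by exact_mod_cast he.symm
  have hn : (0 : ℝ) ≤ n := by positivity
  have hd : (0 : ℝ) ≤ d := by positivity
  have key : 4 * (t : ℝ) ^ 2 - 4 * t + 24 * (e₁ * e₂)
      + 8 * t * n * d - 2 * (n : ℝ) ^ 2 * d ^ 2 - 2 * (n : ℝ) ^ 2 * d ≤ 18 * (t : ℝ) ^ 2 := by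
    have e1 : (24 : ℝ) * (e₁ * e₂) ≤ 6 * (t : ℝ) ^ 2 := by
      rw [h2]; nlinarith [sq_nonneg ((e₁ : ℝ) - e₂)]
    have e2 : (0 : ℝ) ≤ t := by positivity
    have e3 : (0 : ℝ) ≤ (n : ℝ) ^ 2 * d := by positivity
    nlinarith [sq_nonneg (2 * (t : ℝ) - n * d)]
  nlinarith

/-- The part of the main term that comes from pairs of inner edges in general position. -/
lemma mainTerm_ge {n d m e₁ e₂ t : ℕ} (hm : 2 * t = d * n + m)
    (he : e₁ + e₂ = t) :
    (n : ℝ) / 2 * (4 * (t : ℝ) ^ 2 - 4 * t) ≤ 8 * mainTerm n d m e₁ e₂ := by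
  rw [mainTerm_eq hm he]
  have h1 : (2 : ℝ) * t = d * n + m := by exact_mod_cast hm
  have hn : (0 : ℝ) ≤ n := by positivity
  have hm' : (0 : ℝ) ≤ m := by positivity
  have hee : (0 : ℝ) ≤ (e₁ : ℝ) * e₂ := by positivity
  have key : (0 : ℝ) ≤ 8 * t * n * d - 2 * (n : ℝ) ^ 2 * d ^ 2 - 2 * (n : ℝ) ^ 2 * d := by
    have e : (8 : ℝ) * t * n * d - 2 * (n : ℝ) ^ 2 * d ^ 2 - 2 * (n : ℝ) ^ 2 * d
        = 4 * m * n * d + 2 * (n : ℝ) ^ 2 * (d * (d - 1)) := by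
      have : (t : ℝ) = (d * n + m) / 2 := by linarith
      rw [this]; ring
    have hd : (0 : ℝ) ≤ d * ((d : ℝ) - 1) := by
      rcases Nat.eq_zero_or_pos d with h | h
      · simp [h]
      · have : (1 : ℝ) ≤ d := by exact_mod_cast h
        exact mul_nonneg (by linarith) (by linarith)
    rw [e]
    positivity
  nlinarith

/-- The optimisation over the split of a total average degree `2 (d + θ)` between the two classes,
in terms of the piecewise linear interpolation of `x (x - 1)` at the integers: nothing beats giving
one class degrees in `{d, d + 1}` with as many `d + 1` as possible. Between integers the expression
is concave in the split, and the cases are the possible parities of `k + l`. -/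
lemma split_optimal {k l d : ℤ} {α β θ : ℝ} (hα0 : 0 ≤ α) (hα1 : α < 1) (hβ0 : 0 ≤ β) (hβ1 : β < 1)
    (hθ0 : 0 ≤ θ) (hθ1 : θ < 1) (hsum : (k : ℝ) + α + (l + β) = 2 * (d + θ)) :
    3 * ((d + min (2 * θ) 1) * (2 * (d + θ) - (d + min (2 * θ) 1))) + 4 * (d : ℝ) ^ 2 - 4 * d
        + 8 * θ * d
      ≤ 3 * ((k + α) * (l + β)) + 4 * k * (k + α) + 4 * l * (l + β) - 2 * k * (k + 1)
        - 2 * l * (l + 1) := by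
  have hint : ∀ q : ℤ, ∀ z : ℝ, -1 ≤ z → z ≤ 1 → 0 ≤ (q : ℝ) ^ 2 + q * z := by
    intro q z h1 h2
    rcases lt_trichotomy q 0 with h | h | h
    · have : (q : ℝ) ≤ -1 := by exact_mod_cast Int.le_sub_one_of_lt h
      nlinarith
    · simp [h]
    · have : (1 : ℝ) ≤ q := by exact_mod_cast h
      nlinarith
  rcases Int.even_or_odd' (k + l) with ⟨q, hq | hq⟩
  · have hqR : (k : ℝ) + l = 2 * q := by exact_mod_cast hq
    have hdq : d = q := by
      have h1 : (d : ℝ) < q + 1 := by linarith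
      have h2 : (q : ℝ) < d + 1 := by linarith
      have h1' : d < q + 1 := by exact_mod_cast h1
      have h2' : q < d + 1 := by exact_mod_cast h2
      omega
    subst hdq
    have hl : (l : ℝ) = 2 * d - k := by linarith
    have hθ : θ = (α + β) / 2 := by linarith
    have hp := hint (k - d) (α - β) (by linarith) (by linarith)
    push_cast at hp
    have hab := mul_nonneg hα0 hβ0
    have hab' := mul_nonneg (sub_nonneg.2 hα1.le) (sub_nonneg.2 hβ1.le)
    rw [hl]
    rcases le_total (2 * θ) 1 with h | h
    · rw [min_eq_left h, hθ]
      nlinarith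
    · rw [min_eq_right h, hθ]
      nlinarith
  · have hqR : (k : ℝ) + l = 2 * q + 1 := by exact_mod_cast hq
    have hl : (l : ℝ) = 2 * q + 1 - k := by linarith
    have hab := mul_nonneg hα0 hβ0
    have hab' := mul_nonneg (sub_nonneg.2 hα1.le) (sub_nonneg.2 hβ1.le)
    -- `(p ^ 2 + p) + p (α - β) + α` is nonnegative for each integer `p`
    have hp : 0 ≤ ((k : ℝ) - q - 1) ^ 2 + ((k : ℝ) - q - 1) * (1 + α - β) + α ∧
        0 ≤ ((k : ℝ) - q - 1) ^ 2 + ((k : ℝ) - q - 1) * (1 + α - β) + 1 - β := by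
      rcases lt_or_ge (k - q - 1) 0 with h | h
      · have h' : (k : ℝ) - q - 1 ≤ -1 := by exact_mod_cast Int.le_sub_one_of_lt h
        constructor <;> nlinarith
      · have h' : (0 : ℝ) ≤ (k : ℝ) - q - 1 := by exact_mod_cast h
        constructor <;> nlinarith
    rcases lt_or_ge (α + β) 1 with hc | hc
    · have hdq : d = q := by
        have h1 : (d : ℝ) < q + 1 := by linarith
        have h2 : (q : ℝ) < d + 1 := by linarith
        have h1' : d < q + 1 := by exact_mod_cast h1
        have h2' : q < d + 1 := by exact_mod_cast h2
        omega
      subst hdq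
      have hθ : θ = (1 + α + β) / 2 := by linarith
      rw [hl, min_eq_right (by linarith), hθ]
      nlinarith [hp.1]
    · have hdq : d = q + 1 := by
        have h1 : (d : ℝ) < q + 2 := by linarith
        have h2 : (q : ℝ) < d := by linarith
        have h1' : d < q + 2 := by exact_mod_cast h1
        have h2' : q < d := by exact_mod_cast h2
        omega
      have hq' : (q : ℝ) = d - 1 := by rw [hdq]; push_cast; ring
      have hθ : θ = (α + β - 1) / 2 := by linarith
      rw [hq'] at hl hp
      rw [hl, min_eq_left (by linarith), hθ]
      nlinarith [hp.2]

/-- The unscaled form of `split_optimal`, for the degree sums `x` and `y` of the two classes. -/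
lemma split_optimal_degrees {n d m t : ℕ} {x y : ℝ} (hn : 0 < n) (hm : 2 * t = d * n + m)
    (hmn : m < n) (hx : 0 ≤ x) (hy : 0 ≤ y) (hxy : x + y = 2 * t) :
    24 * (((d : ℝ) * n / 4 + min (m : ℝ) ((n : ℝ) / 2) / 2)
        * (t - ((d : ℝ) * n / 4 + min (m : ℝ) ((n : ℝ) / 2) / 2)))
      + 8 * t * n * d - 2 * (n : ℝ) ^ 2 * d ^ 2 - 2 * (n : ℝ) ^ 2 * d
    ≤ 6 * (x * y) + 2 * n * (2 * (⌊2 * x / n⌋₊ : ℝ) * x + 2 * (⌊2 * y / n⌋₊ : ℝ) * y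
      - n / 2 * ((⌊2 * x / n⌋₊ : ℝ) * (⌊2 * x / n⌋₊ + 1)
        + (⌊2 * y / n⌋₊ : ℝ) * (⌊2 * y / n⌋₊ + 1))) := by
  have hn' : (0 : ℝ) < n := by exact_mod_cast hn
  set k := ⌊2 * x / n⌋₊ with hk
  set l := ⌊2 * y / n⌋₊ with hl
  have hk1 : (k : ℝ) ≤ 2 * x / n := Nat.floor_le (by positivity)
  have hk2 : 2 * x / n < k + 1 := Nat.lt_floor_add_one _
  have hl1 : (l : ℝ) ≤ 2 * y / n := Nat.floor_le (by positivity)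
  have hl2 : 2 * y / n < l + 1 := Nat.lt_floor_add_one _
  have hmR : (2 : ℝ) * t = d * n + m := by exact_mod_cast hm
  have hmnR : (m : ℝ) < n := by exact_mod_cast hmn
  have key := split_optimal (k := k) (l := l) (d := d) (α := 2 * x / n - k) (β := 2 * y / n - l)
    (θ := (m : ℝ) / n) (by linarith) (by linarith) (by linarith) (by linarith) (by positivity)
    (by rw [div_lt_one hn']; exact hmnR)
    (by push_cast; field_simp; linarith)
  push_cast at key
  have hmin : min (2 * ((m : ℝ) / n)) 1 = 2 * min (m : ℝ) ((n : ℝ) / 2) / n := by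
    rw [eq_div_iff hn'.ne', min_mul_of_nonneg _ _ hn'.le, mul_min_of_nonneg _ _ (by norm_num)]
    congr 1
    · field_simp
    · ring
  rw [hmin] at key
  set μ := min (m : ℝ) ((n : ℝ) / 2) with hμ
  have e1 : (k : ℝ) + (2 * x / n - k) = 2 * x / n := by ring
  have e2 : (l : ℝ) + (2 * y / n - l) = 2 * y / n := by ring
  rw [e1, e2] at key
  have key2 := mul_le_mul_of_nonneg_right key (show 0 ≤ (n : ℝ) ^ 2 / 2 by positivity)
  have ht : (t : ℝ) = (d * n + m) / 2 := by linarith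
  have l1 : (3 * (((d : ℝ) + 2 * μ / n) * (2 * (d + m / n) - (d + 2 * μ / n))) + 4 * (d : ℝ) ^ 2
      - 4 * d + 8 * ((m : ℝ) / n) * d) * ((n : ℝ) ^ 2 / 2)
      = 24 * ((d * n / 4 + μ / 2) * (t - (d * n / 4 + μ / 2)))
      + 8 * t * n * d - 2 * (n : ℝ) ^ 2 * d ^ 2 - 2 * (n : ℝ) ^ 2 * d := by
    rw [ht]; field_simp; ring
  have l2 : (3 * (2 * x / n * (2 * y / n)) + 4 * k * (2 * x / n) + 4 * l * (2 * y / n)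
      - 2 * k * (k + 1) - 2 * l * (l + 1)) * ((n : ℝ) ^ 2 / 2)
      = 6 * (x * y) + 2 * n * (2 * (k : ℝ) * x + 2 * (l : ℝ) * y
      - n / 2 * ((k : ℝ) * (k + 1) + (l : ℝ) * (l + 1))) := by
    field_simp; ring
  rw [← l1, ← l2]
  exact key2

/-- Rounding down the optimal number of edges in the first class. -/
lemma floor_split {n d m t e₁ e₂ : ℕ} (hm : 2 * t = d * n + m)
    (he₁ : e₁ = ⌊(d : ℝ) * n / 4 + min (m : ℝ) ((n : ℝ) / 2) / 2⌋₊) (he₂ : e₂ = t - e₁) :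
    e₁ + e₂ = t ∧ 24 * ((e₁ : ℝ) * e₂) ≤
      24 * (((d : ℝ) * n / 4 + min (m : ℝ) ((n : ℝ) / 2) / 2)
        * (t - ((d : ℝ) * n / 4 + min (m : ℝ) ((n : ℝ) / 2) / 2))) + 24 * t := by
  have hmR : (2 : ℝ) * t = d * n + m := by exact_mod_cast hm
  have hd : (0 : ℝ) ≤ (d : ℝ) * n := by positivity
  have hm0 : (0 : ℝ) ≤ m := by positivity
  have hn0 : (0 : ℝ) ≤ n := by positivity
  have h1 : min (m : ℝ) ((n : ℝ) / 2) ≤ m := min_le_left _ _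
  have h0 : 0 ≤ min (m : ℝ) ((n : ℝ) / 2) := le_min hm0 (by linarith)
  set E := (d : ℝ) * n / 4 + min (m : ℝ) ((n : ℝ) / 2) / 2 with hE
  have hE0 : 0 ≤ E := by linarith
  have hEt : E ≤ t := by linarith
  have hle : (e₁ : ℝ) ≤ E := by rw [he₁]; exact Nat.floor_le hE0
  have hlt : E < e₁ + 1 := by rw [he₁]; exact Nat.lt_floor_add_one _
  have het : e₁ ≤ t := by exact_mod_cast hle.trans hEt
  have hsum : e₁ + e₂ = t := by omega
  refine ⟨hsum, ?_⟩
  have h2 : (e₂ : ℝ) = t - e₁ := by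
    have : (e₁ : ℝ) + e₂ = t := by exact_mod_cast hsum
    linarith
  rw [h2]
  have e10 : (0 : ℝ) ≤ e₁ := by positivity
  nlinarith

end Optimum

/-! ### The lower bound -/

section LowerBound

open scoped Classical

variable {V : Type*} [Fintype V]

lemma exists_rdeg_eq (G : SimpleGraph V) (x : V) : ∃ k : ℕ, rdeg G x = k :=
  ⟨_, sum_ind _⟩

/-- The tangent at `k` to the convex function `d (d - 1)` on the integers. -/
lemma mul_pred_ge (d k : ℕ) : 2 * (k : ℝ) * d - k * (k + 1) ≤ d * ((d : ℝ) - 1) := by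
  rcases Nat.lt_or_ge k d with h | h
  · have : (k : ℝ) + 1 ≤ d := by exact_mod_cast h
    nlinarith
  · have : (d : ℝ) ≤ k := by exact_mod_cast h
    nlinarith

/-- Lower bounds for the sum of `d (d - 1)` by the tangents at `k` in one class and `l` in the
other. -/
lemma cherries_ge (I : SimpleGraph V) (p : V → Bool) (k l : ℕ) :
    2 * k * classDeg I p true - k * (k + 1) * classCard p true
      + (2 * l * classDeg I p false - l * (l + 1) * classCard p false) ≤ cherries I := by
  have key : ∀ i : Bool, ∀ k : ℕ, 2 * k * classDeg I p i - k * (k + 1) * classCard p i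
      ≤ ∑ x, ind (p x = i) * (rdeg I x * (rdeg I x - 1)) := by
    intro i k
    rw [classDeg, classCard, Finset.mul_sum, Finset.mul_sum, ← Finset.sum_sub_distrib]
    refine Finset.sum_le_sum fun x _ => ?_
    obtain ⟨D, hD⟩ := exists_rdeg_eq I x
    rw [hD]
    have := mul_le_mul_of_nonneg_left (mul_pred_ge D k) (ind_nonneg (p x = i))
    linarith
  rw [cherries, sum_split p]
  linarith [key true k, key false l]

lemma missPairs_eq_zero_or_two_le (G I : SimpleGraph V) (p : V → Bool) :
    missPairs G I p = 0 ∨ 2 ≤ missPairs G I p := by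
  set P : V → V → Prop := fun x y =>
    (p x ≠ p y ∧ ¬G.Adj x y) ∧ (∃ z, I.Adj x z) ∧ ∃ z, I.Adj y z with hP
  have e : missPairs G I p = ∑ q : V × V, ind (P q.1 q.2) := by
    rw [Fintype.sum_prod_type]; rfl
  by_cases h : ∃ x y, P x y
  · right
    obtain ⟨x, y, hxy⟩ := h
    have hyx : P y x := ⟨⟨hxy.1.1.symm, fun h => hxy.1.2 h.symm⟩, hxy.2.2, hxy.2.1⟩
    have hne : (x, y) ≠ (y, x) := fun h => hxy.1.1 (by rw [(Prod.mk.inj h).1])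
    rw [e]
    calc (2 : ℝ) = ∑ q ∈ {(x, y), (y, x)}, ind (P q.1 q.2) := by
          rw [Finset.sum_pair hne, ind_of hxy, ind_of hyx]; norm_num
      _ ≤ _ := Finset.sum_le_sum_of_subset_of_nonneg (Finset.subset_univ _)
          fun _ _ _ => ind_nonneg _
  · left
    push Not at h
    rw [e]
    exact Finset.sum_eq_zero fun q _ => ind_of_not (h q.1 q.2)

/-- A graph with few bowties has few triangles. -/
lemma triTotal_le_of_bowties (G : SimpleGraph V) {t : ℕ} {δ ε : ℝ} (hε : 0 < ε)
    (hδε : 5 * δ ≤ ε) (hn : 8 / ε ≤ (Fintype.card V : ℝ))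
    (ht : (t : ℝ) ≤ δ * (Fintype.card V : ℝ) ^ 2)
    (hB : bowties G ≤ 9 * (t : ℝ) ^ 2 * Fintype.card V) :
    triTotal G ≤ ε * (Fintype.card V : ℝ) ^ 3 := by
  have h := bowties_ge G
  set n : ℝ := (Fintype.card V : ℝ)
  have hn0 : 0 < n := lt_of_lt_of_le (by positivity) hn
  rw [div_le_iff₀ hε] at hn
  by_contra! hc
  set T := triTotal G
  have ht0 : (0 : ℝ) ≤ t := by positivity
  have h1 : n * bowties G ≤ 9 * δ ^ 2 * n ^ 6 := by
    have : (t : ℝ) ^ 2 ≤ (δ * n ^ 2) ^ 2 := by gcongr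
    calc n * bowties G ≤ n * (9 * (δ * n ^ 2) ^ 2 * n) := by
          gcongr
          refine hB.trans ?_
          gcongr
      _ = _ := by ring
  have hT : 8 * n ^ 2 ≤ T := by nlinarith [sq_nonneg n]
  have h2 : T ^ 2 / 2 ≤ 9 * δ ^ 2 * n ^ 6 := by nlinarith
  have hδ0 : 0 ≤ δ := by
    by_contra! hneg
    nlinarith [sq_nonneg n, mul_pos hn0 hn0]
  have h3 : (ε * n ^ 3) ^ 2 < T ^ 2 := by gcongr
  have h4 : 25 * δ ^ 2 ≤ ε ^ 2 := by nlinarith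
  have h5 : 0 ≤ δ ^ 2 * n ^ 6 := by positivity
  have h6 : 25 * δ ^ 2 * n ^ 6 ≤ ε ^ 2 * n ^ 6 := by gcongr
  nlinarith

/-- When the number of inner edges is large compared to `n`, the bowties are counted by convexity
from the triangles alone. -/
lemma bowties_ge_of_many {G I : SimpleGraph V} {p : V → Bool} {κ c S : ℝ} {t : ℕ} (hκ : 0 < κ)
    (hc : 0 < c) (hc1 : c ≤ 1) (hκc : 36 * κ ≤ c) (hI : I ≤ G)
    (hp : ∀ x y, I.Adj x y → p x = p y)
    (hr : ∀ x y, I.Adj x y → missDeg G p x ≤ κ * Fintype.card V)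
    (hh : ∀ i, (1 / 2 - κ) * Fintype.card V ≤ classCard p i)
    (hI2 : 2 * t - 2 * Fintype.card V * S ≤ ∑ x, rdeg I x)
    (hS : Fintype.card V * S ≤ κ * t) (ht : 3 / c * Fintype.card V ≤ t)
    (hn : (0 : ℝ) < Fintype.card V) :
    9 * (1 - c) * (t : ℝ) ^ 2 * Fintype.card V ≤ bowties G := by
  have h1 := triTotal_ge hI hp hr hh
  have h2 := bowties_ge G
  set n : ℝ := (Fintype.card V : ℝ)
  set T := triTotal G
  have ht0 : (0 : ℝ) < t := lt_of_lt_of_le (by positivity) ht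
  have h3 : 3 * (1 - 8 * κ) * n * t ≤ T := by
    have : 2 * (1 - κ) * t ≤ ∑ x, rdeg I x := by linarith
    have h4 : 3 * ((1 / 2 - κ) * n - 2 * (κ * n)) * (2 * (1 - κ) * t) ≤ T := by
      refine le_trans (mul_le_mul_of_nonneg_left this ?_) h1
      have : 0 ≤ (1 / 2 - 3 * κ) * n := mul_nonneg (by linarith) hn.le
      linarith
    have h5 : 0 ≤ n * t := by positivity
    nlinarith [mul_nonneg h5 (mul_nonneg hκ.le hκ.le)]
  rw [div_mul_eq_mul_div, div_le_iff₀ hc] at ht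
  -- the quadratic function `T ^ 2 - 4 n ^ 2 T` is increasing beyond its critical point `2 n ^ 2`
  set T₀ := 3 * (1 - 8 * κ) * n * t with hT₀
  have hT₀' : 4 * n ^ 2 ≤ T₀ := by
    have e : 2 * n ≤ 3 * (1 - 8 * κ) * (t : ℝ) := by nlinarith
    have e' : 4 * n ≤ 3 * (1 - 8 * κ) * (t : ℝ) := by nlinarith
    calc 4 * n ^ 2 = n * (4 * n) := by ring
      _ ≤ n * (3 * (1 - 8 * κ) * (t : ℝ)) := by gcongr
      _ = T₀ := by rw [hT₀]; ring
  have h6 : T₀ ^ 2 - 4 * n ^ 2 * T₀ ≤ n * bowties G := by nlinarith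
  have h7 : n * (9 * (1 - c) * (t : ℝ) ^ 2 * n) ≤ T₀ ^ 2 - 4 * n ^ 2 * T₀ := by
    have e : T₀ ^ 2 - 4 * n ^ 2 * T₀ - n * (9 * (1 - c) * (t : ℝ) ^ 2 * n)
        = n ^ 2 * t * (9 * ((1 - 8 * κ) ^ 2 - (1 - c)) * t - 12 * (1 - 8 * κ) * n) := by
      rw [hT₀]; ring
    have e2 : 0 ≤ 9 * ((1 - 8 * κ) ^ 2 - (1 - c)) * t - 12 * (1 - 8 * κ) * n := by
      have h8 : 9 * (c - 16 * κ) * t ≤ 9 * ((1 - 8 * κ) ^ 2 - (1 - c)) * t := by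
        refine mul_le_mul_of_nonneg_right ?_ ht0.le
        nlinarith [sq_nonneg κ]
      have h9 : 12 * (1 - 8 * κ) * n ≤ 12 * n := by nlinarith
      have h10 : 36 * κ * t ≤ c * t := mul_le_mul_of_nonneg_right hκc ht0.le
      linarith
    nlinarith [mul_nonneg (show 0 ≤ n ^ 2 * t by positivity) e2]
  exact le_of_mul_le_mul_left (h7.trans h6) hn

/-- If the inner degrees sum to `2 t + W` or more, where `W` is the number of missing pairs, then
the surplus of inner edges makes up for the loss of `8 W` at the missing pairs. This needs `t ≥ 2`,
and that `W` is not strictly between `0` and `2`. -/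
lemma sq_degrees_ge {E₁ E₂ W t : ℝ} (hE₁ : 0 ≤ E₁) (hE₂ : 0 ≤ E₂) (ht : 2 ≤ t)
    (hW : W = 0 ∨ 2 ≤ W) (hE : 2 * t + W ≤ E₁ + E₂) :
    4 * t ^ 2 - 4 * t ≤ (E₁ + E₂) ^ 2 - 2 * (E₁ + E₂) - 8 * W := by
  have hW0 : 0 ≤ W := by rcases hW with h | h <;> linarith
  have h1 : (2 * t + W) ^ 2 - 2 * (2 * t + W) ≤ (E₁ + E₂) ^ 2 - 2 * (E₁ + E₂) := by nlinarith
  have h2 : 0 ≤ W * (W - 2) := by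
    rcases hW with h | h
    · rw [h]; simp
    · exact mul_nonneg hW0 (by linarith)
  nlinarith

/-- The quadratic expression in the inner edges is at least `Q` up to a small relative error, when
each of its parts is known up to a small error. -/
lemma quadratic_ge {n t κ c Q c₁ z γ C : ℝ} (hκ : 0 < κ) (hc : 0 < c)
    (hκc : 6000 * κ ≤ c ^ 3) (hκ2 : 6000 * κ ≤ c) (hc1 : c ≤ 1) (hn0 : 0 < n) (hn : 48 ≤ n * κ)
    (h4t : n < 4 * t) (ht : 2 ≤ t) (hQ : 2 * t ^ 2 ≤ Q)
    (hB : Q - 24 * t ≤ 4 * t ^ 2 - 4 * t + 6 * z + 2 * n * c₁) (hz : 0 ≤ z)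
    (hC : 0 ≤ C) (hC₁ : c₁ - 312 * κ * (1 / c) ^ 2 * n ≤ C) (hγ : (1 / 2 - 12 * κ) * n ≤ γ) :
    (1 - (c - 12 * κ)) * Q ≤ 4 * t ^ 2 - 4 * t + 6 * z + 4 * γ * C := by
  have hQpos : 0 ≤ Q := le_trans (by positivity) hQ
  have herr : κ * (1 / c) ^ 2 * n ^ 2 ≤ c / 6000 * (8 * Q) := by
    have h1 : κ * (1 / c) ^ 2 ≤ c / 6000 := by
      rw [one_div, inv_pow, ← div_eq_mul_inv, div_le_iff₀ (by positivity)]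
      linarith
    have h2 : n ^ 2 ≤ 8 * Q := by nlinarith
    exact mul_le_mul h1 h2 (by positivity) (by positivity)
  have herr2 : 24 * t ≤ κ * Q := by
    have h1 : 12 ≤ κ * t := by nlinarith
    have h2 : κ * (2 * t ^ 2) ≤ κ * Q := mul_le_mul_of_nonneg_left hQ hκ.le
    have h3 : 12 * t ≤ κ * t * t := mul_le_mul_of_nonneg_right h1 (by linarith)
    linarith
  have h24 : 0 ≤ 1 - 24 * κ := by linarith
  have hA : 2 * n * (1 - 24 * κ) * (c₁ - 312 * κ * (1 / c) ^ 2 * n) ≤ 4 * γ * C := by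
    calc _ ≤ 2 * n * (1 - 24 * κ) * C := mul_le_mul_of_nonneg_left hC₁ (by positivity)
      _ ≤ _ := by
          refine mul_le_mul_of_nonneg_right ?_ hC
          linarith
  have h1 := mul_le_mul_of_nonneg_left hB h24
  have h2 : 0 ≤ 4 * t ^ 2 - 4 * t + 6 * z := by nlinarith
  have h3 : 0 ≤ κ * (4 * t ^ 2 - 4 * t + 6 * z) := mul_nonneg hκ.le h2
  have h4 : 0 ≤ κ * (κ * (1 / c) ^ 2 * n ^ 2) := by positivity
  have e2 : 2 * n * (1 - 24 * κ) * (c₁ - 312 * κ * (1 / c) ^ 2 * n)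
      = (1 - 24 * κ) * (2 * n * c₁) - 624 * (κ * (1 / c) ^ 2 * n ^ 2)
        + 14976 * (κ * (κ * (1 / c) ^ 2 * n ^ 2)) := by ring
  have h5 : 6000 * κ * Q ≤ c * Q := mul_le_mul_of_nonneg_right hκ2 hQpos
  have h6 : κ * (24 * t) ≥ 0 := mul_nonneg hκ.le (by linarith)
  linarith [mul_nonneg hc.le hQpos]

/-- A total is reduced to a smaller one by reducing both parts. -/
lemma exists_scaled {E₁ E₂ s : ℝ} (hE₁ : 0 ≤ E₁) (hE₂ : 0 ≤ E₂) (hs : 0 < s) (h : s ≤ E₁ + E₂) :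
    ∃ x y, 0 ≤ x ∧ 0 ≤ y ∧ x ≤ E₁ ∧ y ≤ E₂ ∧ x + y = s := by
  have hE : 0 < E₁ + E₂ := by linarith
  have hl0 : 0 ≤ s / (E₁ + E₂) := by positivity
  have hl1 : s / (E₁ + E₂) ≤ 1 := by rw [div_le_one hE]; exact h
  refine ⟨s / (E₁ + E₂) * E₁, s / (E₁ + E₂) * E₂, mul_nonneg hl0 hE₁, mul_nonneg hl0 hE₂,
    mul_le_of_le_one_left hE₁ hl1, mul_le_of_le_one_left hE₂ hl1, ?_⟩
  field_simp

lemma floor_mul_succ_le {n c t z : ℝ} (hn0 : 0 < n) (hc : 0 < c) (hc1 : c ≤ 1)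
    (ht : t ≤ 3 / c * n) (hz0 : 0 ≤ z) (hz : z ≤ 2 * t) :
    (⌊2 * z / n⌋₊ : ℝ) * (⌊2 * z / n⌋₊ + 1) ≤ 156 * (1 / c) ^ 2 := by
  have hK1 : 1 ≤ 1 / c := by rw [le_div_iff₀ hc]; linarith
  have h1 : (⌊2 * z / n⌋₊ : ℝ) ≤ 2 * z / n := Nat.floor_le (by positivity)
  have h2 : 2 * z / n ≤ 12 * (1 / c) := by
    rw [div_le_iff₀ hn0]
    have : (3 : ℝ) / c = 3 * (1 / c) := by ring
    rw [this] at ht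
    linarith
  have h3 : (0 : ℝ) ≤ ⌊2 * z / n⌋₊ := by positivity
  calc _ ≤ 12 * (1 / c) * (12 * (1 / c) + 1 / c) := by gcongr <;> linarith
    _ = _ := by ring

lemma cherries_ge_of_balanced {I : SimpleGraph V} {p : V → Bool} {n κ x y B : ℝ} (k l : ℕ)
    (hκn : 0 ≤ κ * n) (ha : ∀ i, classCard p i ≤ (1 / 2 + κ) * n) (hx : x ≤ classDeg I p true)
    (hy : y ≤ classDeg I p false) (hk : (k : ℝ) * (k + 1) ≤ B) (hl : (l : ℝ) * (l + 1) ≤ B) :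
    2 * (k : ℝ) * x + 2 * (l : ℝ) * y - n / 2 * ((k : ℝ) * (k + 1) + (l : ℝ) * (l + 1))
      - 2 * B * (κ * n) ≤ cherries I := by
  refine le_trans ?_ (cherries_ge I p k l)
  have h1 : (k : ℝ) * (k + 1) * classCard p true ≤ (k : ℝ) * (k + 1) * ((1 / 2 + κ) * n) :=
    mul_le_mul_of_nonneg_left (ha true) (by positivity)
  have h2 : (l : ℝ) * (l + 1) * classCard p false ≤ (l : ℝ) * (l + 1) * ((1 / 2 + κ) * n) :=
    mul_le_mul_of_nonneg_left (ha false) (by positivity)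
  have h3 : 2 * (k : ℝ) * x ≤ 2 * k * classDeg I p true :=
    mul_le_mul_of_nonneg_left hx (by positivity)
  have h4 : 2 * (l : ℝ) * y ≤ 2 * l * classDeg I p false :=
    mul_le_mul_of_nonneg_left hy (by positivity)
  have h5 : κ * n * ((k : ℝ) * (k + 1) + (l : ℝ) * (l + 1)) ≤ κ * n * (2 * B) :=
    mul_le_mul_of_nonneg_left (by linarith) hκn
  linarith

set_option maxHeartbeats 1000000 in
/-- When the number `t` of inner edges is at most linear in `n`, the bowties are counted from the
pairs of inner edges. Their degrees enter through `cherries`, which is bounded below by convexity,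
and the split between the two classes is controlled by `split_optimal_degrees`. -/
lemma bowties_ge_of_linear {G I : SimpleGraph V} {p : V → Bool} {κ c : ℝ} {n t d m e₁ e₂ : ℕ}
    (hκ : 0 < κ) (hc : 0 < c) (hc1 : c ≤ 1) (hκc : 6000 * κ ≤ c ^ 3) (hI : I ≤ G)
    (hp : ∀ x y, I.Adj x y → p x = p y)
    (hr : ∀ x y, I.Adj x y → missDeg G p x ≤ κ * n)
    (hh : ∀ i, (1 / 2 - κ) * n ≤ classCard p i)
    (hI2 : 2 * t + missPairs G I p ≤ ∑ x, rdeg I x) (hV : Fintype.card V = n)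
    (ht2 : 2 ≤ t) (ht : (t : ℝ) ≤ 3 / c * n) (hn : 48 / κ ≤ n)
    (hm : 2 * t = d * n + m) (hmn : m < n)
    (he₁ : e₁ = ⌊(d : ℝ) * n / 4 + min (m : ℝ) ((n : ℝ) / 2) / 2⌋₊) (he₂ : e₂ = t - e₁) :
    8 * (1 - c) * mainTerm n d m e₁ e₂ ≤ bowties G := by
  have hκ2 : 6000 * κ ≤ c := hκc.trans (by nlinarith [mul_nonneg hc.le (sub_nonneg.2 hc1)])
  rw [div_le_iff₀ hκ] at hn
  have hn0 : (0 : ℝ) < n := pos_of_mul_pos_left (by linarith) hκ.le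
  set g : ℝ := (1 / 2 - κ) * n - 4 * (κ * n) - 2 with hg
  have hg1 : (1 / 2 - 6 * κ) * n ≤ g := by linarith
  have hκ0 : 0 ≤ (1 / 2 - 12 * κ) * n := mul_nonneg (by linarith) hn0.le
  have hg0 : 0 ≤ g := by linarith [mul_pos hκ hn0]
  have hmain := bowties_ge_of_inner hI hp hr hh (by positivity) hg hg0
  set E₁ := classDeg I p true
  set E₂ := classDeg I p false
  have hE₁ : 0 ≤ E₁ := classDeg_nonneg I p true
  have hE₂ : 0 ≤ E₂ := classDeg_nonneg I p false
  have hE : E₁ + E₂ = ∑ x, rdeg I x := classDeg_add I p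
  set W := missPairs G I p
  have hW := missPairs_eq_zero_or_two_le G I p
  have hch := cherries_nonneg I
  set γ : ℝ := g - 1 - 4 * (κ * n) with hγ
  have hγ1 : (1 / 2 - 12 * κ) * n ≤ γ := by linarith
  have htR : (2 : ℝ) ≤ t := by exact_mod_cast ht2
  have hsq := sq_degrees_ge hE₁ hE₂ htR hW (by linarith)
  have hn2 : (2 : ℕ) ≤ n := by
    have : (n : ℝ) * κ ≤ n * 1 := mul_le_mul_of_nonneg_left (by linarith) hn0.le
    have : (2 : ℝ) ≤ n := by linarith
    exact_mod_cast this
  obtain ⟨hee, hfl⟩ := floor_split hm he₁ he₂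
  -- it suffices to compare the two bracketed quadratic expressions
  set Q : ℝ := 4 * (t : ℝ) ^ 2 - 4 * t + 24 * (e₁ * e₂)
      + 8 * t * n * d - 2 * (n : ℝ) ^ 2 * d ^ 2 - 2 * (n : ℝ) ^ 2 * d with hQ
  have hM := mainTerm_eq hm hee
  have hQ0 : 4 * (t : ℝ) ^ 2 - 4 * t ≤ Q := by
    have := mainTerm_ge hm hee
    rw [hM] at this
    exact le_of_mul_le_mul_left this (by positivity)
  have htt : 2 * (t : ℝ) ^ 2 ≤ Q := by nlinarith
  have hQpos : 0 ≤ Q := le_trans (by positivity) htt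
  suffices hsuff : (1 - (c - 12 * κ)) * Q ≤ E₁ ^ 2 + E₂ ^ 2 - 2 * (E₁ + E₂) + 8 * (E₁ * E₂) - 8 * W
      + 4 * γ * cherries I by
    have h1 : 8 * (1 - c) * mainTerm n d m e₁ e₂ = (1 - c) * ((n : ℝ) / 2 * Q) := by
      rw [← hM]; ring
    rw [h1]
    have h2 : (1 - 12 * κ) * ((n : ℝ) / 2) * ((1 - (c - 12 * κ)) * Q) ≤ bowties G := by
      refine le_trans ?_ hmain
      refine mul_le_mul ?_ hsuff ?_ hg0
      · linarith
      · exact mul_nonneg (by linarith) hQpos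
    refine le_trans ?_ h2
    have h3 : 1 - c ≤ (1 - 12 * κ) * (1 - (c - 12 * κ)) := by
      have : 0 ≤ κ * (c - 12 * κ) := mul_nonneg hκ.le (by linarith)
      linarith
    have h4 : 0 ≤ (n : ℝ) / 2 * Q := mul_nonneg (by positivity) hQpos
    linarith [mul_le_mul_of_nonneg_right h3 h4]
  rcases Nat.lt_or_ge n (4 * t) with h4t | h4t
  swap
  · -- with at most `n / 4` inner edges the optimal configuration is a matching in one class
    have hd : d = 0 := by
      by_contra hd
      have : n ≤ d * n := Nat.le_mul_of_pos_left n (Nat.pos_of_ne_zero hd)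
      omega
    subst hd
    have hm' : (m : ℝ) = 2 * t := by
      have : m = 2 * t := by omega
      exact_mod_cast this
    have he : e₁ = t := by
      have h4R : (4 : ℝ) * t ≤ n := by exact_mod_cast h4t
      rw [he₁, hm', min_eq_left (by linarith)]
      simp
    have he' : e₂ = 0 := by omega
    have hQe : Q = 4 * (t : ℝ) ^ 2 - 4 * t := by
      rw [hQ, he']; push_cast; ring
    have h1 : 0 ≤ 4 * γ * cherries I := mul_nonneg (by linarith) hch
    have h2 : 0 ≤ (c - 12 * κ) * Q := mul_nonneg (by linarith) hQpos
    have e1 : (E₁ + E₂) ^ 2 = E₁ ^ 2 + E₂ ^ 2 + 2 * (E₁ * E₂) := by ring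
    linarith [mul_nonneg hE₁ hE₂]
  · have h4R : (n : ℝ) < 4 * t := by exact_mod_cast h4t
    -- only `2 t` of the total degree is used
    obtain ⟨x, y, hx0, hy0, hxE, hyE, hxy⟩ := exists_scaled hE₁ hE₂ (s := 2 * (t : ℝ))
      (by linarith) (by rcases hW with h | h <;> linarith)
    have hopt := split_optimal_degrees (by omega) hm hmn hx0 hy0 hxy
    have hcard := classCard_add p
    rw [hV] at hcard
    have ha : ∀ i, classCard p i ≤ (1 / 2 + κ) * n := by
      intro i
      cases i
      · linarith [hh true]
      · linarith [hh false]
    have hcher := cherries_ge_of_balanced ⌊2 * x / n⌋₊ ⌊2 * y / n⌋₊ (mul_nonneg hκ.le hn0.le) ha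
      hxE hyE (floor_mul_succ_le hn0 hc hc1 ht hx0 (by linarith))
      (floor_mul_succ_le hn0 hc hc1 ht hy0 (by linarith))
    set c₁ : ℝ := 2 * (⌊2 * x / n⌋₊ : ℝ) * x + 2 * (⌊2 * y / n⌋₊ : ℝ) * y
      - n / 2 * ((⌊2 * x / n⌋₊ : ℝ) * (⌊2 * x / n⌋₊ + 1)
        + (⌊2 * y / n⌋₊ : ℝ) * (⌊2 * y / n⌋₊ + 1)) with hc₁
    have hcher' : c₁ - 312 * κ * (1 / c) ^ 2 * n ≤ cherries I := by
      linarith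
    have hxyE : x * y ≤ E₁ * E₂ := mul_le_mul hxE hyE hy0 hE₁
    have hB : Q - 24 * t ≤ 4 * (t : ℝ) ^ 2 - 4 * t + 6 * (x * y) + 2 * n * c₁ := by
      rw [hQ]
      linarith
    have hfin := quadratic_ge hκ hc hκc hκ2 hc1 hn0 hn h4R htR htt hB (mul_nonneg hx0 hy0) hch
      hcher' hγ1
    refine hfin.trans ?_
    have e1 : (E₁ + E₂) ^ 2 = E₁ ^ 2 + E₂ ^ 2 + 2 * (E₁ * E₂) := by ring
    linarith

end LowerBound

section LowerBoundMain

/-- The lower bound for the number of bowties in a graph with at least `n ^ 2 / 4 + t` edges. The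
factor `8` is the number of ordered bowties for each unordered one. -/
theorem bowties_lower {c : ℝ} (hc : 0 < c) (hc1 : c ≤ 1) :
    ∃ δ : ℝ, 0 < δ ∧ ∀ n t : ℕ, 1 / δ ≤ (n : ℝ) → (t : ℝ) ≤ δ * (n : ℝ) ^ 2 → 2 ≤ t →
      ∀ d m e₁ e₂ : ℕ, 2 * t = d * n + m → m < n →
      e₁ = ⌊(d : ℝ) * n / 4 + min (m : ℝ) ((n : ℝ) / 2) / 2⌋₊ → e₂ = t - e₁ →
      ∀ G : SimpleGraph (Fin n), n ^ 2 / 4 + t ≤ G.edgeSet.ncard →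
        8 * (1 - c) * mainTerm n d m e₁ e₂ ≤ bowties G := by
  set κ : ℝ := c ^ 3 / 6000 with hκ
  have hκ0 : 0 < κ := by positivity
  have hκc : 6000 * κ ≤ c ^ 3 := by rw [hκ]; linarith
  have hc3 : c ^ 3 ≤ c := by
    have : c ^ 2 ≤ 1 := pow_le_one₀ hc.le hc1
    calc c ^ 3 = c * c ^ 2 := by ring
      _ ≤ c * 1 := by gcongr
      _ = c := mul_one c
  have hκ1 : κ ≤ 1 := by linarith
  have hpow : ∀ a b : ℕ, a ≤ b → κ ^ b ≤ κ ^ a := fun a b h => pow_le_pow_of_le_one hκ0.le hκ1 h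
  refine ⟨κ ^ 6 / 10 ^ 5, by positivity, ?_⟩
  intro n t hn ht ht2 d m e₁ e₂ hm hmn he₁ he₂ G hG
  have hn6 : 10 ^ 5 ≤ n * κ ^ 6 := by
    rw [one_div, inv_div, div_le_iff₀ (by positivity)] at hn
    exact hn
  have hnk : ∀ k : ℕ, k ≤ 6 → 10 ^ 5 ≤ n * κ ^ k := fun k hk =>
    hn6.trans (mul_le_mul_of_nonneg_left (hpow k 6 hk) (by positivity))
  have hn0 : (0 : ℝ) < n := pos_of_mul_pos_left (by linarith) (pow_pos hκ0 6).le
  have hV : Fintype.card (Fin n) = n := Fintype.card_fin n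
  have htR : (2 : ℝ) ≤ t := by exact_mod_cast ht2
  obtain ⟨hee, -⟩ := floor_split hm he₁ he₂
  have hM1 := mainTerm_le hm hee
  have hM0 : 0 ≤ mainTerm n d m e₁ e₂ := by
    have h1 := mainTerm_ge hm hee
    have h2 : 0 ≤ (n : ℝ) / 2 * (4 * (t : ℝ) ^ 2 - 4 * t) :=
      mul_nonneg (by positivity) (by nlinarith)
    linarith
  -- otherwise there are few bowties, hence few triangles
  by_contra! hlt
  have hB : bowties G ≤ 9 * (t : ℝ) ^ 2 * n := by nlinarith
  have hT := triTotal_le_of_bowties G (t := t) (δ := κ ^ 6 / 10 ^ 5) (ε := (κ ^ 2 / 32) ^ 2)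
    (by positivity) (by
      have := hpow 4 6 (by norm_num)
      have e : (κ ^ 2 / 32) ^ 2 = κ ^ 4 / 1024 := by ring
      rw [e]
      linarith [pow_pos hκ0 4]) (by
      rw [hV, div_le_iff₀ (by positivity)]
      have e : (κ ^ 2 / 32) ^ 2 = κ ^ 4 / 1024 := by ring
      rw [e]
      linarith [hnk 4 (by norm_num)]) (by rw [hV]; exact ht) (by rw [hV]; exact hB)
  obtain ⟨p, I, S, hI, hp, hr, hh, hI2, hS, hS01⟩ := exists_structure G hκ0 (t := t) (by omega)
    (by rw [hV]; exact hG) (by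
      rw [hV, div_le_iff₀ (by positivity)]
      linarith [hnk 2 (by norm_num)]) hT
  rw [hV] at hr hh hI2 hS
  have hW : 0 ≤ missPairs G I p := by
    rcases missPairs_eq_zero_or_two_le G I p with h | h <;> linarith
  -- the bowties centred at heavy vertices bound their number
  have hS4 : S * (κ ^ 4 * (n : ℝ) ^ 3) ≤ 288 * (t : ℝ) ^ 2 := by
    have h1 : S * ((κ * n / 2) ^ 4 / 2) ≤ 9 * (t : ℝ) ^ 2 * n := hS.trans hB
    have e : S * ((κ * n / 2) ^ 4 / 2) = S * (κ ^ 4 * (n : ℝ) ^ 3) / 32 * n := by ring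
    rw [e] at h1
    have := le_of_mul_le_mul_right h1 hn0
    linarith
  have hS0 : 0 ≤ S := by rcases hS01 with h | h <;> linarith
  rcases le_total (3 / c * (n : ℝ)) t with hcase | hcase
  · have hSn : (n : ℝ) * S ≤ κ * t := by
      have h1 : 288 * (t : ℝ) ^ 2 ≤ κ ^ 5 * n ^ 2 * t := by
        have h2 : 288 * (t : ℝ) ≤ κ ^ 5 * n ^ 2 := by
          have h3 := hpow 5 6 (by norm_num)
          have h4 : κ ^ 6 * (n : ℝ) ^ 2 ≤ κ ^ 5 * (n : ℝ) ^ 2 :=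
            mul_le_mul_of_nonneg_right h3 (by positivity)
          have h5 : 0 ≤ κ ^ 6 * (n : ℝ) ^ 2 := by positivity
          linarith
        nlinarith
      have h2 := hS4.trans h1
      have h3 : (n : ℝ) * S * (κ ^ 4 * n ^ 2) ≤ κ * t * (κ ^ 4 * n ^ 2) := by linarith
      exact le_of_mul_le_mul_right h3 (by positivity)
    have h1 := bowties_ge_of_many (t := t) (S := S) hκ0 hc hc1 (by linarith) hI hp
      (by rw [hV]; exact hr) (by rw [hV]; exact hh) (by rw [hV]; linarith) (by rw [hV]; exact hSn)
      (by rw [hV]; exact hcase) (by rw [hV]; exact hn0)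
    rw [hV] at h1
    have h2 := mul_le_mul_of_nonneg_left hM1 (sub_nonneg.2 hc1)
    linarith
  · -- a single heavy vertex would already be the centre of too many bowties
    have hS' : S = 0 := by
      rcases hS01 with h | h
      · exact h
      · exfalso
        have h1 : (t : ℝ) ^ 2 ≤ (3 / c * n) ^ 2 := by gcongr
        have h2 : κ ^ 4 * (n : ℝ) ^ 3 ≤ S * (κ ^ 4 * (n : ℝ) ^ 3) :=
          le_mul_of_one_le_left (by positivity) h
        have h3 : κ ^ 4 * (n : ℝ) ^ 3 ≤ 288 * (3 / c * n) ^ 2 := by linarith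
        have h4 : κ ^ 4 * c ^ 2 * n ≤ 2592 := by
          have e : 288 * (3 / c * (n : ℝ)) ^ 2 * c ^ 2 = 2592 * n ^ 2 := by field_simp; ring
          have h5 := mul_le_mul_of_nonneg_right h3 (sq_nonneg c)
          rw [e] at h5
          have h6 : κ ^ 4 * c ^ 2 * n * (n : ℝ) ^ 2 ≤ 2592 * (n : ℝ) ^ 2 := by linarith
          exact le_of_mul_le_mul_right h6 (by positivity)
        have h5 : κ ^ 2 ≤ c ^ 2 := by
          have : κ ≤ c := by linarith
          gcongr
        have h6 : κ ^ 4 * κ ^ 2 * n ≤ κ ^ 4 * c ^ 2 * n := by gcongr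
        linarith
    rw [hS'] at hI2
    have := bowties_ge_of_linear hκ0 hc hc1 hκc hI hp hr hh (by linarith) hV ht2 hcase
      (by rw [div_le_iff₀ hκ0]; linarith [hnk 1 (by norm_num)]) hm hmn he₁ he₂
    linarith

end LowerBoundMain

/-! ### Nearly regular graphs -/

section NearRegular

open scoped Classical

variable {V : Type*} [Fintype V]

/-- The complete graph on a class. -/
def classClique (p : V → Bool) (i : Bool) : SimpleGraph V where
  Adj x y := x ≠ y ∧ p x = i ∧ p y = i
  symm := ⟨fun _ _ h => ⟨h.1.symm, h.2.2, h.2.1⟩⟩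
  loopless := ⟨fun _ h => h.1 rfl⟩

lemma sum_rdeg_classClique (p : V → Bool) (i : Bool) :
    ∑ x, rdeg (classClique p i) x = classCard p i * (classCard p i - 1) := by
  have h : ∀ x, rdeg (classClique p i) x = ind (p x = i) * (classCard p i - 1) := by
    intro x
    by_cases hx : p x = i
    · rw [ind_of hx, one_mul, rdeg, classCard, ← sum_ind_eq x, ← Finset.sum_sub_distrib]
      refine Finset.sum_congr rfl fun y _ => ?_
      by_cases hxy : x = y
      · subst hxy
        simp [ind, classClique, hx]
      · simp [ind, classClique, hx, hxy]
    · rw [ind_of_not hx, zero_mul]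
      exact Finset.sum_eq_zero fun y _ => ind_of_not fun h => hx h.2.1
  simp only [h, ← Finset.sum_mul]
  rfl

lemma exists_graph_in_class (p : V → Bool) (i : Bool) (e : ℕ)
    (he : 2 * (e : ℝ) ≤ classCard p i * (classCard p i - 1)) :
    ∃ I : SimpleGraph V, I ≤ classClique p i ∧ ∑ x, rdeg I x = 2 * e := by
  have h1 : e ≤ (classClique p i).edgeFinset.card := by
    have := sum_rdeg (classClique p i)
    rw [sum_rdeg_classClique, ← SimpleGraph.coe_edgeFinset, Set.ncard_coe_finset] at this
    have : (e : ℝ) ≤ (classClique p i).edgeFinset.card := by linarith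
    exact_mod_cast this
  obtain ⟨F, hF, hFe⟩ := Finset.exists_subset_card_eq h1
  have hF' : (F : Set (Sym2 V)) ⊆ (classClique p i).edgeSet := by
    rw [← SimpleGraph.coe_edgeFinset]
    exact_mod_cast hF
  have hE : (SimpleGraph.fromEdgeSet (F : Set (Sym2 V))).edgeSet = F := by
    rw [SimpleGraph.edgeSet_fromEdgeSet]
    ext q
    simp only [Set.mem_sdiff, and_iff_left_iff_imp]
    exact fun hq => (classClique p i).not_isDiag_of_mem_edgeSet (hF' hq)
  refine ⟨SimpleGraph.fromEdgeSet F, ?_, ?_⟩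
  · rw [← SimpleGraph.edgeSet_subset_edgeSet, hE]
    exact hF'
  · rw [sum_rdeg, hE, Set.ncard_coe_finset, hFe]

/-- The graph obtained by moving the end `u` of the edge `u w` to `v`. -/
def moveEdge (I : SimpleGraph V) {u v w : V} (hvw : v ≠ w) : SimpleGraph V where
  Adj x y := (I.Adj x y ∧ ¬(x = u ∧ y = w) ∧ ¬(x = w ∧ y = u)) ∨ (x = v ∧ y = w) ∨ (x = w ∧ y = v)
  symm := ⟨fun x y h => by
    have := I.adj_comm x y
    tauto⟩
  loopless := ⟨fun x h => by
    rcases h with h | h | h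
    · exact h.1.ne rfl
    · exact hvw (h.1.symm.trans h.2)
    · exact hvw (h.2.symm.trans h.1)⟩

lemma rdeg_moveEdge (I : SimpleGraph V) {u v w : V} (hvw : v ≠ w) (huw : I.Adj u w)
    (hv : ¬I.Adj v w) (x : V) :
    rdeg (moveEdge I (u := u) hvw) x = rdeg I x - ind (x = u) + ind (x = v) := by
  have huv : u ≠ v := by rintro rfl; exact hv huw
  have key : ∀ y, ind ((moveEdge I (u := u) hvw).Adj x y) = ind (I.Adj x y)
      - ind (x = u) * ind (y = w) - ind (x = w) * ind (y = u)
      + ind (x = v) * ind (y = w) + ind (x = w) * ind (y = v) := by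
    intro y
    simp only [moveEdge]
    by_cases h1 : x = u
    · subst h1
      by_cases h2 : y = w
      · subst h2
        simp [ind, huw, huw.ne, huv]
      · simp [ind, h2, huw.ne, huv]
    · by_cases h2 : x = v
      · subst h2
        by_cases h3 : y = w
        · subst h3
          simp [ind, h1, hvw, hv]
        · simp [ind, h1, hvw, h3]
      · by_cases h3 : x = w
        · subst h3
          by_cases h4 : y = u
          · subst h4
            simp [ind, h1, h2, huw.symm, huv]
          · by_cases h5 : y = v
            · subst h5
              simp [ind, h1, h2, h4, I.adj_comm x y, hv]
            · simp [ind, h1, h2, h4, h5]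
        · simp [ind, h1, h2, h3]
  rw [rdeg, Finset.sum_congr rfl fun y _ => key y]
  simp only [Finset.sum_add_distrib, Finset.sum_sub_distrib, ← Finset.mul_sum, sum_ind_eq',
    mul_one]
  rw [← rdeg]
  ring

/-- A graph on a class with a given number of edges that minimises the sum of the squares of the
degrees is nearly regular. -/
lemma exists_nearly_regular (p : V → Bool) (i : Bool) (e : ℕ)
    (he : 2 * (e : ℝ) ≤ classCard p i * (classCard p i - 1)) :
    ∃ I : SimpleGraph V, I ≤ classClique p i ∧ ∑ x, rdeg I x = 2 * e ∧
      ∀ x y, p x = i → p y = i → rdeg I x ≤ rdeg I y + 1 := by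
  obtain ⟨I₀, hI₀⟩ := exists_graph_in_class p i e he
  obtain ⟨I, hI, hmin⟩ := Set.exists_min_image
    {I : SimpleGraph V | I ≤ classClique p i ∧ ∑ x, rdeg I x = 2 * e}
    (fun I => ∑ x, rdeg I x ^ 2) (Set.toFinite _) ⟨I₀, hI₀⟩
  refine ⟨I, hI.1, hI.2, fun u v hu hv => ?_⟩
  by_contra! hlt
  -- moving an edge from a vertex of larger degree to one of smaller degree decreases the sum
  obtain ⟨w, huw, hvw, hne⟩ : ∃ w, I.Adj u w ∧ ¬I.Adj v w ∧ v ≠ w := by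
    by_contra! hcon
    have : rdeg I u ≤ rdeg I v + 1 := by
      rw [← sum_ind_eq v, rdeg, rdeg, ← Finset.sum_add_distrib]
      refine Finset.sum_le_sum fun w _ => ?_
      by_cases h1 : I.Adj u w
      · by_cases h2 : I.Adj v w
        · rw [ind_of h1, ind_of h2]
          linarith [ind_nonneg (v = w)]
        · rw [ind_of h1, ind_of (hcon w h1 h2)]
          linarith [ind_nonneg (I.Adj v w)]
      · rw [ind_of_not h1]
        exact add_nonneg (ind_nonneg _) (ind_nonneg _)
    linarith
  have huv : u ≠ v := by rintro rfl; exact hvw huw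
  have hdeg := rdeg_moveEdge I hne huw hvw
  have h1 := hmin (moveEdge I (u := u) hne) ⟨?_, ?_⟩
  · have h2 : ∑ x, rdeg (moveEdge I (u := u) hne) x ^ 2
        = ∑ x, rdeg I x ^ 2 + 2 * rdeg I v - 2 * rdeg I u + 2 := by
      have h3 : ∀ x, rdeg (moveEdge I (u := u) hne) x ^ 2
          = rdeg I x ^ 2 + (2 * rdeg I x + 1) * ind (x = v)
            + (1 - 2 * rdeg I x) * ind (x = u) := by
        intro x
        rw [hdeg]
        by_cases k1 : x = u
        · have k2 : x ≠ v := fun k => huv (k1.symm.trans k)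
          simp only [ind, k1, huv]
          simp
          ring
        · by_cases k2 : x = v
          · simp only [ind, k2, huv.symm]
            simp
            ring
          · simp [ind, k1, k2]
      simp only [h3, Finset.sum_add_distrib]
      rw [sum_mul_ind_eq' (fun x => 2 * rdeg I x + 1), sum_mul_ind_eq' (fun x => 1 - 2 * rdeg I x)]
      ring
    rw [h2] at h1
    obtain ⟨a, ha⟩ := exists_rdeg_eq I u
    obtain ⟨b, hb⟩ := exists_rdeg_eq I v
    rw [ha, hb] at hlt h1
    have h4 : b + 1 < a := by exact_mod_cast hlt
    have h5 : (b : ℝ) + 2 ≤ a := by exact_mod_cast h4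
    linarith
  · intro x y h
    rcases h with h | h | h
    · exact hI.1 h.1
    · rw [h.1, h.2]
      exact ⟨hne, hv, (hI.1 huw).2.2⟩
    · rw [h.1, h.2]
      exact ⟨hne.symm, (hI.1 huw).2.2, hv⟩
  · rw [← hI.2]
    simp only [hdeg, Finset.sum_add_distrib, Finset.sum_sub_distrib, sum_ind_eq']
    ring

/-- In a nearly regular graph on a class of size `a` whose degree sum is within `R < a` of the
interval `[D a, (D + 1) a]`, the degrees are at most `D + 2`, and almost all degrees are `D` or
`D + 1`. -/
lemma nearly_regular_bounds {I : SimpleGraph V} {p : V → Bool} {i : Bool} {E R : ℝ} {D : ℕ}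
    (hE : classDeg I p i = E)
    (hreg : ∀ x y, p x = i → p y = i → rdeg I x ≤ rdeg I y + 1)
    (h1 : D * classCard p i - R ≤ E) (h2 : E ≤ (D + 1) * classCard p i + R) (hR0 : 0 ≤ R)
    (hR : R < classCard p i) :
    (∑ x, ind (p x = i) * (rdeg I x * (rdeg I x - 1))
      ≤ 2 * D * E - D * (D + 1) * classCard p i + 2 * R) ∧
    (∀ x, p x = i → rdeg I x ≤ D + 2) ∧ (R = 0 → ∀ x, p x = i → rdeg I x ≤ D + 1) := by
  have hsum : ∀ f : V → ℝ, ∀ g : V → ℝ, (∀ x, p x = i → f x ≤ g x) →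
      ∑ x, ind (p x = i) * f x ≤ ∑ x, ind (p x = i) * g x := by
    intro f g h
    refine Finset.sum_le_sum fun x _ => ?_
    by_cases hx : p x = i
    · rw [ind_of hx, one_mul, one_mul]; exact h x hx
    · rw [ind_of_not hx, zero_mul, zero_mul]
  have hlin : ∀ a b : ℝ, ∑ x, ind (p x = i) * (a * rdeg I x + b) = a * E + b * classCard p i := by
    intro a b
    rw [← hE, classDeg, classCard, Finset.mul_sum, Finset.mul_sum, ← Finset.sum_add_distrib]
    exact Finset.sum_congr rfl fun x _ => by ring
  have hnat : ∀ x, ∃ k : ℕ, rdeg I x = k := exists_rdeg_eq I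
  have hlt : ∀ x (q : ℤ), (q : ℝ) < rdeg I x → (q : ℝ) + 1 ≤ rdeg I x := by
    intro x q h
    obtain ⟨k, hk⟩ := hnat x
    rw [hk] at h ⊢
    have : q < k := by exact_mod_cast h
    exact_mod_cast this
  have hlt' : ∀ x (q : ℤ), rdeg I x < q → rdeg I x ≤ q - 1 := by
    intro x q h
    obtain ⟨k, hk⟩ := hnat x
    rw [hk] at h ⊢
    have : (k : ℤ) < q := by exact_mod_cast h
    have : (k : ℤ) ≤ q - 1 := by omega
    exact_mod_cast this
  by_cases c1 : ∃ y, p y = i ∧ rdeg I y < D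
  · -- the degrees are `D - 1` and `D`
    obtain ⟨y, hy, hyD⟩ := c1
    have hyD' := hlt' y D (by exact_mod_cast hyD)
    push_cast at hyD'
    have hup : ∀ x, p x = i → rdeg I x ≤ D := fun x hx => by linarith [hreg x y hx hy]
    have hlow : ∀ x, p x = i → (D : ℝ) - 1 ≤ rdeg I x := by
      intro x hx
      by_contra! hc
      have hx' := hlt' x (D - 1) (by exact_mod_cast hc)
      push_cast at hx'
      have hall : ∀ z, p z = i → rdeg I z ≤ 0 * rdeg I z + ((D : ℝ) - 1) := fun z hz => by
        linarith [hreg z x hz hx]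
      have := hsum _ _ hall
      rw [hlin, ← classDeg, hE] at this
      linarith
    refine ⟨?_, fun x hx => by linarith [hup x hx], fun _ x hx => by linarith [hup x hx]⟩
    have hall : ∀ x, p x = i → rdeg I x * (rdeg I x - 1)
        ≤ (2 * (D : ℝ) - 2) * rdeg I x + (2 * D - D * (D + 1)) := by
      intro x hx
      nlinarith [mul_nonneg (sub_nonneg.2 (hup x hx)) (sub_nonneg.2 (hlow x hx))]
    have := hsum _ _ hall
    rw [hlin] at this
    linarith
  · push Not at c1
    by_cases c2 : ∃ y, p y = i ∧ (D : ℝ) + 1 < rdeg I y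
    · -- the degrees are `D + 1` and `D + 2`
      obtain ⟨y, hy, hyD⟩ := c2
      have hyD' := hlt y (D + 1) (by exact_mod_cast hyD)
      push_cast at hyD'
      have hlow : ∀ x, p x = i → (D : ℝ) + 1 ≤ rdeg I x := fun x hx => by linarith [hreg y x hy hx]
      have hup : ∀ x, p x = i → rdeg I x ≤ D + 2 := by
        intro x hx
        by_contra! hc
        have hx' := hlt x (D + 2) (by exact_mod_cast hc)
        push_cast at hx'
        have hall : ∀ z, p z = i → 0 * rdeg I z + ((D : ℝ) + 2) ≤ rdeg I z := fun z hz => by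
          linarith [hreg x z hx hz]
        have := hsum _ _ hall
        rw [hlin, ← classDeg, hE] at this
        linarith
      refine ⟨?_, hup, ?_⟩
      · have hall : ∀ x, p x = i → rdeg I x * (rdeg I x - 1)
            ≤ (2 * (D : ℝ) + 2) * rdeg I x + (-2 * (D + 1) - D * (D + 1)) := by
          intro x hx
          nlinarith [mul_nonneg (sub_nonneg.2 (hup x hx)) (sub_nonneg.2 (hlow x hx))]
        have := hsum _ _ hall
        rw [hlin] at this
        linarith
      · intro hR x hx
        by_contra! hc
        have h3 : ∑ z, ind (p z = i) * (0 * rdeg I z + ((D : ℝ) + 1))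
            < ∑ z, ind (p z = i) * rdeg I z := by
          refine Finset.sum_lt_sum (fun z _ => ?_) ⟨x, Finset.mem_univ x, ?_⟩
          · by_cases hz : p z = i
            · rw [ind_of hz]; linarith [hlow z hz]
            · rw [ind_of_not hz]; simp
          · rw [ind_of hx]; linarith
        rw [hlin, ← classDeg, hE] at h3
        linarith
    · push Not at c2
      refine ⟨?_, fun x hx => by linarith [c2 x hx], fun _ => c2⟩
      have hall : ∀ x, p x = i → rdeg I x * (rdeg I x - 1)
          ≤ 2 * (D : ℝ) * rdeg I x + (- (D * (D + 1))) := by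
        intro x hx
        nlinarith [mul_nonneg (sub_nonneg.2 (c1 x hx)) (sub_nonneg.2 (c2 x hx))]
      have := hsum _ _ hall
      rw [hlin] at this
      linarith

end NearRegular

/-! ### Complete bipartite graphs with additional inner edges -/

section Construction

open scoped Classical

variable {V : Type*} [Fintype V]

/-- The graph with the inner edges `I` and all edges between the classes of `p`. -/
def bipartitePlus (I : SimpleGraph V) (p : V → Bool) : SimpleGraph V where
  Adj x y := I.Adj x y ∨ p x ≠ p y
  symm := ⟨fun _ _ h => h.imp (fun h => h.symm) Ne.symm⟩
  loopless := ⟨fun _ h => h.elim (fun h => h.ne rfl) fun h => h rfl⟩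

lemma ncard_edgeSet_bipartitePlus {I : SimpleGraph V} {p : V → Bool}
    (hp : ∀ x y, I.Adj x y → p x = p y) :
    2 * ((bipartitePlus I p).edgeSet.ncard : ℝ)
      = ∑ x, rdeg I x + 2 * (classCard p true * classCard p false) := by
  rw [← sum_rdeg, ← sum_classCard_not, ← Finset.sum_add_distrib]
  refine Finset.sum_congr rfl fun x _ => ?_
  rw [rdeg, rdeg, classCard, ← Finset.sum_add_distrib]
  refine Finset.sum_congr rfl fun y _ => ?_
  simp only [bipartitePlus]
  by_cases h1 : I.Adj x y
  · have := hp _ _ h1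
    cases h3 : p x <;> cases h4 : p y <;> simp_all [ind]
  · cases h3 : p x <;> cases h4 : p y <;> simp [ind, h1]

lemma pairSum_le_mul {f g : V → V → ℝ} (hf : ∀ x y, 0 ≤ f x y) (hg : ∀ x y, 0 ≤ g x y) :
    pairSum f g ≤ (∑ x, ∑ y, f x y) * ∑ u, ∑ w, g u w := by
  rw [Finset.sum_mul]
  refine Finset.sum_le_sum fun x _ => ?_
  rw [Finset.sum_mul]
  refine Finset.sum_le_sum fun y _ => ?_
  rw [Finset.mul_sum]
  refine Finset.sum_le_sum fun u _ => ?_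
  rw [Finset.mul_sum]
  refine Finset.sum_le_sum fun w _ => ?_
  exact mul_le_of_le_one_right (mul_nonneg (hf _ _) (hg _ _)) (apart_le_one _ _ _ _)

lemma pairSum_nonneg {f g : V → V → ℝ} (hf : ∀ x y, 0 ≤ f x y) (hg : ∀ x y, 0 ≤ g x y) :
    0 ≤ pairSum f g :=
  Finset.sum_nonneg fun _ _ => Finset.sum_nonneg fun _ _ => Finset.sum_nonneg fun _ _ =>
    Finset.sum_nonneg fun _ _ => mul_nonneg (mul_nonneg (hf _ _) (hg _ _)) (apart_nonneg _ _ _ _)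

section Upper

variable {I : SimpleGraph V} {p : V → Bool} {h Δ : ℝ}

/-- The indicator of a triangle `v x y` whose only inner edge is `x y`. -/
noncomputable def oppTri (I : SimpleGraph V) (p : V → Bool) (v x y : V) : ℝ :=
  ind (I.Adj x y ∧ p x ≠ p v)

/-- The indicator of a triangle `v x y` whose only inner edge is `v x`. -/
noncomputable def sideTri (I : SimpleGraph V) (p : V → Bool) (v x y : V) : ℝ :=
  ind (I.Adj v x ∧ p y ≠ p v)

omit [Fintype V] in
/-- A triangle has one or three inner edges. -/
lemma tri_bipartitePlus_le (v x y : V) :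
    tri (bipartitePlus I p) v x y
      ≤ (oppTri I p v x y + (sideTri I p v x y + sideTri I p v y x)) + tri I v x y := by
  have h1 := ind_nonneg (I.Adj x y ∧ p x ≠ p v)
  have h2 := ind_nonneg (I.Adj v x ∧ p y ≠ p v)
  have h3 := ind_nonneg (I.Adj v y ∧ p x ≠ p v)
  have h4 := ind_nonneg (I.Adj v x ∧ I.Adj v y ∧ I.Adj x y)
  unfold tri oppTri sideTri
  by_cases h : (bipartitePlus I p).Adj v x ∧ (bipartitePlus I p).Adj v y ∧
      (bipartitePlus I p).Adj x y
  · rw [ind_of h]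
    obtain ⟨k1, k2, k3⟩ := h
    have : (I.Adj x y ∧ p x ≠ p v) ∨ (I.Adj v x ∧ p y ≠ p v) ∨ (I.Adj v y ∧ p x ≠ p v) ∨
        (I.Adj v x ∧ I.Adj v y ∧ I.Adj x y) := by
      simp only [bipartitePlus] at k1 k2 k3
      cases h4 : p v <;> cases h5 : p x <;> cases h6 : p y <;> simp_all
    rcases this with k | k | k | k
    · rw [ind_of k] at *; linarith
    · rw [ind_of k] at *; linarith
    · rw [ind_of k] at *; linarith
    · rw [ind_of k] at *; linarith
  · rw [ind_of_not h]
    linarith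

lemma bowtiesAt_bipartitePlus_le (v : V) :
    bowtiesAt (bipartitePlus I p) v ≤ pairSum (oppTri I p v) (oppTri I p v)
      + 4 * pairSum (oppTri I p v) (sideTri I p v) + 4 * pairSum (sideTri I p v) (sideTri I p v)
      + 2 * (triAt I v * ∑ x, ∑ y, ((oppTri I p v x y + (sideTri I p v x y + sideTri I p v y x))
        + tri I v x y)) := by
  have h0 : ∀ x y, 0 ≤ oppTri I p v x y + (sideTri I p v x y + sideTri I p v y x) := fun x y =>
    add_nonneg (ind_nonneg _) (add_nonneg (ind_nonneg _) (ind_nonneg _))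
  have h1 : ∀ x y, 0 ≤ tri I v x y := tri_nonneg I v
  have h2 : ∀ x y, 0 ≤ (oppTri I p v x y + (sideTri I p v x y + sideTri I p v y x))
      + tri I v x y := fun x y => add_nonneg (h0 x y) (h1 x y)
  rw [bowtiesAt_eq_pairSum]
  refine (pairSum_mono (tri_nonneg _ v) (tri_nonneg _ v) (tri_bipartitePlus_le v)
    (tri_bipartitePlus_le v)).trans ?_
  rw [← pairSum_expand]
  have e1 := pairSum_add_left
    (fun x y => oppTri I p v x y + (sideTri I p v x y + sideTri I p v y x)) (tri I v) (fun x y => (oppTri I p v x y + (sideTri I p v x y + sideTri I p v y x))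
      + tri I v x y)
  have e2 := pairSum_add_right
    (fun x y => oppTri I p v x y + (sideTri I p v x y + sideTri I p v y x))
    (fun x y => oppTri I p v x y + (sideTri I p v x y + sideTri I p v y x)) (tri I v)
  have e3 := pairSum_add_left
    (fun x y => oppTri I p v x y + (sideTri I p v x y + sideTri I p v y x)) (tri I v) (tri I v)
  have e4 := pairSum_add_right (tri I v)
    (fun x y => oppTri I p v x y + (sideTri I p v x y + sideTri I p v y x)) (tri I v)
  have e5 := pairSum_comm (tri I v)
    (fun x y => oppTri I p v x y + (sideTri I p v x y + sideTri I p v y x))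
  have b1 := pairSum_le_mul (f := tri I v) h1 h2
  have b2 := pairSum_nonneg (f := tri I v) h1 h1
  rw [triAt]
  linarith

lemma sum_oppTri (v : V) : ∑ x, ∑ y, oppTri I p v x y = classDeg I p (!p v) := by
  rw [classDeg]
  refine Finset.sum_congr rfl fun x _ => ?_
  rw [rdeg, Finset.mul_sum]
  refine Finset.sum_congr rfl fun y _ => ?_
  rw [oppTri, ind_and, mul_comm]
  congr 1
  apply ind_congr
  cases p x <;> cases p v <;> simp

lemma sum_sideTri (v : V) : ∑ x, ∑ y, sideTri I p v x y = rdeg I v * classCard p (!p v) := by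
  rw [rdeg, classCard, Finset.sum_mul]
  refine Finset.sum_congr rfl fun x _ => ?_
  rw [Finset.mul_sum]
  refine Finset.sum_congr rfl fun y _ => ?_
  rw [sideTri, ind_and]
  congr 1
  apply ind_congr
  cases p y <;> cases p v <;> simp

lemma sum_pairSum_opp_opp_le (hp : ∀ x y, I.Adj x y → p x = p y) (hh : ∀ i, classCard p i ≤ h) :
    ∑ v, pairSum (oppTri I p v) (oppTri I p v)
      ≤ h * (classDeg I p true ^ 2 + classDeg I p false ^ 2
        - 2 * (classDeg I p true + classDeg I p false) - 4 * cherries I) := by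
  rw [sum_apart_eq hp, Finset.mul_sum]
  simp only [pairSum]
  rw [sum_comm_four]
  simp only [Finset.mul_sum]
  refine Finset.sum_le_sum fun x _ => Finset.sum_le_sum fun y _ => Finset.sum_le_sum fun u _ =>
    Finset.sum_le_sum fun w _ => ?_
  rw [← Finset.sum_mul, ← mul_assoc]
  refine mul_le_mul_of_nonneg_right ?_ (apart_nonneg _ _ _ _)
  calc ∑ v, oppTri I p v x y * oppTri I p v u w
      ≤ ∑ v, ind (p v = !p x) * (ind (I.Adj x y) * ind (I.Adj u w) * ind (p x = p u)) := by
        refine Finset.sum_le_sum fun v _ => ?_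
        simp only [oppTri, ← ind_and]
        refine ind_mono ?_
        rintro ⟨⟨k1, k2⟩, k3, k4⟩
        refine ⟨?_, ⟨k1, k3⟩, ?_⟩ <;> cases h1 : p x <;> cases h2 : p v <;> cases h3 : p u <;>
          simp_all
    _ = classCard p (!p x) * (ind (I.Adj x y) * ind (I.Adj u w) * ind (p x = p u)) := by
        rw [← Finset.sum_mul]; rfl
    _ ≤ _ := mul_le_mul_of_nonneg_right (hh _)
        (mul_nonneg (mul_nonneg (ind_nonneg _) (ind_nonneg _)) (ind_nonneg _))

lemma sum_pairSum_opp_side_le (hh : ∀ i, classCard p i ≤ h) :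
    ∑ v, pairSum (oppTri I p v) (sideTri I p v)
      ≤ h * (2 * (classDeg I p true * classDeg I p false)) := by
  have h1 : ∀ v, pairSum (oppTri I p v) (sideTri I p v)
      ≤ h * (classDeg I p (!p v) * rdeg I v) := by
    intro v
    refine (pairSum_le_mul (f := oppTri I p v) (g := sideTri I p v) (fun _ _ => ind_nonneg _)
      fun _ _ => ind_nonneg _).trans ?_
    rw [sum_oppTri, sum_sideTri]
    have := mul_le_mul_of_nonneg_left (hh (!p v))
      (mul_nonneg (classDeg_nonneg I p (!p v)) (rdeg_nonneg I v))
    linarith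
  refine (Finset.sum_le_sum fun v _ => h1 v).trans (le_of_eq ?_)
  rw [← Finset.mul_sum, sum_classDeg_not_mul]

lemma sum_pairSum_side_side_le (hh : ∀ i, classCard p i ≤ h) (h0 : 0 ≤ h) :
    ∑ v, pairSum (sideTri I p v) (sideTri I p v) ≤ h ^ 2 * cherries I := by
  rw [cherries, Finset.mul_sum]
  refine Finset.sum_le_sum fun v _ => ?_
  calc pairSum (sideTri I p v) (sideTri I p v)
      ≤ ∑ x, ∑ y, ∑ u, ∑ w, (ind (I.Adj v x) * ind (I.Adj v u) * (1 - ind (u = x)))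
          * (ind (p y = !p v) * ind (p w = !p v)) := by
        refine Finset.sum_le_sum fun x _ => Finset.sum_le_sum fun y _ =>
          Finset.sum_le_sum fun u _ => Finset.sum_le_sum fun w _ => ?_
        have e : 1 - ind (u = x) = ind (u ≠ x) := by
          by_cases h : u = x <;> simp [ind, h]
        simp only [sideTri, apart, e, ← ind_and]
        refine ind_mono ?_
        rintro ⟨⟨⟨k1, k2⟩, k3, k4⟩, k5⟩
        refine ⟨⟨⟨k1, k3⟩, fun h => k5.1 h.symm⟩, ?_, ?_⟩
        · cases h1 : p y <;> cases h2 : p v <;> simp_all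
        · cases h1 : p w <;> cases h2 : p v <;> simp_all
    _ = (rdeg I v * (rdeg I v - 1)) * (classCard p (!p v) * classCard p (!p v)) := by
        rw [← sum_adj_mul_adj_ne, Finset.sum_mul]
        refine Finset.sum_congr rfl fun x _ => ?_
        rw [Finset.sum_comm, Finset.sum_mul]
        refine Finset.sum_congr rfl fun u _ => ?_
        simp only [← Finset.mul_sum, ← Finset.sum_mul]
        rfl
    _ ≤ (rdeg I v * (rdeg I v - 1)) * (h * h) :=
        mul_le_mul_of_nonneg_left
          (mul_le_mul (hh _) (hh _) (classCard_nonneg _ _) h0) (rdeg_mul_pred_nonneg I v)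
    _ = _ := by ring

lemma triAt_le_rdeg (I : SimpleGraph V) (v : V) : triAt I v ≤ rdeg I v * (rdeg I v - 1) := by
  rw [← sum_adj_mul_adj_ne]
  refine Finset.sum_le_sum fun x _ => Finset.sum_le_sum fun y _ => ?_
  have e : 1 - ind (y = x) = ind (y ≠ x) := by
    by_cases h : y = x <;> simp [ind, h]
  rw [tri, e, ← ind_and, ← ind_and]
  exact ind_mono fun h => ⟨⟨h.1, h.2.1⟩, h.2.2.ne.symm⟩

/-- The number of bowties in a complete bipartite graph with additional inner edges. The last term
bounds the bowties that contain a triangle of inner edges. -/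
lemma bowties_bipartitePlus_le (hp : ∀ x y, I.Adj x y → p x = p y) (hh : ∀ i, classCard p i ≤ h)
    (h0 : 0 ≤ h) (hΔ : ∀ x, rdeg I x ≤ Δ) (hΔ1 : 1 ≤ Δ) :
    bowties (bipartitePlus I p) ≤ h * (classDeg I p true ^ 2 + classDeg I p false ^ 2
      - 2 * (classDeg I p true + classDeg I p false)
      + 8 * (classDeg I p true * classDeg I p false) + 4 * (h - 1) * cherries I)
      + 8 * (Δ * (Δ - 1)) * Fintype.card V * ∑ x, rdeg I x := by
  set n : ℝ := (Fintype.card V : ℝ) with hn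
  have hn0 : 0 ≤ n := by positivity
  have hΔ2 : 0 ≤ Δ * (Δ - 1) := mul_nonneg (by linarith) (by linarith)
  have hcn : ∀ i, classCard p i ≤ n := by
    intro i
    have := classCard_add p
    have := classCard_nonneg p true
    have := classCard_nonneg p false
    cases i <;> linarith
  have htri : ∀ v, triAt I v ≤ Δ * (Δ - 1) := by
    intro v
    refine (triAt_le_rdeg I v).trans ?_
    rcases rdeg_eq_zero_or_one_le I v with h | h
    · rw [h.1]; simpa using hΔ2
    · exact mul_le_mul (hΔ v) (by linarith [hΔ v]) (by linarith [h.1]) (by linarith)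
  have hrest : ∀ v, ∑ x, ∑ y, ((oppTri I p v x y + (sideTri I p v x y + sideTri I p v y x))
      + tri I v x y) ≤ ∑ x, rdeg I x + 3 * n * rdeg I v := by
    intro v
    simp only [Finset.sum_add_distrib]
    rw [Finset.sum_comm (f := fun x y => sideTri I p v y x), sum_oppTri, sum_sideTri]
    have h1 : classDeg I p (!p v) ≤ ∑ x, rdeg I x := by
      rw [← classDeg_add I p]
      have := classDeg_nonneg I p true
      have := classDeg_nonneg I p false
      cases p v <;> simp <;> linarith
    have h2 := mul_le_mul_of_nonneg_left (hcn (!p v)) (rdeg_nonneg I v)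
    have h3 : ∑ x, ∑ y, tri I v x y ≤ rdeg I v * n := by
      calc ∑ x, ∑ y, tri I v x y ≤ ∑ x, ∑ _y : V, ind (I.Adj v x) :=
            Finset.sum_le_sum fun x _ => Finset.sum_le_sum fun y _ => ind_mono fun h => h.1
        _ = rdeg I v * n := by
            simp [rdeg, hn, Finset.mul_sum, mul_comm]
    linarith
  have hs0 : 0 ≤ ∑ x, rdeg I x := Finset.sum_nonneg fun x _ => rdeg_nonneg I x
  have hlast : ∑ v, triAt I v * ∑ x, ∑ y, ((oppTri I p v x y
      + (sideTri I p v x y + sideTri I p v y x)) + tri I v x y)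
      ≤ Δ * (Δ - 1) * (4 * n * ∑ x, rdeg I x) := by
    calc _ ≤ ∑ v, Δ * (Δ - 1) * (∑ x, rdeg I x + 3 * n * rdeg I v) := by
          refine Finset.sum_le_sum fun v _ => ?_
          refine mul_le_mul (htri v) (hrest v) ?_ hΔ2
          exact Finset.sum_nonneg fun x _ => Finset.sum_nonneg fun y _ =>
            add_nonneg (add_nonneg (ind_nonneg _) (add_nonneg (ind_nonneg _) (ind_nonneg _)))
              (ind_nonneg _)
      _ = _ := by
          rw [← Finset.mul_sum, Finset.sum_add_distrib, ← Finset.mul_sum, Finset.sum_const,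
            Finset.card_univ, nsmul_eq_mul]
          ring
  have hsum := Finset.sum_le_sum fun v (_ : v ∈ Finset.univ) =>
    bowtiesAt_bipartitePlus_le (I := I) (p := p) v
  rw [← bowties_eq_sum] at hsum
  simp only [Finset.sum_add_distrib, ← Finset.mul_sum] at hsum hlast
  have k1 := sum_pairSum_opp_opp_le hp hh
  have k2 := sum_pairSum_opp_side_le (I := I) hh
  have k3 := sum_pairSum_side_side_le (I := I) hh h0
  linarith

end Upper

end Construction

/-! ### The upper bound -/

section UpperBound

open scoped Classical

variable {V : Type*} [Fintype V]

/-- Nearly regular graphs with given numbers of edges in both classes. -/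
lemma exists_inner (p : V → Bool) (e₁ e₂ : ℕ)
    (h₁ : 2 * (e₁ : ℝ) ≤ classCard p true * (classCard p true - 1))
    (h₂ : 2 * (e₂ : ℝ) ≤ classCard p false * (classCard p false - 1)) :
    ∃ I : SimpleGraph V, (∀ x y, I.Adj x y → p x = p y) ∧ classDeg I p true = 2 * e₁ ∧
      classDeg I p false = 2 * e₂ ∧
      ∀ i x y, p x = i → p y = i → rdeg I x ≤ rdeg I y + 1 := by
  obtain ⟨I₁, hI₁, hs₁, hr₁⟩ := exists_nearly_regular p true e₁ h₁
  obtain ⟨I₂, hI₂, hs₂, hr₂⟩ := exists_nearly_regular p false e₂ h₂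
  have hz : ∀ (i : Bool) (J : SimpleGraph V), J ≤ classClique p i → ∀ x, p x ≠ i →
      rdeg J x = 0 := fun i J hJ x hx =>
    Finset.sum_eq_zero fun y _ => ind_of_not fun h => hx (hJ h).2.1
  have hdt : ∀ x, p x = true → rdeg (I₁ ⊔ I₂) x = rdeg I₁ x := by
    intro x hx
    refine Finset.sum_congr rfl fun y _ => ind_congr ?_
    rw [SimpleGraph.sup_adj, or_iff_left]
    intro h
    have := (hI₂ h).2.1
    simp [hx] at this
  have hdf : ∀ x, p x = false → rdeg (I₁ ⊔ I₂) x = rdeg I₂ x := by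
    intro x hx
    refine Finset.sum_congr rfl fun y _ => ind_congr ?_
    rw [SimpleGraph.sup_adj, or_iff_right]
    intro h
    have := (hI₁ h).2.1
    simp [hx] at this
  refine ⟨I₁ ⊔ I₂, ?_, ?_, ?_, ?_⟩
  · intro x y h
    rcases h with h | h
    · exact (hI₁ h).2.1.trans (hI₁ h).2.2.symm
    · exact (hI₂ h).2.1.trans (hI₂ h).2.2.symm
  · rw [← hs₁, classDeg]
    refine Finset.sum_congr rfl fun x _ => ?_
    by_cases hx : p x = true
    · rw [ind_of hx, one_mul, hdt x hx]
    · rw [ind_of_not hx, zero_mul, hz true I₁ hI₁ x hx]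
  · rw [← hs₂, classDeg]
    refine Finset.sum_congr rfl fun x _ => ?_
    by_cases hx : p x = false
    · rw [ind_of hx, one_mul, hdf x hx]
    · rw [ind_of_not hx, zero_mul, hz false I₂ hI₂ x hx]
  · intro i x y hx hy
    cases i
    · rw [hdf x hx, hdf y hy]
      exact hr₂ x y hx hy
    · rw [hdt x hx, hdt y hy]
      exact hr₁ x y hx hy

/-- The construction with prescribed numbers of edges in the two classes, whose degrees average
within `R` of the interval `[d, d + 1]`. -/
lemma exists_bipartitePlus {p : V → Bool} {d e₁ e₂ : ℕ} {h R Δ : ℝ}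
    (h₁ : 2 * (e₁ : ℝ) ≤ classCard p true * (classCard p true - 1))
    (h₂ : 2 * (e₂ : ℝ) ≤ classCard p false * (classCard p false - 1))
    (hh : ∀ i, classCard p i ≤ h) (h1 : 1 ≤ h) (hR0 : 0 ≤ R) (hR : ∀ i, R < classCard p i)
    (hd₁ : d * classCard p true - R ≤ 2 * e₁) (hd₁' : 2 * e₁ ≤ (d + 1) * classCard p true + R)
    (hd₂ : d * classCard p false - R ≤ 2 * e₂) (hd₂' : 2 * e₂ ≤ (d + 1) * classCard p false + R)
    (hΔ : d + 2 ≤ Δ ∨ (R = 0 ∧ d + 1 ≤ Δ)) (hΔ1 : 1 ≤ Δ) :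
    ∃ G : SimpleGraph V,
      (G.edgeSet.ncard : ℝ) = e₁ + e₂ + classCard p true * classCard p false ∧
      bowties G ≤ h * (4 * ((e₁ : ℝ) + e₂) ^ 2 - 4 * (e₁ + e₂) + 24 * (e₁ * e₂)
        + 4 * (h - 1) * (4 * d * (e₁ + e₂) - d * (d + 1) * Fintype.card V + 4 * R))
        + 16 * (Δ * (Δ - 1)) * Fintype.card V * (e₁ + e₂) := by
  obtain ⟨I, hp, hs₁, hs₂, hreg⟩ := exists_inner p e₁ e₂ h₁ h₂
  have hsum : ∑ x, rdeg I x = 2 * ((e₁ : ℝ) + e₂) := by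
    rw [← classDeg_add I p, hs₁, hs₂]; ring
  obtain ⟨a1, a2, a3⟩ := nearly_regular_bounds hs₁ (hreg true) hd₁ hd₁' hR0 (hR true)
  obtain ⟨b1, b2, b3⟩ := nearly_regular_bounds hs₂ (hreg false) hd₂ hd₂' hR0 (hR false)
  refine ⟨bipartitePlus I p, ?_, ?_⟩
  · have := ncard_edgeSet_bipartitePlus hp
    rw [hsum] at this
    linarith
  · have hdeg : ∀ x, rdeg I x ≤ Δ := by
      intro x
      rcases hΔ with h | ⟨h, h'⟩
      · cases hx : p x
        · linarith [b2 x hx]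
        · linarith [a2 x hx]
      · cases hx : p x
        · linarith [b3 h x hx]
        · linarith [a3 h x hx]
    have hmain := bowties_bipartitePlus_le hp hh (by linarith) hdeg hΔ1
    have hch : cherries I ≤ 4 * d * (e₁ + e₂) - d * (d + 1) * Fintype.card V + 4 * R := by
      rw [← classCard_add p, cherries, sum_split p]
      linarith
    rw [hs₁, hs₂, hsum] at hmain
    have k1 : h * (4 * (h - 1) * cherries I) ≤ h * (4 * (h - 1)
        * (4 * d * (e₁ + e₂) - d * (d + 1) * Fintype.card V + 4 * R)) :=
      mul_le_mul_of_nonneg_left (mul_le_mul_of_nonneg_left hch (by linarith)) (by linarith)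
    linarith

/-- The balanced partition of `Fin n`. -/
def halves (n : ℕ) (x : Fin n) : Bool := decide (x.val < (n + 1) / 2)

lemma classCard_halves_true (n : ℕ) : classCard (halves n) true = ((n + 1) / 2 : ℕ) := by
  rw [classCard_eq]
  congr 1
  simp only [halves, decide_eq_true_eq]
  rw [Fin.card_filter_val_lt]
  omega

lemma classCard_halves_false (n : ℕ) : classCard (halves n) false = (n / 2 : ℕ) := by
  have h1 := classCard_add (halves n)
  rw [classCard_halves_true, Fintype.card_fin] at h1
  have h2 : ((n + 1) / 2 : ℕ) + (n / 2 : ℕ) = n := by omega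
  have h3 : (((n + 1) / 2 : ℕ) : ℝ) + ((n / 2 : ℕ) : ℝ) = n := by exact_mod_cast h2
  linarith

lemma half_mul_half (n : ℕ) : (n + 1) / 2 * (n / 2) = n ^ 2 / 4 := by
  rcases Nat.even_or_odd' n with ⟨k, rfl | rfl⟩
  · have h1 : (2 * k + 1) / 2 = k := by omega
    have h2 : 2 * k / 2 = k := by omega
    rw [h1, h2, show (2 * k) ^ 2 = 4 * (k * k) by ring]
    omega
  · have h1 : (2 * k + 1 + 1) / 2 = k + 1 := by omega
    have h2 : (2 * k + 1) / 2 = k := by omega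
    rw [h1, h2, show (2 * k + 1) ^ 2 = 4 * ((k + 1) * k) + 1 by ring]
    omega

/-- The error terms of the construction are negligible: `Q` is the main term up to scaling, `n (d +
3)` comes from the rounding and `(d + 2) (d + 1)` from the bowties that contain a triangle of inner
edges. -/
lemma construction_error_le {n t d c Q : ℝ} (hc : 0 < c) (hc1 : c ≤ 1) (hcn : 4000 ≤ c * n)
    (ht : t ≤ c / 4000 * n ^ 2) (hnt : n < 4 * t) (hd0 : 0 ≤ d) (hdn : d * n ≤ 2 * t)
    (hQ0 : 4 * t ^ 2 - 4 * t ≤ Q) :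
    (n + 1) / 2 * (Q + 8 * n * (d + 3)) + 16 * ((d + 2) * (d + 2 - 1)) * n * t
      ≤ (1 + c) * (n / 2 * Q) := by
  have hn4 : (4000 : ℝ) ≤ n := by nlinarith
  have hn0 : (0 : ℝ) < n := by linarith
  have ht2 : (1000 : ℝ) ≤ t := by linarith
  have hQ2 : 2 * t ^ 2 ≤ Q := by nlinarith
  have hQpos : 0 ≤ Q := le_trans (by positivity) hQ2
  have ht0 : 0 ≤ t := by linarith
  have k1 : d + 3 ≤ 14 * t / n := by
    rw [le_div_iff₀ hn0]; linarith
  have k2 : (d + 2) * (d + 2 - 1) ≤ (10 * t / n) ^ 2 := by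
    have h1 : d + 2 ≤ 10 * t / n := by rw [le_div_iff₀ hn0]; linarith
    rw [sq]
    exact mul_le_mul h1 (by linarith) (by linarith) (by positivity)
  have s2 : 8 * n * (d + 3) ≤ 112 * t := by
    calc 8 * n * (d + 3) ≤ 8 * n * (14 * t / n) := by gcongr
      _ = 112 * t := by field_simp; ring
  have s3 : 16 * ((d + 2) * (d + 2 - 1)) * n * t ≤ 1600 * t ^ 3 / n := by
    calc 16 * ((d + 2) * (d + 2 - 1)) * n * t ≤ 16 * (10 * t / n) ^ 2 * n * t := by gcongr
      _ = 1600 * t ^ 3 / n := by field_simp; ring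
  have s4 : 1600 * t ^ 3 / n ≤ 2 / 5 * c * (n * t ^ 2) := by
    rw [div_le_iff₀ hn0]
    have h1 : 1600 * t ≤ 2 / 5 * c * n ^ 2 := by linarith
    have h2 := mul_le_mul_of_nonneg_right h1 (sq_nonneg t)
    linarith
  have s5 : (n + 1) / 2 * (112 * t) ≤ 1 / 4 * c * (n * t ^ 2) := by
    have h1 : 1000 ≤ c * t := by nlinarith
    have h2 : (n + 1) / 2 * (112 * t) ≤ n * (112 * t) := by gcongr; linarith
    have h3 : 1000 * (n * t) ≤ c * t * (n * t) :=
      mul_le_mul_of_nonneg_right h1 (by positivity)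
    have h4 : 0 ≤ n * t := by positivity
    linarith
  have s6 : n * t ^ 2 ≤ n / 2 * Q := by
    have := mul_le_mul_of_nonneg_left hQ2 hn0.le
    linarith
  have s7 : Q / 2 ≤ 1 / 4000 * c * (n / 2 * Q) := by
    have := mul_le_mul_of_nonneg_right hcn hQpos
    linarith
  have s8 : (n + 1) / 2 * (8 * n * (d + 3)) ≤ (n + 1) / 2 * (112 * t) :=
    mul_le_mul_of_nonneg_left s2 (by positivity)
  have s9 : c * (n * t ^ 2) ≤ c * (n / 2 * Q) := mul_le_mul_of_nonneg_left s6 hc.le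
  have s10 : 0 ≤ c * (n / 2 * Q) := by positivity
  linarith

set_option maxHeartbeats 1000000 in
/-- The upper bound for the number of bowties: there are graphs with `n ^ 2 / 4 + t` edges and few
bowties. -/
theorem bowties_upper {c : ℝ} (hc : 0 < c) (hc1 : c ≤ 1) :
    ∃ δ : ℝ, 0 < δ ∧ ∀ n t : ℕ, 1 / δ ≤ (n : ℝ) → (t : ℝ) ≤ δ * (n : ℝ) ^ 2 → 1 ≤ t →
      ∀ d m e₁ e₂ : ℕ, 2 * t = d * n + m → m < n →
      e₁ = ⌊(d : ℝ) * n / 4 + min (m : ℝ) ((n : ℝ) / 2) / 2⌋₊ → e₂ = t - e₁ →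
      ∃ G : SimpleGraph (Fin n), G.edgeSet.ncard = n ^ 2 / 4 + t ∧
        bowties G ≤ 8 * (1 + c) * mainTerm n d m e₁ e₂ := by
  refine ⟨c / 4000, by positivity, ?_⟩
  intro n t hn ht ht1 d m e₁ e₂ hm hmn he₁ he₂
  have hcn : 4000 ≤ c * n := by
    rw [one_div, inv_div, div_le_iff₀ hc] at hn
    linarith
  have hn4 : (4000 : ℝ) ≤ n := by nlinarith
  have hn0 : (0 : ℝ) < n := by linarith
  have ht' : (t : ℝ) ≤ n ^ 2 / 4000 := by nlinarith [sq_nonneg (n : ℝ)]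
  obtain ⟨hee, -⟩ := floor_split hm he₁ he₂
  have hM := mainTerm_eq hm hee
  have heeR : (e₁ : ℝ) + e₂ = t := by exact_mod_cast hee
  have e10 : (0 : ℝ) ≤ e₁ := by positivity
  have e20 : (0 : ℝ) ≤ e₂ := by positivity
  have hmR : (2 : ℝ) * t = d * n + m := by exact_mod_cast hm
  have hmnR : (m : ℝ) < n := by exact_mod_cast hmn
  have hm0 : (0 : ℝ) ≤ m := by positivity
  have hd0 : (0 : ℝ) ≤ d := by positivity
  have ht1R : (1 : ℝ) ≤ t := by exact_mod_cast ht1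
  have hdn : (d : ℝ) * n ≤ 2 * t := by linarith
  have hd1 : (d : ℝ) ≤ n / 2000 := by
    have : (d : ℝ) * n ≤ n / 2000 * n := by nlinarith
    exact le_of_mul_le_mul_right this hn0
  -- the sizes of the classes
  set p := halves n with hp
  set a := classCard p true with ha
  set b := classCard p false with hb
  have hV : (Fintype.card (Fin n) : ℝ) = n := by rw [Fintype.card_fin]
  have hab : a + b = n := by rw [ha, hb, classCard_add, hV]
  have ha1 : (n : ℝ) / 2 ≤ a ∧ a ≤ ((n : ℝ) + 1) / 2 := by
    rw [ha, hp, classCard_halves_true]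
    have h1 : n ≤ 2 * ((n + 1) / 2) := by omega
    have h2 : 2 * ((n + 1) / 2) ≤ n + 1 := by omega
    have h1R : (n : ℝ) ≤ 2 * (((n + 1) / 2 : ℕ) : ℝ) := by exact_mod_cast h1
    have h2R : 2 * (((n + 1) / 2 : ℕ) : ℝ) ≤ n + 1 := by exact_mod_cast h2
    constructor <;> linarith
  have hb1 : ((n : ℝ) - 1) / 2 ≤ b := by linarith
  have hb2 : b ≤ n / 2 := by linarith
  have habm : a * b = ((n ^ 2 / 4 : ℕ) : ℝ) := by
    rw [ha, hb, hp, classCard_halves_true, classCard_halves_false, ← half_mul_half]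
    push_cast
    rfl
  have hh : ∀ i, classCard p i ≤ ((n : ℝ) + 1) / 2 := by
    intro i
    cases i
    · linarith
    · exact ha1.2
  have hroom : 2 * (t : ℝ) ≤ b * (b - 1) := by nlinarith
  have h₁ : 2 * (e₁ : ℝ) ≤ a * (a - 1) := by nlinarith
  have h₂ : 2 * (e₂ : ℝ) ≤ b * (b - 1) := by linarith
  have hE : (0 : ℝ) ≤ (d : ℝ) * n / 4 + min (m : ℝ) ((n : ℝ) / 2) / 2 := by positivity
  have hle := Nat.floor_le hE
  have hlt := Nat.lt_floor_add_one ((d : ℝ) * n / 4 + min (m : ℝ) ((n : ℝ) / 2) / 2)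
  rw [← he₁] at hle hlt
  set Q : ℝ := 4 * (t : ℝ) ^ 2 - 4 * t + 24 * (e₁ * e₂)
      + 8 * t * n * d - 2 * (n : ℝ) ^ 2 * d ^ 2 - 2 * (n : ℝ) ^ 2 * d with hQ
  have hQ0 : 4 * (t : ℝ) ^ 2 - 4 * t ≤ Q := by
    have := mainTerm_ge hm hee
    rw [hM] at this
    exact le_of_mul_le_mul_left this (by positivity)
  have hfinish : ∀ G : SimpleGraph (Fin n),
      (G.edgeSet.ncard : ℝ) = e₁ + e₂ + a * b → G.edgeSet.ncard = n ^ 2 / 4 + t := by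
    intro G hG
    rw [heeR, habm, add_comm] at hG
    exact_mod_cast hG
  have hgoal : 8 * (1 + c) * mainTerm n d m e₁ e₂ = (1 + c) * ((n : ℝ) / 2 * Q) := by
    rw [← hM]; ring
  rcases Nat.lt_or_ge n (4 * t) with h4t | h4t
  swap
  · -- a matching in one class
    have h4R : (4 : ℝ) * t ≤ n := by exact_mod_cast h4t
    have hd : d = 0 := by
      by_contra hd
      have : n ≤ d * n := Nat.le_mul_of_pos_left n (Nat.pos_of_ne_zero hd)
      omega
    subst hd
    have hm' : (m : ℝ) = 2 * t := by push_cast at hmR; linarith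
    have he : e₁ = t := by
      rw [he₁, hm', min_eq_left (by linarith)]
      simp
    have he' : e₂ = 0 := by omega
    have he1R : (e₁ : ℝ) = t := by exact_mod_cast he
    have he2R : (e₂ : ℝ) = 0 := by exact_mod_cast he'
    obtain ⟨G, hG, hB⟩ := exists_bipartitePlus (p := p) (d := 0) (R := 0) (Δ := 1) h₁ h₂ hh
      (by linarith) le_rfl (by intro i; cases i <;> linarith)
      (by push_cast; linarith) (by push_cast; rw [he1R]; linarith)
      (by push_cast; linarith) (by push_cast; rw [he2R]; linarith)
      (Or.inr ⟨rfl, by norm_num⟩) le_rfl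
    refine ⟨G, hfinish G hG, ?_⟩
    have hQe : Q = 4 * (t : ℝ) ^ 2 - 4 * t := by
      rw [hQ, he2R]; push_cast; ring
    rw [hgoal]
    rw [heeR, he2R, hV] at hB
    push_cast at hB
    have hB' : bowties G ≤ ((n : ℝ) + 1) / 2 * Q := by rw [hQe]; linarith
    refine hB'.trans ?_
    have hQpos : 0 ≤ Q := by
      have := mul_nonneg (show (0 : ℝ) ≤ t by linarith) (show (0 : ℝ) ≤ t - 1 by linarith)
      rw [hQe]
      linarith
    have h1 : ((n : ℝ) + 1) / 2 ≤ (1 + c) * (n / 2) := by linarith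
    have h2 := mul_le_mul_of_nonneg_right h1 hQpos
    linarith
  · have h4R : (n : ℝ) < 4 * t := by exact_mod_cast h4t
    have ht2 : (2 : ℝ) ≤ t := by linarith
    have hmin1 : min (m : ℝ) ((n : ℝ) / 2) ≤ n / 2 := min_le_right _ _
    have hmin0 : 0 ≤ min (m : ℝ) ((n : ℝ) / 2) := le_min hm0 (by linarith)
    have hmin2 : (m : ℝ) - n / 2 ≤ min (m : ℝ) ((n : ℝ) / 2) := le_min (by linarith) (by linarith)
    have hmin3 : min (m : ℝ) ((n : ℝ) / 2) ≤ m := min_le_left _ _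
    have hda : (d : ℝ) * a ≤ d * (((n : ℝ) + 1) / 2) := mul_le_mul_of_nonneg_left ha1.2 hd0
    have hda' : ((d : ℝ) + 1) * (n / 2) ≤ (d + 1) * a :=
      mul_le_mul_of_nonneg_left ha1.1 (by linarith)
    have hdb : (d : ℝ) * b ≤ d * (n / 2) := mul_le_mul_of_nonneg_left hb2 hd0
    have hdb' : ((d : ℝ) + 1) * (((n : ℝ) - 1) / 2) ≤ (d + 1) * b :=
      mul_le_mul_of_nonneg_left hb1 (by linarith)
    -- the average degrees in both classes are close to `[d, d + 1]`: the larger class has at most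
    -- one more vertex, and `e₁` is rounded
    obtain ⟨G, hG, hB⟩ := exists_bipartitePlus (p := p) (d := d) (R := d + 3) (Δ := d + 2) h₁ h₂ hh
      (by linarith) (by linarith) (by intro i; cases i <;> linarith)
      (by linarith) (by linarith) (by linarith) (by linarith) (Or.inl le_rfl) (by linarith)
    refine ⟨G, hfinish G hG, ?_⟩
    rw [hgoal]
    rw [heeR, hV] at hB
    have hcherry : 0 ≤ 4 * d * (t : ℝ) - d * (d + 1) * n + 4 * (d + 3) := by
      have h1 : 4 * (d : ℝ) * t = 2 * d * (d * n + m) := by rw [← hmR]; ring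
      have h2 : 0 ≤ (d : ℝ) * (d - 1) * n := by
        rcases Nat.eq_zero_or_pos d with h | h
        · simp [h]
        · have : (1 : ℝ) ≤ d := by exact_mod_cast h
          exact mul_nonneg (mul_nonneg hd0 (by linarith)) hn0.le
      have h3 : 0 ≤ (d : ℝ) * m := by positivity
      rw [h1]
      linarith
    refine le_trans (hB.trans ?_)
      (construction_error_le hc hc1 hcn (by linarith) h4R hd0 hdn hQ0)
    have h1 : 4 * (((n : ℝ) + 1) / 2 - 1) ≤ 2 * n := by linarith
    have h2 := mul_le_mul_of_nonneg_right h1 hcherry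
    have h3 : 4 * (t : ℝ) ^ 2 - 4 * t + 24 * (e₁ * e₂) + 4 * (((n : ℝ) + 1) / 2 - 1)
        * (4 * d * t - d * (d + 1) * n + 4 * (d + 3)) ≤ Q + 8 * n * (d + 3) := by
      rw [hQ]; linarith
    have h4 := mul_le_mul_of_nonneg_left h3 (show 0 ≤ ((n : ℝ) + 1) / 2 by positivity)
    linarith

end UpperBound

/-! ### The extremal number and the asymptotic formula -/

section Asymptotics

/-- A single edge inside the classes creates no bowtie. -/
lemma mainTerm_eq_zero {n d m e₁ e₂ : ℕ} (hm : 2 * 1 = d * n + m) (hn : 2 < n)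
    (he : e₁ + e₂ = 1) : mainTerm n d m e₁ e₂ = 0 := by
  have hd : d = 0 := by
    by_contra hd
    have : n ≤ d * n := Nat.le_mul_of_pos_left n (Nat.pos_of_ne_zero hd)
    omega
  have h := mainTerm_eq hm he
  subst hd
  have hee : (e₁ : ℝ) * e₂ = 0 := by
    rcases Nat.eq_zero_or_pos e₁ with h | h
    · simp [h]
    · have : e₂ = 0 := by omega
      simp [this]
  rw [hee] at h
  push_cast at h
  linarith

lemma mainTerm_nonneg {n d m e₁ e₂ t : ℕ} (hm : 2 * t = d * n + m) (he : e₁ + e₂ = t) :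
    0 ≤ mainTerm n d m e₁ e₂ := by
  have h := mainTerm_ge hm he
  have : (0 : ℝ) ≤ (n : ℝ) / 2 * (4 * (t : ℝ) ^ 2 - 4 * t) := by
    refine mul_nonneg (by positivity) ?_
    rcases Nat.eq_zero_or_pos t with h | h
    · simp [h]
    · have : (1 : ℝ) ≤ t := by exact_mod_cast h
      nlinarith
  linarith

/-- The main term vanishes for a single inner edge, so `n ^ 2 / 4 + 1` edges do not force a bowtie;
with two inner edges it is positive, and one more edge does. -/
theorem extremalNumber_bowtie :
    ∃ δ : ℝ, 0 < δ ∧ ∀ n : ℕ, 1 / δ ≤ (n : ℝ) →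
      SimpleGraph.extremalNumber n bowtie = n ^ 2 / 4 + 1 := by
  classical
  obtain ⟨δ₁, hδ₁, hlow⟩ := bowties_lower (c := 1 / 2) (by norm_num) (by norm_num)
  obtain ⟨δ₂, hδ₂, hup⟩ := bowties_upper (c := 1) one_pos le_rfl
  refine ⟨min (min (δ₁ / 4) (δ₂ / 4)) (1 / 5), by positivity, fun n hn => ?_⟩
  have hpos : 0 < min (min (δ₁ / 4) (δ₂ / 4)) (1 / 5 : ℝ) := by positivity
  have hδn := (div_le_iff₀ hpos).1 hn
  have h5 : (5 : ℝ) ≤ n := by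
    have := mul_le_mul_of_nonneg_left (min_le_right (min (δ₁ / 4) (δ₂ / 4)) (1 / 5 : ℝ))
      (Nat.cast_nonneg n : (0 : ℝ) ≤ n)
    linarith
  have hsmall : ∀ δ : ℝ, 0 < δ → min (min (δ₁ / 4) (δ₂ / 4)) (1 / 5) ≤ δ / 4 →
      1 / δ ≤ n ∧ (2 : ℝ) ≤ δ * n ^ 2 := by
    intro δ hδ hle
    have h1 := mul_le_mul_of_nonneg_left hle (Nat.cast_nonneg n : (0 : ℝ) ≤ n)
    have h2 : 4 ≤ δ * n := by linarith
    refine ⟨by rw [div_le_iff₀ hδ]; linarith, ?_⟩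
    nlinarith
  obtain ⟨k₁, k₁'⟩ := hsmall δ₁ hδ₁ ((min_le_left _ _).trans (min_le_left _ _))
  obtain ⟨k₂, k₂'⟩ := hsmall δ₂ hδ₂ ((min_le_left _ _).trans (min_le_right _ _))
  have h5' : 5 ≤ n := by exact_mod_cast h5
  refine le_antisymm ?_ ?_
  · rw [← Fintype.card_fin n, SimpleGraph.extremalNumber_le_iff]
    intro G _ hG
    rw [Fintype.card_fin]
    by_contra! hlt
    have hm : 2 * 2 = 0 * n + 4 := by ring
    obtain ⟨hee, -⟩ := floor_split hm rfl rfl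
    have h := hlow n 2 k₁ (by exact_mod_cast k₁') le_rfl 0 4 _ _ hm (by omega) rfl rfl G
      (by rw [← Set.ncard_coe_finset, SimpleGraph.coe_edgeFinset] at hlt; omega)
    have hge := mainTerm_ge hm hee
    rw [bowties_eq, SimpleGraph.copyCount_eq_zero.2 hG] at h
    push_cast at h hge
    linarith
  · have hm : 2 * 1 = 0 * n + 2 := by ring
    obtain ⟨hee, -⟩ := floor_split hm rfl rfl
    obtain ⟨G, hG, hB⟩ := hup n 1 k₂ (by push_cast; linarith) le_rfl 0 2 _ _ hm (by omega) rfl rfl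
    rw [bowties_eq, mainTerm_eq_zero hm (by omega) hee, mul_zero] at hB
    have hfree : bowtie.Free G := by
      rw [← SimpleGraph.copyCount_eq_zero]
      have : (G.copyCount bowtie : ℝ) ≤ 0 := by linarith
      exact_mod_cast le_antisymm this (Nat.cast_nonneg _)
    have h := SimpleGraph.card_edgeFinset_le_extremalNumber hfree
    rwa [Fintype.card_fin, ← Set.ncard_coe_finset, SimpleGraph.coe_edgeFinset, hG] at h

/-- The asymptotic formula, in terms of `mainTerm`. The graphs of `bowties_upper` also show that
there are graphs with the prescribed number of edges, so that the infimum in `supersat` is attained.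
-/
theorem supersat_bowtie_bounds {c : ℝ} (hc : 0 < c) :
    ∃ δ : ℝ, 0 < δ ∧ ∀ n q : ℕ, 1 / δ ≤ (n : ℝ) → (q : ℝ) ≤ δ * (n : ℝ) ^ 2 →
      ∀ d m e₁ e₂ : ℕ, 2 * (q + 1) = d * n + m → m < n →
      e₁ = ⌊(d : ℝ) * n / 4 + min (m : ℝ) ((n : ℝ) / 2) / 2⌋₊ → e₂ = q + 1 - e₁ →
      (1 - c) * mainTerm n d m e₁ e₂ ≤ (supersat bowtie n q : ℝ) ∧
        (supersat bowtie n q : ℝ) ≤ (1 + c) * mainTerm n d m e₁ e₂ := by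
  have hc' : 0 < min c 1 := by positivity
  obtain ⟨δ₀, hδ₀, hex⟩ := extremalNumber_bowtie
  obtain ⟨δ₁, hδ₁, hlow⟩ := bowties_lower hc' (min_le_right _ _)
  obtain ⟨δ₂, hδ₂, hup⟩ := bowties_upper hc' (min_le_right _ _)
  obtain ⟨δ, hδ, hd₀, hd₁, hd₂, hd₃⟩ : ∃ δ : ℝ, 0 < δ ∧ δ ≤ δ₀ ∧ δ ≤ δ₁ / 2 ∧ δ ≤ δ₂ / 2 ∧
      δ ≤ 1 / 5 :=
    ⟨min (min δ₀ (δ₁ / 2)) (min (δ₂ / 2) (1 / 5)), by positivity,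
      (min_le_left _ _).trans (min_le_left _ _), (min_le_left _ _).trans (min_le_right _ _),
      (min_le_right _ _).trans (min_le_left _ _), (min_le_right _ _).trans (min_le_right _ _)⟩
  refine ⟨δ, hδ, fun n q hn hq d m e₁ e₂ hm hmn he₁ he₂ => ?_⟩
  have hδn := (div_le_iff₀ hδ).1 hn
  have hn5 : (5 : ℝ) ≤ n := by
    have := mul_le_mul_of_nonneg_left hd₃ (Nat.cast_nonneg n : (0 : ℝ) ≤ n)
    linarith
  have hn5' : 5 ≤ n := by exact_mod_cast hn5
  have hq1 : ((q + 1 : ℕ) : ℝ) ≤ 2 * δ * n ^ 2 := by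
    push_cast
    nlinarith
  have hadapt : ∀ δ' : ℝ, δ ≤ δ' / 2 → 1 / δ' ≤ n ∧ ((q + 1 : ℕ) : ℝ) ≤ δ' * n ^ 2 := by
    intro δ' h
    refine ⟨(one_div_le_one_div_of_le hδ (by linarith)).trans hn, hq1.trans ?_⟩
    exact mul_le_mul_of_nonneg_right (by linarith) (sq_nonneg _)
  obtain ⟨k₁, k₁'⟩ := hadapt δ₁ hd₁
  obtain ⟨k₂, k₂'⟩ := hadapt δ₂ hd₂
  have hexn := hex n ((one_div_le_one_div_of_le hδ hd₀).trans hn)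
  obtain ⟨hee, -⟩ := floor_split hm he₁ he₂
  have hM := mainTerm_nonneg hm hee
  have hmin : min c 1 * mainTerm n d m e₁ e₂ ≤ c * mainTerm n d m e₁ e₂ :=
    mul_le_mul_of_nonneg_right (min_le_left _ _) hM
  obtain ⟨G, hG, hB⟩ := hup n (q + 1) k₂ k₂' (by omega) d m e₁ e₂ hm hmn he₁ he₂
  have hmem : G.copyCount bowtie ∈ {k : ℕ | ∃ H : SimpleGraph (Fin n),
      H.edgeSet.ncard = SimpleGraph.extremalNumber n bowtie + q ∧ H.copyCount bowtie = k} :=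
    ⟨G, by rw [hG, hexn]; ring, rfl⟩
  constructor
  · rcases Nat.eq_zero_or_pos q with rfl | hq0
    · -- the lower bound for the number of bowties needs two inner edges, but here `M = 0`
      rw [mainTerm_eq_zero hm (by omega) hee, mul_zero]
      positivity
    · obtain ⟨H, hH, hHk⟩ := Nat.sInf_mem ⟨_, hmem⟩
      have h := hlow n (q + 1) k₁ k₁' (by omega) d m e₁ e₂ hm hmn he₁ he₂ H
        (by rw [hH, hexn]; omega)
      rw [bowties_eq, hHk] at h
      rw [supersat]
      linarith
  · have hle : (supersat bowtie n q : ℝ) ≤ (G.copyCount bowtie : ℝ) := by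
      exact_mod_cast Nat.sInf_le hmem
    rw [bowties_eq] at hB
    linarith

/-- For `t` much larger than `n` the two classes share the inner edges almost equally, and the main
term is close to `9 / 8 * t ^ 2 * n`. -/
lemma mainTerm_ge_of_large {n d m e₁ e₂ t : ℕ} (hn : 4 ≤ n) (hnt : n ≤ t)
    (hm : 2 * t = d * n + m) (hmn : m < n)
    (he₁ : e₁ = ⌊(d : ℝ) * n / 4 + min (m : ℝ) ((n : ℝ) / 2) / 2⌋₊) (he₂ : e₂ = t - e₁) :
    9 * (t : ℝ) ^ 2 * n - 20 * n ^ 2 * t ≤ 8 * mainTerm n d m e₁ e₂ := by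
  obtain ⟨hee, -⟩ := floor_split hm he₁ he₂
  rw [mainTerm_eq hm hee]
  have hnR : (4 : ℝ) ≤ n := by exact_mod_cast hn
  have hntR : (n : ℝ) ≤ t := by exact_mod_cast hnt
  have hmR : (2 : ℝ) * t = d * n + m := by exact_mod_cast hm
  have hmnR : (m : ℝ) < n := by exact_mod_cast hmn
  have hm0 : (0 : ℝ) ≤ m := by positivity
  have hmin1 : min (m : ℝ) ((n : ℝ) / 2) ≤ m := min_le_left _ _
  have hmin0 : 0 ≤ min (m : ℝ) ((n : ℝ) / 2) := le_min hm0 (by linarith)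
  have hle := Nat.floor_le (show (0 : ℝ) ≤ (d : ℝ) * n / 4 + min (m : ℝ) ((n : ℝ) / 2) / 2 by
    positivity)
  have hlt := Nat.lt_floor_add_one ((d : ℝ) * n / 4 + min (m : ℝ) ((n : ℝ) / 2) / 2)
  rw [← he₁] at hle hlt
  have he₂R : (e₂ : ℝ) = t - e₁ := by
    have : (e₁ : ℝ) + e₂ = t := by exact_mod_cast hee
    linarith
  have hdn : (d : ℝ) * n = 2 * t - m := by linarith
  have h1 : (2 * (e₁ : ℝ) - t) ^ 2 ≤ n ^ 2 := by
    apply sq_le_sq'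
    · linarith
    · linarith
  have h2 : (24 : ℝ) * (e₁ * e₂) = 6 * t ^ 2 - 6 * (2 * e₁ - t) ^ 2 := by rw [he₂R]; ring
  have h3 : 8 * (t : ℝ) * n * d - 2 * (n : ℝ) ^ 2 * d ^ 2 - 2 * (n : ℝ) ^ 2 * d
      = 8 * t ^ 2 - 2 * m ^ 2 - 2 * n * (2 * t - m) := by
    rw [← hdn]
    have : (m : ℝ) = 2 * t - d * n := by linarith
    rw [this]; ring
  have h4 : (m : ℝ) ^ 2 ≤ n ^ 2 := pow_le_pow_left₀ hm0 hmnR.le 2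
  have h5 : (n : ℝ) * n ≤ n * t := mul_le_mul_of_nonneg_left hntR (by linarith)
  have h6 : (4 : ℝ) * t ≤ n * t := mul_le_mul_of_nonneg_right hnR (by linarith)
  have h7 : (0 : ℝ) ≤ n * m := by positivity
  have key : 18 * (t : ℝ) ^ 2 - 40 * (n * t) ≤ 4 * (t : ℝ) ^ 2 - 4 * t + 24 * (e₁ * e₂)
      + 8 * t * n * d - 2 * (n : ℝ) ^ 2 * d ^ 2 - 2 * (n : ℝ) ^ 2 * d := by
    linarith
  have := mul_le_mul_of_nonneg_left key (show (0 : ℝ) ≤ n / 2 by positivity)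
  linarith

/-- When the number of extra edges is superlinear but subquadratic, the count is asymptotic to
`9 / 8 * q ^ 2 * n`. -/
theorem supersat_bowtie_isEquivalent {n q : ℕ → ℕ} (hn : Filter.Tendsto n Filter.atTop Filter.atTop)
    (hq : Filter.Tendsto (fun k => (q k : ℝ) / (n k : ℝ)) Filter.atTop Filter.atTop)
    (hq' : Filter.Tendsto (fun k => (q k : ℝ) / (n k : ℝ) ^ 2) Filter.atTop (nhds 0)) :
    Asymptotics.IsEquivalent Filter.atTop (fun k => (supersat bowtie (n k) (q k) : ℝ))
      (fun k => 9 / 8 * (q k : ℝ) ^ 2 * (n k : ℝ)) := by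
  rw [Asymptotics.IsEquivalent, Asymptotics.isLittleO_iff]
  intro ε hε
  obtain ⟨c, hc, hc1, hcε⟩ : ∃ c : ℝ, 0 < c ∧ c ≤ 1 ∧ 3 * c ≤ ε :=
    ⟨min 1 (ε / 3), by positivity, min_le_left _ _, by linarith [min_le_right 1 (ε / 3)]⟩
  obtain ⟨δ, hδ, hbound⟩ := supersat_bowtie_bounds hc
  have hnR : Filter.Tendsto (fun k => (n k : ℝ)) Filter.atTop Filter.atTop :=
    tendsto_natCast_atTop_atTop.comp hn
  filter_upwards [hnR.eventually_ge_atTop (1 / δ), hn.eventually_ge_atTop 4,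
    hq.eventually_ge_atTop (3 / c), hq'.eventually_lt_const hδ] with k h1 h2 h3 h4
  rw [Pi.sub_apply]
  generalize n k = N at *
  generalize q k = s at *
  have hN4 : (4 : ℝ) ≤ N := by exact_mod_cast h2
  have hN0 : (0 : ℝ) < N := by linarith
  have h4' : (s : ℝ) ≤ δ * N ^ 2 := ((div_lt_iff₀ (by positivity)).1 h4).le
  have h3' : 3 * (N : ℝ) ≤ c * s := by
    rw [le_div_iff₀ hN0, div_mul_eq_mul_div, div_le_iff₀ hc] at h3
    linarith
  have hNs : (N : ℝ) ≤ s := by nlinarith [(Nat.cast_nonneg s : (0 : ℝ) ≤ s)]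
  have hNs' : N ≤ s := by exact_mod_cast hNs
  have hm : 2 * (s + 1) = 2 * (s + 1) / N * N + 2 * (s + 1) % N := by
    rw [mul_comm]; exact (Nat.div_add_mod' _ _).symm ▸ rfl
  have hmn : 2 * (s + 1) % N < N := Nat.mod_lt _ (by omega)
  obtain ⟨hl, hu⟩ := hbound N s h1 h4' _ _ _ _ hm hmn rfl rfl
  obtain ⟨hee, -⟩ := floor_split hm rfl rfl
  have hM1 := mainTerm_le hm hee
  have hM2 := mainTerm_ge_of_large h2 (by omega) hm hmn rfl rfl
  generalize mainTerm _ _ _ _ _ = M at *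
  push_cast at hM1 hM2
  generalize (supersat bowtie N s : ℝ) = S at *
  have hs0 : (0 : ℝ) ≤ s := Nat.cast_nonneg s
  obtain ⟨X, hX⟩ : ∃ X, X = 9 / 8 * (s : ℝ) ^ 2 * N := ⟨_, rfl⟩
  rw [← hX]
  have hX0 : 0 ≤ X := by rw [hX]; positivity
  have hM1' : M ≤ (1 + c / 3) ^ 2 * X := by
    have k1 : (s : ℝ) + 1 ≤ (1 + c / 3) * s := by linarith
    have k2 := mul_le_mul_of_nonneg_right
      (pow_le_pow_left₀ (by positivity) k1 2) (show (0 : ℝ) ≤ 9 * N by positivity)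
    rw [hX]
    linarith
  have hM2' : (1 - c) * X ≤ M := by
    have k1 : (0 : ℝ) ≤ (c * s - 3 * N) * (20 / 3 * (s + 1)) :=
      mul_nonneg (by linarith) (by positivity)
    have k2 : 0 ≤ (1 - c) * ((s : ℝ) * 1) := mul_nonneg (by linarith) (by positivity)
    have k3 : 0 ≤ c * (s : ℝ) * (s + 1) := by positivity
    have k4 : 9 * (1 - c) * (s : ℝ) ^ 2 ≤ 9 * (s + 1) ^ 2 - 20 * N * (s + 1) := by
      linarith
    have k5 := mul_le_mul_of_nonneg_right k4 hN0.le
    rw [hX]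
    linarith
  have hupper : S ≤ (1 + 3 * c) * X := by
    refine (hu.trans (mul_le_mul_of_nonneg_left hM1' (by linarith))).trans ?_
    rw [← mul_assoc]
    refine mul_le_mul_of_nonneg_right ?_ hX0
    nlinarith [mul_nonneg hc.le (sub_nonneg.2 hc1), mul_nonneg (sq_nonneg c) (sub_nonneg.2 hc1)]
  have hlower : (1 - 2 * c) * X ≤ S := by
    refine le_trans ?_ ((mul_le_mul_of_nonneg_left hM2' (by linarith)).trans hl)
    rw [← mul_assoc (1 - c)]
    refine mul_le_mul_of_nonneg_right ?_ hX0
    nlinarith [sq_nonneg c]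
  rw [Real.norm_eq_abs, Real.norm_eq_abs, abs_of_nonneg hX0, abs_le]
  have := mul_le_mul_of_nonneg_right hcε hX0
  have := mul_nonneg hc.le hX0
  constructor <;> linarith

end Asymptotics

theorem theorem2 :
    -- the asymptotic formula
    (∀ c : ℝ, 0 < c → ∃ δ : ℝ, 0 < δ ∧
      ∀ n q : ℕ, 1 / δ ≤ (n : ℝ) → (q : ℝ) ≤ δ * (n : ℝ) ^ 2 →
      ∀ d m : ℕ, 2 * (q + 1) = d * n + m → m < n →
      ∀ e₁ e₂ : ℕ,
        e₁ = ⌊(d : ℝ) * n / 4 + min (m : ℝ) ((n : ℝ) / 2) / 2⌋₊ →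
        e₂ = q + 1 - e₁ →
      ∀ M : ℝ,
        M = (n : ℝ) / 2 * ((e₁.choose 2 : ℝ) + (e₂.choose 2 : ℝ)
            + (m : ℝ) * ((d + 1).choose 2 : ℝ) * ((n : ℝ) / 2)
            + ((n : ℝ) - m) * (d.choose 2 : ℝ) * ((n : ℝ) / 2)
            + 4 * (e₁ : ℝ) * (e₂ : ℝ)) →
        (1 - c) * M ≤ (supersat bowtie n q : ℝ) ∧
          (supersat bowtie n q : ℝ) ≤ (1 + c) * M) ∧
    -- the simplified formula when `q / n → ∞` (within the range `q = o(n ^ 2)`)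
    (∀ n q : ℕ → ℕ,
      Filter.Tendsto n Filter.atTop Filter.atTop →
      Filter.Tendsto (fun k => (q k : ℝ) / (n k : ℝ)) Filter.atTop Filter.atTop →
      Filter.Tendsto (fun k => (q k : ℝ) / (n k : ℝ) ^ 2) Filter.atTop (nhds 0) →
      Asymptotics.IsEquivalent Filter.atTop
        (fun k => (supersat bowtie (n k) (q k) : ℝ))
        (fun k => 9 / 8 * (q k : ℝ) ^ 2 * (n k : ℝ))) := by
  refine ⟨fun c hc => ?_, fun n q => supersat_bowtie_isEquivalent⟩
  obtain ⟨δ, hδ, h⟩ := supersat_bowtie_bounds hc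
  refine ⟨δ, hδ, ?_⟩
  rintro n q hn hq d m hm hmn e₁ e₂ he₁ he₂ _ rfl
  exact h n q hn hq d m e₁ e₂ hm hmn he₁ he₂
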